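/- **Notation.** For $\operatorname{Im}\tau>0$ let $q=e^{i\pi\tau}$, $G=\prod_{m\ge1}(1-q^{2m})$, $\theta_1(x)=G\sin x\prod_{m\ge1}(1-2q^{2m}\cos 2x+q^{4m})$, $\frac{\eta_1}{\pi}=\frac1{12}-2\sum_{m\ge1}\frac{q^{2m}}{(1-q^{2m})^2}$, and let $\wp$ be the Weierstrass function with periods $(\pi,\pi\tau)$. Let $(a)_m=a(a+1)\cdots(a+m-1)$. The non-stationary Lamé equation with parameters $(\kappa,g)$ is $$\Bigl(\frac{2i}{\pi}\kappa\frac{\partial}{\partial\tau}-\frac{\partial^2}{\partial x^2}+g(g-1)\wp(x)\Bigr)\psi(x,\tau)=E(\tau)\,\psi(x,\tau).$$ $C_n^{(g)}(z)=\sum_{k=0}^{\lfloor n/2\rfloor}\frac{(-1)^k(g)_{n-k}}{k!(n-2k)!}(2z)^{n-2k}$ denotes the Gegenbauer polynomial for $g\ne0$, and $C_n^{(0)}(\cos x)=\cos(nx)$. Write $C_n^{(g)}(z)=a_n^{(g)}(2z)^n+\dots$, where $a_n^{(g)}=(g)_n/n!$ for $g\neq0$, $a_n^{(0)}=\frac12$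 for $n\ge1$ and $a_0^{(0)}=1$. A function is *of Gegenbauer form with coupling $g$ and degree $n$* if it is $$\psi(x,\tau)=(\theta_1(x)^2)^{g/2}\,\mathcal P(\cos x,q),\qquad \mathcal P(z,q)=C_n^{(g)}(z)+\sum_{\ell\ge1}\mathcal P^{(\ell)}(z)\,q^{2\ell},$$ where $\mathcal P^{(\ell)}$ is a polynomial of degree at most $n+2\ell$, and $\mathcal P$ is analytic, with this expansion convergent, on $\{(\cos x,q): |q|e^{|\operatorname{Im}x|}<1\}$ (so $\mathcal P(\cos x,e^{i\pi\tau})$ is analytic for $|\operatorname{Im}x|<\pi\operatorname{Im}\tau$). Near real $x\notin\pi\mathbb Z$ the power is the branch analytic in $(x,\tau)$ that tends to $(\sin^2x)^{g/2}$ as $q\to0$. **Theorem.** Let $\kappa\in\mathbb Z$, $g\ge0$ real, and $n\ge\kappa$, $n\ge0$ an integer, with $(2g+\kappa)_{n-\kappa}\ne0$ (automatic if $2g+\kappa>0$). Let $\psi_{n,g}$ be of Gegenbauer form with coupling $g$ and degree $n$, and let it solve the non-stationary Lamé equation with parameters $(\kappa,g)$ for some $E_{n,g}(\tau)$, for all real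 $x\notin\pi\mathbb Z$ and all $\tau$ with $\operatorname{Im}\tau>0$. For $|\operatorname{Im}x|<\varepsilon<\pi\operatorname{Im}\tau$ put $$(K_{g+\kappa,g}\psi_{n,g})(x)=\mathcal N\int_{-\pi+i\varepsilon}^{\pi+i\varepsilon}\frac{dy}{2\pi}\,\frac{(\theta_1(x)^2)^{(g+\kappa)/2}(\theta_1(y)^2)^{g/2}}{\bigl(\theta_1(\frac{x+y}2)\theta_1(\frac{x-y}2)\bigr)^{2g+\kappa}}\,\psi_{n,g}(y),$$ $$\mathcal N=e^{-i\pi g}\,2^{-2(g+\kappa)}\,\frac{(n-\kappa)!\;a^{(g+\kappa)}_{n-\kappa}}{(2g+\kappa)_{n-\kappa}\;a^{(g)}_{n}}$$ (for $g>0$ and $g+\kappa>0$ this is $e^{-i\pi g}2^{-2(g+\kappa)}\frac{n!}{(2g+\kappa)_{n-\kappa}(g)_\kappa}$ with $(g)_\kappa=\Gamma(g+\kappa)/\Gamma(g)$). On the contour $(\theta_1(y)^2)^{g/2}$ and $\psi_{n,g}(y)$ denote the analytic continuations from $(0,\pi)$ to the strip $0<\operatorname{Im}y<\pi\operatorname{Im}\tau$,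 and the power in the denominator is the branch analytic for $|\operatorname{Im}x|<\operatorname{Im}y<2\pi\operatorname{Im}\tau-|\operatorname{Im}x|$ that, for real $q$, is positive at $x=0$, $y\in i\mathbb R$. Then: 1. the integral is well defined, and it does not depend on $\varepsilon$; 2. $K_{g+\kappa,g}\psi_{n,g}$ solves the non-stationary Lamé equation with parameters $(\kappa,g+\kappa)$ and $$E=E_{n,g}+4\kappa(1-2g-\kappa)\frac{\eta_1}{\pi}+6\kappa(2g+\kappa)\Bigl(\frac{\eta_1}{\pi}-\frac1{12}\Bigr)$$ for $|\operatorname{Im}x|<\varepsilon<\pi\operatorname{Im}\tau$, $\operatorname{Re}x\notin\pi\mathbb Z$; 3. it is an analytic function of $(x,\tau)$ on that region, and also where $\operatorname{Re}x\in\pi\mathbb Z$ if $g+\kappa\in\{0,2,4,\dots\}$; 4. it is of Gegenbauer form with coupling $g+\kappa$ and degree $n-\kappa$. -/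

import Mathlib

noncomputable section

namespace NSLame

open Complex

/-! ### Special functions -/

/-- The nome `q = exp(iπτ)`. -/
def nome (τ : ℂ) : ℂ := cexp ((Real.pi : ℂ) * I * τ)

/-- `G = ∏_{m ≥ 1} (1 - q^{2m})`. -/
def eulerG (τ : ℂ) : ℂ := ∏' m : ℕ, (1 - nome τ ^ (2 * (m + 1)))

/-- The odd theta function `θ₁(x) = G sin x ∏_{m ≥ 1} (1 - 2 q^{2m} cos 2x + q^{4m})`. -/
def theta1 (x τ : ℂ) : ℂ :=
  eulerG τ * Complex.sin x *
    ∏' m : ℕ, (1 - 2 * nome τ ^ (2 * (m + 1)) * Complex.cos (2 * x) + nome τ ^ (4 * (m + 1)))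

/-- `η₁/π = 1/12 - 2 ∑_{m ≥ 1} q^{2m} / (1 - q^{2m})²`. -/
def etaOverPi (τ : ℂ) : ℂ :=
  1 / 12 - 2 * ∑' m : ℕ, nome τ ^ (2 * (m + 1)) / (1 - nome τ ^ (2 * (m + 1))) ^ 2

/-- The pair of periods `(π, πτ)`. -/
def periods (τ : UpperHalfPlane) : PeriodPair where
  ω₁ := (Real.pi : ℂ)
  ω₂ := (Real.pi : ℂ) * (τ : ℂ)
  indep := by
    have hpi := Real.pi_ne_zero
    have hτ := τ.im_ne_zero
    rw [LinearIndependent.pair_iff]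
    intro a b h
    have h2 := congrArg Complex.im h
    have hb : b = 0 := by simpa [hpi, hτ] using h2
    subst hb
    have h1 := congrArg Complex.re h
    refine ⟨?_, rfl⟩
    simpa [hpi] using h1

/-- The Weierstrass function `℘(x)` with periods `(π, πτ)`. -/
def wp (τ : UpperHalfPlane) (x : ℂ) : ℂ := (periods τ).weierstrassP x

/-- The raising Pochhammer symbol `(a)_m = a (a + 1) ⋯ (a + m - 1)`. -/
def poch (a : ℝ) (m : ℕ) : ℝ := (ascPochhammer ℝ m).eval a

/-- The Gegenbauer polynomial `C_n^{(g)}`, by its explicit series for `g ≠ 0`. For `g = 0` (where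
that series vanishes identically if `n ≥ 1`) it is the Chebyshev polynomial, `cos x ↦ cos (n x)`,
which spans the limit of the lines spanned by `C_n^{(g)}` as `g → 0`. -/
def gegenbauer (g : ℝ) (n : ℕ) : Polynomial ℂ :=
  if g = 0 then Polynomial.Chebyshev.T ℂ n
  else ∑ k ∈ Finset.range (n / 2 + 1),
    Polynomial.C ((((-1) ^ k * poch g (n - k) / (k.factorial * (n - 2 * k).factorial) : ℝ)) : ℂ) *
      (2 * Polynomial.X) ^ (n - 2 * k)

/-- The number `a` with `C_n^{(g)}(z) = a (2z)^n + (lower order)`; it is `(g)_n / n!` for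
`g ≠ 0`. -/
def gegenbauerTop (g : ℝ) (n : ℕ) : ℝ :=
  if g = 0 then (if n = 0 then 1 else 1 / 2) else poch g n / n.factorial

/-! ### Powers of theta functions -/

/-- The logarithm of `θ₁(v) / sin v = ∏_{m ≥ 1} (1 - q^{2m}) (1 - q^{2m} e^{2iv})
(1 - q^{2m} e^{-2iv})` that is analytic for `|Im v| < π Im τ` and tends to `0` as `q → 0`: all
factors lie in the disc of radius `1` about `1`. -/
def logThetaReg (v τ : ℂ) : ℂ :=
  ∑' m : ℕ, (Complex.log (1 - nome τ ^ (2 * (m + 1))) +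
    Complex.log (1 - nome τ ^ (2 * (m + 1)) * cexp (2 * I * v)) +
    Complex.log (1 - nome τ ^ (2 * (m + 1)) * cexp (-(2 * I * v))))

/-- `(θ₁(x)²)^s` for `x` on the real line, and near it off `πℤ`: the branch that tends to
`(sin² x)^s > 0` as `q → 0` at real `x ∉ πℤ`. -/
def theta1SqPow (s x τ : ℂ) : ℂ :=
  (Complex.sin x ^ 2) ^ s * cexp (2 * s * logThetaReg x τ)

/-- The logarithm of `θ₁(y)²` that is analytic in the strip `0 < Im y < π Im τ` (the branch cuts
lie along the real line) and continues the one of `theta1SqPow` from the interval `(0, π)`. It uses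
`sin² y = - (1/4) e^{-2iy} (1 - e^{2iy})²`. -/
def logTheta1SqUpper (y τ : ℂ) : ℂ :=
  (Real.pi : ℂ) * I - 2 * I * y - (Real.log 4 : ℂ) + 2 * Complex.log (1 - cexp (2 * I * y)) +
    2 * logThetaReg y τ

/-- The logarithm of `θ₁((x+y)/2) θ₁((x-y)/2)` that is analytic for
`|Im x| < Im y < 2π Im τ - |Im x|` and real for `x` and `q` real and `y` purely imaginary and large. It uses
`sin((x+y)/2) sin((x-y)/2) = (1/4) e^{-iy} (1 - e^{i(y+x)}) (1 - e^{i(y-x)})`. -/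
def logTheta1Prod (x y τ : ℂ) : ℂ :=
  -(Real.log 4 : ℂ) - I * y + Complex.log (1 - cexp (I * (y + x))) +
    Complex.log (1 - cexp (I * (y - x))) +
    logThetaReg ((x + y) / 2) τ + logThetaReg ((x - y) / 2) τ

/-! The three definitions above are indeed logarithms and branches of the stated functions. -/

lemma norm_nome (τ : ℂ) : ‖nome τ‖ = Real.exp (-(Real.pi * τ.im)) := by
  rw [nome, Complex.norm_exp]
  congr 1
  simp

lemma one_sub_ne_zero_of_norm_lt {a : ℂ} (h : ‖a‖ < 1) : 1 - a ≠ 0 := by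
  intro h0
  have h1 : a = 1 := (sub_eq_zero.mp h0).symm
  rw [h1] at h
  simp at h

lemma norm_nome_lt_one {τ : ℂ} (hτ : 0 < τ.im) : ‖nome τ‖ < 1 := by
  rw [norm_nome]
  have := mul_pos Real.pi_pos hτ
  exact Real.exp_lt_one_iff.mpr (by linarith)

lemma norm_factor_lt {τ w : ℂ} (hτ : 0 < τ.im) (hw : ‖w‖ * ‖nome τ‖ ^ 2 < 1) (m : ℕ) :
    ‖nome τ ^ (2 * (m + 1)) * w‖ < 1 := by
  have h1 : ‖nome τ‖ ^ (2 * m) ≤ 1 := pow_le_one₀ (norm_nonneg _) (norm_nome_lt_one hτ).le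
  have h2 : ‖nome τ ^ (2 * (m + 1)) * w‖ = ‖nome τ‖ ^ (2 * m) * (‖w‖ * ‖nome τ‖ ^ 2) := by
    rw [norm_mul, norm_pow]
    ring
  rw [h2]
  have h3 : 0 ≤ ‖w‖ * ‖nome τ‖ ^ 2 := by positivity
  nlinarith

lemma summable_log_factor {τ : ℂ} (hτ : 0 < τ.im) (w : ℂ) :
    Summable fun m : ℕ => Complex.log (1 - nome τ ^ (2 * (m + 1)) * w) := by
  have h2 : ‖nome τ ^ 2‖ < 1 := by
    rw [norm_pow]
    exact pow_lt_one₀ (norm_nonneg _) (norm_nome_lt_one hτ) two_ne_zero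
  have h : Summable fun m : ℕ => -(nome τ ^ (2 * (m + 1)) * w) := by
    have h3 := (summable_geometric_of_norm_lt_one h2).mul_left (-(nome τ ^ 2 * w))
    refine h3.congr fun m => ?_
    rw [pow_mul]
    ring
  refine (Complex.summable_log_one_add_of_summable h).congr fun m => ?_
  rw [sub_eq_add_neg]

lemma norm_exp_factor {v τ : ℂ} (hv : |v.im| < Real.pi * τ.im) :
    ‖cexp (2 * I * v)‖ * ‖nome τ‖ ^ 2 < 1 ∧ ‖cexp (-(2 * I * v))‖ * ‖nome τ‖ ^ 2 < 1 := by
  rw [abs_lt] at hv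
  rw [norm_nome, Complex.norm_exp, Complex.norm_exp, ← Real.exp_nat_mul, ← Real.exp_add,
    ← Real.exp_add]
  constructor <;> refine Real.exp_lt_one_iff.mpr ?_ <;> simp <;> linarith

/-- `logThetaReg` is a logarithm of `θ₁(v) / sin v`. -/
lemma exp_logThetaReg {v τ : ℂ} (hτ : 0 < τ.im) (hv : |v.im| < Real.pi * τ.im) :
    Complex.sin v * cexp (logThetaReg v τ) = theta1 v τ := by
  obtain ⟨hp, hm⟩ := norm_exp_factor hv
  have h1 : ‖(1 : ℂ)‖ * ‖nome τ‖ ^ 2 < 1 := by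
    rw [norm_one, one_mul]
    exact pow_lt_one₀ (norm_nonneg _) (norm_nome_lt_one hτ) two_ne_zero
  have s0 : Summable fun m : ℕ => Complex.log (1 - nome τ ^ (2 * (m + 1))) := by
    simpa using summable_log_factor hτ 1
  have sp := summable_log_factor hτ (cexp (2 * I * v))
  have sm := summable_log_factor hτ (cexp (-(2 * I * v)))
  have n0 : ∀ m : ℕ, 1 - nome τ ^ (2 * (m + 1)) ≠ 0 := fun m => by
    simpa using one_sub_ne_zero_of_norm_lt (norm_factor_lt hτ h1 m)
  have np := fun m => one_sub_ne_zero_of_norm_lt (norm_factor_lt hτ hp m)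
  have nm := fun m => one_sub_ne_zero_of_norm_lt (norm_factor_lt hτ hm m)
  have key : ∀ m : ℕ, (1 - nome τ ^ (2 * (m + 1)) * cexp (2 * I * v)) *
      (1 - nome τ ^ (2 * (m + 1)) * cexp (-(2 * I * v))) =
      1 - 2 * nome τ ^ (2 * (m + 1)) * Complex.cos (2 * v) + nome τ ^ (4 * (m + 1)) := by
    intro m
    have e : cexp (2 * I * v) * cexp (-(2 * I * v)) = 1 := by
      rw [← Complex.exp_add, add_neg_cancel, Complex.exp_zero]
    have hc : 2 * Complex.cos (2 * v) = cexp (2 * I * v) + cexp (-(2 * I * v)) := by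
      rw [Complex.cos]
      ring_nf
    have e4 : nome τ ^ (4 * (m + 1)) = (nome τ ^ (2 * (m + 1))) ^ 2 := by
      rw [← pow_mul]
      ring_nf
    rw [e4]
    linear_combination (nome τ ^ (2 * (m + 1))) ^ 2 * e + nome τ ^ (2 * (m + 1)) * hc
  have hprod : ∏' m : ℕ, (1 - 2 * nome τ ^ (2 * (m + 1)) * Complex.cos (2 * v) +
      nome τ ^ (4 * (m + 1))) =
      cexp (∑' m : ℕ, Complex.log (1 - nome τ ^ (2 * (m + 1)) * cexp (2 * I * v))) *
      cexp (∑' m : ℕ, Complex.log (1 - nome τ ^ (2 * (m + 1)) * cexp (-(2 * I * v)))) := by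
    have a := Complex.hasProd_of_hasSum_log np sp.hasSum
    have b := Complex.hasProd_of_hasSum_log nm sm.hasSum
    exact ((a.mul b).congr_fun (fun m => (key m).symm)).tprod_eq
  have hG : eulerG τ = cexp (∑' m : ℕ, Complex.log (1 - nome τ ^ (2 * (m + 1)))) :=
    (Complex.cexp_tsum_eq_tprod n0 s0).symm
  have hsplit : logThetaReg v τ = ∑' m : ℕ, Complex.log (1 - nome τ ^ (2 * (m + 1))) +
      ∑' m : ℕ, Complex.log (1 - nome τ ^ (2 * (m + 1)) * cexp (2 * I * v)) +
      ∑' m : ℕ, Complex.log (1 - nome τ ^ (2 * (m + 1)) * cexp (-(2 * I * v))) := by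
    rw [logThetaReg, (s0.add sp).tsum_add sm, s0.tsum_add sp]
  rw [hsplit, theta1, hprod, hG, Complex.exp_add, Complex.exp_add]
  ring

lemma exp_log_four : cexp (Real.log 4 : ℂ) = 4 := by
  rw [← Complex.ofReal_exp, Real.exp_log (by norm_num)]
  norm_num

lemma one_sub_exp_ne_zero {u : ℂ} (hu : 0 < u.im) : 1 - cexp (I * u) ≠ 0 := by
  refine one_sub_ne_zero_of_norm_lt ?_
  rw [Complex.norm_exp]
  exact Real.exp_lt_one_iff.mpr (by simpa using hu)

/-- `logTheta1SqUpper` is a logarithm of `θ₁(y)²` in the upper strip. -/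
lemma exp_logTheta1SqUpper {y τ : ℂ} (hy : 0 < y.im) (hy' : y.im < Real.pi * τ.im) :
    cexp (logTheta1SqUpper y τ) = theta1 y τ ^ 2 := by
  have hτ : 0 < τ.im := by
    by_contra h
    nlinarith [Real.pi_pos]
  rw [← exp_logThetaReg hτ (by rw [abs_of_pos hy]; exact hy'), logTheta1SqUpper, Complex.exp_add,
    Complex.exp_add, Complex.exp_sub, Complex.exp_sub, exp_log_four, Complex.exp_pi_mul_I]
  have hne : 1 - cexp (2 * I * y) ≠ 0 := by
    have := one_sub_exp_ne_zero (u := 2 * y) (by simpa using hy)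
    rwa [show I * (2 * y) = 2 * I * y by ring] at this
  have e1 : cexp (2 * Complex.log (1 - cexp (2 * I * y))) = (1 - cexp (2 * I * y)) ^ 2 := by
    rw [two_mul, Complex.exp_add, Complex.exp_log hne]
    ring
  have e2 : cexp (2 * logThetaReg y τ) = cexp (logThetaReg y τ) ^ 2 := by
    rw [two_mul, Complex.exp_add]
    ring
  have e3 : cexp (2 * I * y) = cexp (y * I) ^ 2 := by
    rw [← Complex.exp_nat_mul]
    congr 1
    push_cast
    ring
  have e4 : cexp (-y * I) = (cexp (y * I))⁻¹ := by rw [← Complex.exp_neg]; ring_nf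
  have e5 := Complex.exp_ne_zero (y * I)
  rw [e1, e2, Complex.sin, e3, e4]
  field_simp
  linear_combination (-4 * (1 - cexp (y * I) ^ 2) ^ 2) * Complex.I_sq

/-- On the interval `(0, π)` the upper branch of `(θ₁(y)²)^s` agrees with `theta1SqPow`. -/
lemma exp_logTheta1SqUpper_ofReal (s τ : ℂ) {y : ℝ} (h0 : 0 < y) (h1 : y < Real.pi) :
    cexp (s * logTheta1SqUpper y τ) = theta1SqPow s y τ := by
  have hs : 0 < Real.sin y := Real.sin_pos_of_pos_of_lt_pi h0 h1
  have e0 : (1 : ℂ) - cexp (2 * I * y) =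
      ((2 * Real.sin y : ℝ) : ℂ) * cexp (((y - Real.pi / 2 : ℝ) : ℂ) * I) := by
    have a1 : ((y - Real.pi / 2 : ℝ) : ℂ) * I = (y : ℂ) * I - (Real.pi : ℂ) / 2 * I := by
      push_cast
      ring
    have a2 : cexp (2 * I * y) = cexp (y * I) ^ 2 := by
      rw [← Complex.exp_nat_mul]
      congr 1
      push_cast
      ring
    have a3 : cexp (-(y : ℂ) * I) = (cexp (y * I))⁻¹ := by rw [← Complex.exp_neg]; ring_nf
    have a4 := Complex.exp_ne_zero ((y : ℂ) * I)
    rw [a1, Complex.exp_sub, Complex.exp_pi_div_two_mul_I, a2]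
    push_cast
    rw [Complex.sin, a3]
    field_simp
  have e1 : Complex.log (1 - cexp (2 * I * y)) =
      (Real.log (2 * Real.sin y) : ℂ) + ((y - Real.pi / 2 : ℝ) : ℂ) * I := by
    rw [e0, Complex.log_ofReal_mul (by positivity) (Complex.exp_ne_zero _), Complex.log_exp]
    · simp; linarith [Real.pi_pos]
    · simp; linarith [Real.pi_pos]
  have e2 : Complex.sin (y : ℂ) ^ 2 = ((Real.sin y ^ 2 : ℝ) : ℂ) := by push_cast; rfl
  have e3 : (2 * Real.log (2 * Real.sin y) - Real.log 4 : ℝ) = Real.log (Real.sin y ^ 2) := by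
    rw [Real.log_mul two_ne_zero hs.ne', Real.log_pow, show (4 : ℝ) = 2 ^ 2 by norm_num,
      Real.log_pow]
    push_cast
    ring
  have hne : ((Real.sin y ^ 2 : ℝ) : ℂ) ≠ 0 := by
    exact_mod_cast (pow_pos hs 2).ne'
  rw [theta1SqPow, e2, Complex.cpow_def_of_ne_zero hne, ← Complex.exp_add,
    ← Complex.ofReal_log (by positivity), ← e3, logTheta1SqUpper, e1]
  congr 1
  push_cast
  ring

/-- `logTheta1Prod` is a logarithm of `θ₁((x+y)/2) θ₁((x-y)/2)`. -/
lemma exp_logTheta1Prod {x y τ : ℂ} (hy : |x.im| < y.im)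
    (hy' : y.im < 2 * (Real.pi * τ.im) - |x.im|) :
    cexp (logTheta1Prod x y τ) = theta1 ((x + y) / 2) τ * theta1 ((x - y) / 2) τ := by
  have hx1 := le_abs_self x.im
  have hx2 := neg_abs_le x.im
  have hx3 := abs_nonneg x.im
  have hτ : 0 < τ.im := by
    by_contra h
    nlinarith [Real.pi_pos]
  have b1 : |((x + y) / 2).im| < Real.pi * τ.im := by
    rw [show ((x + y) / 2).im = (x.im + y.im) / 2 by simp, abs_lt]
    constructor <;> linarith
  have b2 : |((x - y) / 2).im| < Real.pi * τ.im := by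
    rw [show ((x - y) / 2).im = (x.im - y.im) / 2 by simp, abs_lt]
    constructor <;> linarith
  rw [← exp_logThetaReg hτ b1, ← exp_logThetaReg hτ b2, logTheta1Prod, Complex.exp_add,
    Complex.exp_add, Complex.exp_add, Complex.exp_add, Complex.exp_sub, Complex.exp_neg,
    exp_log_four,
    Complex.exp_log (one_sub_exp_ne_zero (by simp; linarith)),
    Complex.exp_log (one_sub_exp_ne_zero (by simp; linarith))]
  have c1 : cexp ((x + y) / 2 * I) = cexp (x / 2 * I) * cexp (y / 2 * I) := by
    rw [← Complex.exp_add]; ring_nf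
  have c2 : cexp (-((x + y) / 2) * I) = (cexp (x / 2 * I))⁻¹ * (cexp (y / 2 * I))⁻¹ := by
    rw [← Complex.exp_neg, ← Complex.exp_neg, ← Complex.exp_add]; ring_nf
  have c3 : cexp ((x - y) / 2 * I) = cexp (x / 2 * I) * (cexp (y / 2 * I))⁻¹ := by
    rw [← Complex.exp_neg, ← Complex.exp_add]; ring_nf
  have c4 : cexp (-((x - y) / 2) * I) = (cexp (x / 2 * I))⁻¹ * cexp (y / 2 * I) := by
    rw [← Complex.exp_neg, ← Complex.exp_add]; ring_nf
  have c5 : cexp (I * (y + x)) = cexp (x / 2 * I) ^ 2 * cexp (y / 2 * I) ^ 2 := by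
    rw [← Complex.exp_nat_mul, ← Complex.exp_nat_mul, ← Complex.exp_add]
    congr 1; push_cast; ring
  have c6 : cexp (I * (y - x)) = (cexp (x / 2 * I))⁻¹ ^ 2 * cexp (y / 2 * I) ^ 2 := by
    rw [← Complex.exp_neg, ← Complex.exp_nat_mul, ← Complex.exp_nat_mul, ← Complex.exp_add]
    congr 1; push_cast; ring
  have c7 : cexp (I * y) = cexp (y / 2 * I) ^ 2 := by
    rw [← Complex.exp_nat_mul]
    congr 1; push_cast; ring
  have d1 := Complex.exp_ne_zero (x / 2 * I)
  have d2 := Complex.exp_ne_zero (y / 2 * I)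
  rw [Complex.sin, Complex.sin, c1, c2, c3, c4, c5, c6, c7]
  field_simp
  ring_nf
  simp only [Complex.I_sq]
  ring

/-! ### The functions `ψ_{n,g}` -/

/-- The domain of `𝒫(z, q)`: all `(cos x, q)` with `|q| < 1` and `|q| e^{|Im x|} < 1`. With
`q = e^{iπτ}` the latter is the strip `|Im x| < π Im τ`. -/
def domain : Set (ℂ × ℂ) :=
  {p | ∃ x : ℂ, Complex.cos x = p.1 ∧ ‖p.2‖ * Real.exp |x.im| < 1}

/-- `𝒫(z, q)` is analytic and `𝒫(z, q) = C_n^{(g)}(z) + ∑_{ℓ ≥ 1} 𝒫^{(ℓ)}(z) q^{2ℓ}` with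
`𝒫^{(ℓ)}` a polynomial of degree at most `n + 2ℓ`. -/
def HasGegenbauerForm (g : ℝ) (n : ℕ) (P : ℂ → ℂ → ℂ) : Prop :=
  AnalyticOnNhd ℂ (fun p : ℂ × ℂ => P p.1 p.2) domain ∧
  ∃ p : ℕ → Polynomial ℂ,
    p 0 = gegenbauer g n ∧
    (∀ ℓ, (p ℓ).natDegree ≤ n + 2 * ℓ) ∧
    ∀ z q : ℂ, (z, q) ∈ domain → HasSum (fun ℓ => (p ℓ).eval z * q ^ (2 * ℓ)) (P z q)

/-- `ψ(x, τ) = (θ₁(x)²)^{g/2} 𝒫(cos x)`. -/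
def lameFn (g : ℝ) (P : ℂ → ℂ → ℂ) (x τ : ℂ) : ℂ :=
  theta1SqPow ((g / 2 : ℝ) : ℂ) x τ * P (Complex.cos x) (nome τ)

/-- The analytic continuation of `ψ` from the interval `(0, π)` to the strip
`0 < Im y < π Im τ`, where the contour lies. -/
def lameFnUpper (g : ℝ) (P : ℂ → ℂ → ℂ) (y τ : ℂ) : ℂ :=
  cexp (((g / 2 : ℝ) : ℂ) * logTheta1SqUpper y τ) * P (Complex.cos y) (nome τ)

/-- The non-stationary Lamé equation with parameters `(κ, g)` and generalized energy `E`,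
at the point `(x, τ)`. -/
def LameEqAt (κ g : ℝ) (ψ : ℂ → ℂ → ℂ) (E : ℂ) (x : ℂ) (τ : UpperHalfPlane) : Prop :=
  2 * I / (Real.pi : ℂ) * (κ : ℂ) * deriv (fun t : ℂ => ψ x t) (τ : ℂ)
    - iteratedDeriv 2 (fun u : ℂ => ψ u (τ : ℂ)) x
    + (g : ℂ) * ((g : ℂ) - 1) * wp τ x * ψ x (τ : ℂ) = E * ψ x (τ : ℂ)

/-! ### The integral transform -/

/-- The kernel `(θ₁(x)²)^{(g+κ)/2} (θ₁(y)²)^{g/2} / (θ₁((x+y)/2) θ₁((x-y)/2))^{2g+κ}`, for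
`|Im x| < Im y < π Im τ`. -/
def kernel (g : ℝ) (κ : ℤ) (x y τ : ℂ) : ℂ :=
  theta1SqPow (((g + κ) / 2 : ℝ) : ℂ) x τ *
    cexp (((g / 2 : ℝ) : ℂ) * logTheta1SqUpper y τ) /
    cexp (((2 * g + κ : ℝ) : ℂ) * logTheta1Prod x y τ)

/-- The normalization constant
`e^{-iπg} 2^{-2(g+κ)} (n-κ)! a(g+κ, n-κ) / ((2g+κ)_{n-κ} a(g, n))`, with `a` the normalized top
coefficient of the Gegenbauer polynomials. For `g > 0` and `g + κ ≠ 0` it is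
`e^{-iπg} 2^{-2(g+κ)} n! / ((2g+κ)_{n-κ} (g)_κ)`, with `1/(g)_κ = (g+κ)_{n-κ} / (g)_n`. -/
def normConst (g : ℝ) (κ : ℤ) (n : ℕ) : ℂ :=
  cexp (-((Real.pi : ℂ) * I * (g : ℂ))) *
    (((2 : ℝ) ^ (-(2 * (g + κ))) * ((n - κ).toNat.factorial * gegenbauerTop (g + κ) (n - κ).toNat) /
      (poch (2 * g + κ) (n - κ).toNat * gegenbauerTop g n) : ℝ) : ℂ)

/-- The integrand of the transform at the point `y = t + iε` of the contour. -/
def integrand (g : ℝ) (κ : ℤ) (ε : ℝ) (φ : ℂ → ℂ → ℂ) (x τ : ℂ) (t : ℝ) : ℂ :=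
  kernel g κ x (t + ε * I) τ * φ (t + ε * I) τ / (2 * (Real.pi : ℂ))

/-- The integral transform `K_{g+κ,g}`, along the line from `-π + iε` to `π + iε`. -/
def transform (g : ℝ) (κ : ℤ) (n : ℕ) (ε : ℝ) (φ : ℂ → ℂ → ℂ) (x τ : ℂ) : ℂ :=
  normConst g κ n * ∫ t in (-Real.pi)..Real.pi, integrand g κ ε φ x τ t

/-- The shift of the generalized energy,
`4κ(1 - 2g - κ) η₁/π + 6κ(2g + κ)(η₁/π - 1/12)`. -/
def energyShift (g : ℝ) (κ : ℤ) (τ : ℂ) : ℂ :=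
  4 * (κ : ℂ) * (1 - 2 * (g : ℂ) - (κ : ℂ)) * etaOverPi τ +
    6 * (κ : ℂ) * (2 * (g : ℂ) + (κ : ℂ)) * (etaOverPi τ - 1 / 12)

end NSLame

end

/-! Divide out the power of θ₁. For ψ = (θ₁²)^{g/2} f, with f a function of x and Q = q², the heat
equation of θ₁ and ℘ = -(log θ₁)'' - 4η₁/π turn the Lamé equation into `reducedOp κ g f = E f`
(`lameEqAt_iff`). The coefficients of this operator are built from φ = θ₁'/θ₁ and remain meaningful
at Q = 0.

The core is `kernel_identity`. If f solves the reduced equation at y, then the operator with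
coupling g + κ, acting in (x, Q) on the kernel times f(y), less the shifted energy, gives the
y-derivative of a flux. It combines the heat equation at y and at (y ± x)/2 with the addition
theorem for φ at the zero-sum triples (x, -(y+x)/2, (y-x)/2) and (y, -(y+x)/2, -(y-x)/2). Since κ is
an integer, the integrand is 2π-periodic in y. Hence the flux integrates to zero
(`reducedOp_reducedTransform`), and Cauchy's theorem makes the height of the contour immaterial
(`reducedTransform_congr`).

The heat equation and the addition theorem are identities between functions of w = e^{2ix}. In each,
the relevant combination is invariant under w ↦ Qw and its poles cancel, so it is constant by a
multiplicative Liouville theorem (`eq_const_of_mul_periodic`). The constant is read off at w = 1.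

For the Gegenbauer form, let the contour follow x at height |Im x| + δ. The kernel then contributes
e^{-κ|Im x|} and f contributes e^{n|Im x|}, so the transform is O(e^{(n-κ)|Im x|}) for |Q| e^{2|Im
x|} ≤ σ < 1. Cauchy's estimate in Q bounds its ℓ-th coefficient by a multiple of e^{(n-κ+2ℓ)|Im x|}.
That coefficient is entire, even and 2π-periodic, hence a polynomial in cos x of degree at most n -
κ + 2ℓ, and the same estimates give convergence (`exists_cosSeries_reducedTransform`).

The leading polynomial is found by letting Q → 0 in both equations. Eliminating E leaves the
Gegenbauer equation of degree n - κ and coupling g + κ (`gegOp_eq_zero_of_reducedOp`). The condition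
(2g+κ)_{n-κ} ≠ 0 excludes resonance, so the top coefficient determines the solution
(`eq_of_gegOp_eq_zero`). This coefficient comes from the limit Im x → ∞ at Q = 0, where the integral
extracts the Taylor coefficient of w^{n-κ} in (1-w)^{-(2g+κ)} (`coeff_transform_zero`). The
normalization is chosen to match it.

Joint analyticity follows throughout from Osgood's lemma (`analyticOnNhd_of_separately`). -/

noncomputable section

namespace NSLame

open Complex Set Filter Topology Metric MeasureTheory
open scoped BoundedContinuousFunction

/-! ### Analyticity in two complex variables -/

/-- The circle parametrization in one of two real variables, as a bounded continuous function. -/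
def circleBCF (k : C(ℝ × ℝ, ℝ)) (c : ℂ) (r : ℝ) : (ℝ × ℝ) →ᵇ ℂ :=
  BoundedContinuousFunction.ofNormedAddCommGroup (fun t => circleMap c r (k t))
    ((continuous_circleMap c r).comp k.continuous) (‖c‖ + |r|) (fun t => by
      rw [circleMap]
      refine (norm_add_le _ _).trans ?_
      simp)

/-- Inversion in a Banach algebra is analytic at units. Applied to bounded continuous functions on
the parameter plane, this makes the Cauchy kernel analytic in z as a function-valued map. The
distance r - ‖z - c‖ to the circle bounds the inverse. -/
lemma analyticAt_inverse_circleBCF (k : C(ℝ × ℝ, ℝ)) {c : ℂ} {r : ℝ} {z : ℂ} (hz : z ∈ ball c r) :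
    AnalyticAt ℂ (fun z : ℂ => Ring.inverse (circleBCF k c r - algebraMap ℂ _ z)) z ∧
    ∀ t, Ring.inverse (circleBCF k c r - algebraMap ℂ ((ℝ × ℝ) →ᵇ ℂ) z) t =
      (circleMap c r (k t) - z)⁻¹ := by
  have hd : ∀ t, r - ‖z - c‖ ≤ ‖circleMap c r (k t) - z‖ := fun t => by
    have h1 : circleMap c r (k t) - z = circleMap 0 r (k t) - (z - c) := by
      simp [circleMap]; ring
    have h2 := norm_sub_norm_le (circleMap 0 r (k t)) (z - c)
    rw [h1]
    refine le_trans ?_ h2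
    have : r ≤ ‖circleMap 0 r (k t)‖ := by simp [le_abs_self]
    linarith
  have hpos : 0 < r - ‖z - c‖ := by
    rw [mem_ball, dist_eq_norm] at hz; linarith
  have hne : ∀ t, circleMap c r (k t) - z ≠ 0 := fun t h => by
    have := hd t
    rw [h, norm_zero] at this
    linarith
  let g : (ℝ × ℝ) →ᵇ ℂ := BoundedContinuousFunction.ofNormedAddCommGroup
    (fun t => (circleMap c r (k t) - z)⁻¹)
    ((((continuous_circleMap c r).comp k.continuous).sub continuous_const).inv₀ hne)
    ((r - ‖z - c‖)⁻¹) (fun t => by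
      rw [norm_inv]
      exact inv_anti₀ hpos (hd t))
  have h1 : (circleBCF k c r - algebraMap ℂ ((ℝ × ℝ) →ᵇ ℂ) z) * g = 1 := by
    ext t
    exact mul_inv_cancel₀ (hne t)
  let u : ((ℝ × ℝ) →ᵇ ℂ)ˣ := ⟨circleBCF k c r - algebraMap ℂ ((ℝ × ℝ) →ᵇ ℂ) z, g, h1, by
    rw [mul_comm]; exact h1⟩
  refine ⟨?_, fun t => ?_⟩
  · have := analyticAt_inverse (𝕜 := ℂ) u
    refine AnalyticAt.fun_comp (g := Ring.inverse) this ?_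
    have h2 : AnalyticAt ℂ (fun z : ℂ => algebraMap ℂ ((ℝ × ℝ) →ᵇ ℂ) z) z :=
      (Algebra.linearMap ℂ ((ℝ × ℝ) →ᵇ ℂ)).mkContinuous 1 (fun x => by
        simp) |>.analyticAt z
    exact analyticAt_const.sub h2
  · have : Ring.inverse (circleBCF k c r - algebraMap ℂ ((ℝ × ℝ) →ᵇ ℂ) z) = g :=
      Ring.inverse_unit u
    rw [this]
    rfl

/-- Iterated integration over `[0, 2π]²` as a continuous functional. -/
def torusFunctional : ((ℝ × ℝ) →ᵇ ℂ) →L[ℂ] ℂ :=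
  LinearMap.mkContinuous
    { toFun := fun φ => ∫ s in (0 : ℝ)..(2 * Real.pi), ∫ t in (0 : ℝ)..(2 * Real.pi), φ (s, t)
      map_add' := fun φ χ => by
        have hc : ∀ φ : (ℝ × ℝ) →ᵇ ℂ, Continuous fun s =>
            ∫ t in (0 : ℝ)..(2 * Real.pi), φ (s, t) := fun φ =>
          intervalIntegral.continuous_parametric_intervalIntegral_of_continuous'
            (f := fun s t => φ (s, t)) φ.continuous _ _
        rw [← intervalIntegral.integral_add ((hc φ).intervalIntegrable _ _)
          ((hc χ).intervalIntegrable _ _)]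
        congr 1; funext s
        rw [← intervalIntegral.integral_add]
        · rfl
        · exact (φ.continuous.comp (by fun_prop : Continuous fun t : ℝ => (s, t))).intervalIntegrable _ _
        · exact (χ.continuous.comp (by fun_prop : Continuous fun t : ℝ => (s, t))).intervalIntegrable _ _
      map_smul' := fun a φ => by
        simp [intervalIntegral.integral_const_mul] }
    ((2 * Real.pi) * (2 * Real.pi)) (fun φ => by
      have hpi := Real.pi_pos
      have h1 : ∀ s, ‖∫ t in (0 : ℝ)..(2 * Real.pi), φ (s, t)‖ ≤ ‖φ‖ * |2 * Real.pi - 0| := fun s =>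
        intervalIntegral.norm_integral_le_of_norm_le_const fun t _ => φ.norm_coe_le_norm _
      refine (intervalIntegral.norm_integral_le_of_norm_le_const fun s _ => h1 s).trans ?_
      rw [sub_zero, abs_of_pos (by positivity)]
      apply le_of_eq
      ring)

/-- Osgood's lemma: a continuous function of two complex variables that is holomorphic in each of
them is analytic. -/
theorem analyticOnNhd_of_separately {f : ℂ × ℂ → ℂ} {U : Set (ℂ × ℂ)} (hU : IsOpen U)
    (hc : ContinuousOn f U)
    (h1 : ∀ p ∈ U, DifferentiableAt ℂ (fun z => f (z, p.2)) p.1)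
    (h2 : ∀ p ∈ U, DifferentiableAt ℂ (fun w => f (p.1, w)) p.2) :
    AnalyticOnNhd ℂ f U := by
  rintro ⟨a, b⟩ hab
  obtain ⟨r, hr, hrU⟩ : ∃ r > 0, closedBall a r ×ˢ closedBall b r ⊆ U := by
    obtain ⟨r, hr, h⟩ := Metric.nhds_basis_closedBall.mem_iff.mp (hU.mem_nhds hab)
    refine ⟨r, hr, ?_⟩
    rwa [closedBall_prod_same]
  have hmem : ∀ {z w : ℂ}, z ∈ closedBall a r → w ∈ closedBall b r → (z, w) ∈ U :=
    fun hz hw => hrU ⟨hz, hw⟩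
  have hcm : ∀ (c : ℂ) (t : ℝ), circleMap c r t ∈ closedBall c r := fun c t =>
    circleMap_mem_closedBall c hr.le t
  let k1 : C(ℝ × ℝ, ℝ) := ⟨Prod.fst, continuous_fst⟩
  let k2 : C(ℝ × ℝ, ℝ) := ⟨Prod.snd, continuous_snd⟩
  have hcont : Continuous fun t : ℝ × ℝ => f (circleMap a r t.1, circleMap b r t.2) := by
    refine hc.comp_continuous ?_ fun t => hmem (hcm a _) (hcm b _)
    exact ((continuous_circleMap a r).comp continuous_fst).prodMk
      ((continuous_circleMap b r).comp continuous_snd)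
  obtain ⟨M, hM⟩ : ∃ M, ∀ p ∈ closedBall a r ×ˢ closedBall b r, ‖f p‖ ≤ M :=
    (((isCompact_closedBall a r).prod (isCompact_closedBall b r))).exists_bound_of_continuousOn
      (hc.mono hrU)
  let φ : (ℝ × ℝ) →ᵇ ℂ := BoundedContinuousFunction.ofNormedAddCommGroup
    (fun t => f (circleMap a r t.1, circleMap b r t.2)) hcont M
    (fun t => hM _ ⟨hcm a _, hcm b _⟩)
  -- The integrand of the iterated Cauchy formula as an element of the algebra. The factors
  -- `circleBCF _ 0 r * I` are the derivatives of the two circle parametrizations.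
  let G : ℂ × ℂ → ((ℝ × ℝ) →ᵇ ℂ) := fun p =>
    ((circleBCF k1 0 r * algebraMap ℂ _ I) * (circleBCF k2 0 r * algebraMap ℂ _ I) * φ) *
      (Ring.inverse (circleBCF k1 a r - algebraMap ℂ _ p.1) *
      Ring.inverse (circleBCF k2 b r - algebraMap ℂ _ p.2))
  have hG : AnalyticAt ℂ G (a, b) := by
    refine AnalyticAt.mul analyticAt_const (AnalyticAt.mul ?_ ?_)
    · exact AnalyticAt.comp (f := Prod.fst) (x := (a, b))
        (analyticAt_inverse_circleBCF k1 (mem_ball_self hr)).1 analyticAt_fst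
    · exact AnalyticAt.comp (f := Prod.snd) (x := (a, b))
        (analyticAt_inverse_circleBCF k2 (mem_ball_self hr)).1 analyticAt_snd
  have key : AnalyticAt ℂ
      (fun p => (2 * Real.pi * I : ℂ)⁻¹ * (2 * Real.pi * I : ℂ)⁻¹ * torusFunctional (G p)) (a, b) :=
    analyticAt_const.mul ((torusFunctional.analyticAt _).comp hG)
  refine key.congr ?_
  have hnb : ball a r ×ˢ ball b r ∈ 𝓝 (a, b) := prod_mem_nhds (ball_mem_nhds a hr) (ball_mem_nhds b hr)
  filter_upwards [hnb] with p hp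
  obtain ⟨hz, hw⟩ := hp
  have c1 := circleIntegral_sub_inv_smul_of_differentiable_on_off_countable (s := ∅)
    countable_empty hz (f := fun z => f (z, p.2))
    (hc.comp (by fun_prop) fun z hz => hmem hz (ball_subset_closedBall hw))
    (fun z hz => h1 (z, p.2) (hmem (ball_subset_closedBall hz.1) (ball_subset_closedBall hw)))
  have c2 : ∀ z ∈ closedBall a r, _ := fun z hz =>
    circleIntegral_sub_inv_smul_of_differentiable_on_off_countable (s := ∅)
    countable_empty hw (f := fun w => f (z, w))
    (hc.comp (by fun_prop) fun w hw => hmem hz hw)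
    (fun w hw => h2 (z, w) (hmem hz (ball_subset_closedBall hw.1)))
  have hpi : (2 * Real.pi * I : ℂ) ≠ 0 := by simp [Real.pi_ne_zero]
  have e1 : torusFunctional (G p) = (2 * Real.pi * I : ℂ) * ((2 * Real.pi * I : ℂ) * f p) := by
    have e2 : ∀ s t : ℝ, G p (s, t) = circleMap 0 r s * I * ((circleMap a r s - p.1)⁻¹ *
        (circleMap 0 r t * I * ((circleMap b r t - p.2)⁻¹ *
          f (circleMap a r s, circleMap b r t)))) := fun s t => by
      have e3 : G p (s, t) = ((circleMap 0 r s * I) * (circleMap 0 r t * I) *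
        f (circleMap a r s, circleMap b r t)) *
        (Ring.inverse (circleBCF k1 a r - algebraMap ℂ ((ℝ × ℝ) →ᵇ ℂ) p.1) (s, t) *
        Ring.inverse (circleBCF k2 b r - algebraMap ℂ ((ℝ × ℝ) →ᵇ ℂ) p.2) (s, t)) := rfl
      rw [e3, (analyticAt_inverse_circleBCF k1 hz).2, (analyticAt_inverse_circleBCF k2 hw).2]
      simp only [k1, k2, ContinuousMap.coe_mk]
      ring
    have e3 : torusFunctional (G p) = ∫ s in (0 : ℝ)..(2 * Real.pi),
      ∫ t in (0 : ℝ)..(2 * Real.pi), G p (s, t) := rfl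
    rw [e3]
    simp only [e2, intervalIntegral.integral_const_mul]
    rw [show f p = f (p.1, p.2) from rfl, ← smul_eq_mul (2 * Real.pi * I) (f (p.1, p.2)), ← c1,
      circleIntegral, ← intervalIntegral.integral_const_mul]
    congr 1; funext s
    have c3 := c2 (circleMap a r s) (hcm a s)
    rw [circleIntegral] at c3
    simp only [deriv_circleMap, smul_eq_mul] at c3 ⊢
    rw [c3]
    ring
  rw [e1]
  field_simp

/-- Locally uniform convergence gives continuity and holomorphy in each variable; Osgood's lemma
does the rest. -/
theorem analyticOnNhd_tsum {f : ℕ → ℂ × ℂ → ℂ} {U : Set (ℂ × ℂ)} (hU : IsOpen U)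
    (hf : ∀ m, AnalyticOnNhd ℂ (f m) U)
    (hb : ∀ p ∈ U, ∃ V ∈ 𝓝 p, ∃ u : ℕ → ℝ, Summable u ∧ ∀ m, ∀ q ∈ V, ‖f m q‖ ≤ u m) :
    AnalyticOnNhd ℂ (fun p => ∑' m, f m p) U := by
  intro p hp
  obtain ⟨V, hV, u, hu, hfu⟩ := hb p hp
  obtain ⟨W, hWs, hW, hpW⟩ := _root_.mem_nhds_iff.mp (Filter.inter_mem hV (hU.mem_nhds hp))
  have hd : ∀ m, ∀ q ∈ W, DifferentiableAt ℂ (f m) q := fun m q hq =>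
    (hf m q (hWs hq).2).differentiableAt
  refine analyticOnNhd_of_separately hW ?_ ?_ ?_ p hpW
  · exact continuousOn_tsum (fun m q hq => (hd m q hq).continuousAt.continuousWithinAt) hu
      fun m q hq => hfu m q (hWs hq).1
  · intro q hq
    have hO : IsOpen {z : ℂ | (z, q.2) ∈ W} := hW.preimage (by fun_prop)
    refine (differentiableOn_tsum_of_summable_norm (F := fun m z => f m (z, q.2)) hu
      (fun m z hz => ?_) hO fun m z hz => hfu m _ (hWs hz).1).differentiableAt (hO.mem_nhds hq)
    exact ((hd m _ hz).comp (f := fun z => (z, q.2)) z (by fun_prop)).differentiableWithinAt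
  · intro q hq
    have hO : IsOpen {z : ℂ | (q.1, z) ∈ W} := hW.preimage (by fun_prop)
    refine (differentiableOn_tsum_of_summable_norm (F := fun m z => f m (q.1, z)) hu
      (fun m z hz => ?_) hO fun m z hz => hfu m _ (hWs hz).1).differentiableAt (hO.mem_nhds hq)
    exact ((hd m _ hz).comp (f := fun z => (q.1, z)) z (by fun_prop)).differentiableWithinAt

lemma _root_.AnalyticAt.hasDerivAt_fst {f : ℂ × ℂ → ℂ} {p : ℂ × ℂ} (hf : AnalyticAt ℂ f p) :
    HasDerivAt (fun z => f (z, p.2)) (fderiv ℂ f p (1, 0)) p.1 :=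
  HasFDerivAt.comp_hasDerivAt (x := p.1) (f := fun z => (z, p.2)) (l := f)
    hf.differentiableAt.hasFDerivAt ((hasDerivAt_id _).prodMk (hasDerivAt_const _ _))

lemma _root_.AnalyticAt.hasDerivAt_snd {f : ℂ × ℂ → ℂ} {p : ℂ × ℂ} (hf : AnalyticAt ℂ f p) :
    HasDerivAt (fun z => f (p.1, z)) (fderiv ℂ f p (0, 1)) p.2 :=
  HasFDerivAt.comp_hasDerivAt (x := p.2) (f := fun z => (p.1, z)) (l := f)
    hf.differentiableAt.hasFDerivAt ((hasDerivAt_const _ _).prodMk (hasDerivAt_id _))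

/-- The partial derivative of `f` in the first variable. -/
def dfst (f : ℂ × ℂ → ℂ) (p : ℂ × ℂ) : ℂ := deriv (fun z => f (z, p.2)) p.1

/-- The partial derivative of `f` in the second variable. -/
def dsnd (f : ℂ × ℂ → ℂ) (p : ℂ × ℂ) : ℂ := deriv (fun z => f (p.1, z)) p.2

lemma _root_.AnalyticAt.dfst {f : ℂ × ℂ → ℂ} {p : ℂ × ℂ} (hf : AnalyticAt ℂ f p) :
    AnalyticAt ℂ (dfst f) p := by
  refine AnalyticAt.congr
    ((ContinuousLinearMap.apply ℂ ℂ ((1, 0) : ℂ × ℂ)).analyticAt _ |>.comp hf.fderiv) ?_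
  filter_upwards [hf.eventually_analyticAt] with q hq
  exact hq.hasDerivAt_fst.deriv.symm

lemma _root_.AnalyticAt.dsnd {f : ℂ × ℂ → ℂ} {p : ℂ × ℂ} (hf : AnalyticAt ℂ f p) :
    AnalyticAt ℂ (dsnd f) p := by
  refine AnalyticAt.congr
    ((ContinuousLinearMap.apply ℂ ℂ ((0, 1) : ℂ × ℂ)).analyticAt _ |>.comp hf.fderiv) ?_
  filter_upwards [hf.eventually_analyticAt] with q hq
  exact hq.hasDerivAt_snd.deriv.symm

lemma hasDerivAt_dfst {f : ℂ × ℂ → ℂ} {x q : ℂ} (hf : AnalyticAt ℂ f (x, q)) :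
    HasDerivAt (fun z => f (z, q)) (dfst f (x, q)) x :=
  hf.hasDerivAt_fst.differentiableAt.hasDerivAt

lemma hasDerivAt_dsnd {f : ℂ × ℂ → ℂ} {x q : ℂ} (hf : AnalyticAt ℂ f (x, q)) :
    HasDerivAt (fun z => f (x, z)) (dsnd f (x, q)) q :=
  hf.hasDerivAt_snd.differentiableAt.hasDerivAt

/-! ### Integrals with parameters and contour shifts -/

lemma continuousOn_intervalIntegral {X : Type*} [TopologicalSpace X] {F : X → ℝ → ℂ}
    {U : Set X} {a b : ℝ} (hF : ContinuousOn (fun p : X × ℝ => F p.1 p.2) (U ×ˢ univ)) :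
    ContinuousOn (fun z => ∫ t in a..b, F z t) U := by
  rw [continuousOn_iff_continuous_domRestrict]
  refine intervalIntegral.continuous_parametric_intervalIntegral_of_continuous'
    (f := fun (z : U) t => F z t) ?_ _ _
  exact hF.comp_continuous (f := fun p : U × ℝ => ((p.1 : X), p.2)) (by fun_prop)
    fun p => ⟨p.1.2, mem_univ _⟩

lemma hasDerivAt_intervalIntegral {F F' : ℂ → ℝ → ℂ} {U : Set ℂ} (hU : IsOpen U) {a b : ℝ}
    (hF : ContinuousOn (fun p : ℂ × ℝ => F p.1 p.2) (U ×ˢ univ))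
    (hF' : ContinuousOn (fun p : ℂ × ℝ => F' p.1 p.2) (U ×ˢ univ))
    (hd : ∀ z ∈ U, ∀ t, HasDerivAt (fun z => F z t) (F' z t) z) {z : ℂ} (hz : z ∈ U) :
    HasDerivAt (fun z => ∫ t in a..b, F z t) (∫ t in a..b, F' z t) z := by
  obtain ⟨r, hr, hrU⟩ := Metric.nhds_basis_closedBall.mem_iff.mp (hU.mem_nhds hz)
  obtain ⟨M, hM⟩ : ∃ M, ∀ p ∈ closedBall z r ×ˢ uIcc a b, ‖F' p.1 p.2‖ ≤ M :=
    ((isCompact_closedBall z r).prod isCompact_uIcc).exists_bound_of_continuousOn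
      (hF'.mono (prod_mono hrU (subset_univ _)))
  have hs : ∀ {G : ℂ → ℝ → ℂ}, ContinuousOn (fun p : ℂ × ℝ => G p.1 p.2) (U ×ˢ univ) →
      ∀ w ∈ U, Continuous (G w) := fun hG w hw =>
    hG.comp_continuous (f := fun t => (w, t)) (by fun_prop) fun t => ⟨hw, mem_univ _⟩
  refine (intervalIntegral.hasDerivAt_integral_of_dominated_loc_of_deriv_le (bound := fun _ => M)
    (ball_mem_nhds z hr) ?_ ((hs hF z hz).intervalIntegrable _ _)
    (hs hF' z hz).aestronglyMeasurable ?_ intervalIntegrable_const ?_).2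
  · filter_upwards [hU.mem_nhds hz] with w hw using (hs hF w hw).aestronglyMeasurable
  · exact .of_forall fun t ht w hw => hM (w, t) ⟨ball_subset_closedBall hw, uIoc_subset_uIcc ht⟩
  · exact .of_forall fun t _ w hw => hd w (hrU (ball_subset_closedBall hw)) t

/-- Cauchy's theorem on a rectangle one period wide: the integrals over the two vertical sides
cancel. -/
lemma integral_horizontal_eq {f : ℂ → ℂ} {α β : ℝ}
    (hf : DifferentiableOn ℂ f {z | α < z.im ∧ z.im < β})
    (hp : ∀ z : ℂ, α < z.im → z.im < β → f (z + 2 * Real.pi) = f z) {c d : ℝ}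
    (hc : α < c ∧ c < β) (hd : α < d ∧ d < β) :
    ∫ t in (-Real.pi)..Real.pi, f (t + c * I) = ∫ t in (-Real.pi)..Real.pi, f (t + d * I) := by
  have h := Complex.integral_boundary_rect_eq_zero_of_differentiableOn f
    (-Real.pi + c * I) (Real.pi + d * I) (hf.mono ?_)
  · simp only [add_re, neg_re, ofReal_re, mul_re, I_re, mul_zero, ofReal_im, I_im, mul_one,
      sub_self, add_zero, add_im, neg_im, mul_im, zero_add, neg_zero] at h
    have e : ∀ y ∈ uIcc c d, f ((Real.pi : ℝ) + y * I) = f ((-Real.pi : ℝ) + y * I) := by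
      intro y hy
      have hy' : α < y ∧ y < β := by
        rcases le_total c d with hcd | hcd
        · rw [uIcc_of_le hcd] at hy; exact ⟨hc.1.trans_le hy.1, hy.2.trans_lt hd.2⟩
        · rw [uIcc_of_ge hcd] at hy; exact ⟨hd.1.trans_le hy.1, hy.2.trans_lt hc.2⟩
      rw [← hp ((-Real.pi : ℝ) + y * I) (by simpa using hy'.1) (by simpa using hy'.2)]
      congr 1
      push_cast
      ring
    rw [intervalIntegral.integral_congr e] at h
    simpa [sub_eq_zero] using h
  · intro z hz
    have hz2 := hz.2
    simp only [add_im, neg_im, ofReal_im, neg_zero, mul_im, ofReal_re, I_im, mul_one, I_re,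
      mul_zero, add_zero, zero_add, mem_preimage] at hz2
    rcases le_total c d with hcd | hcd
    · rw [uIcc_of_le hcd] at hz2; exact ⟨hc.1.trans_le hz2.1, hz2.2.trans_lt hd.2⟩
    · rw [uIcc_of_ge hcd] at hz2; exact ⟨hd.1.trans_le hz2.1, hz2.2.trans_lt hc.2⟩

/-- The fundamental theorem of calculus; it disposes of the flux term in the kernel identity. -/
lemma integral_horizontal_deriv_eq_zero {f f' : ℂ → ℂ} {c : ℝ}
    (hf : ∀ t : ℝ, HasDerivAt f (f' (t + c * I)) (t + c * I))
    (hf' : Continuous fun t : ℝ => f' (t + c * I))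
    (hp : f ((Real.pi : ℂ) + c * I) = f (-(Real.pi : ℂ) + c * I)) :
    ∫ t in (-Real.pi)..Real.pi, f' (t + c * I) = 0 := by
  have h1 : ∀ t : ℝ, HasDerivAt (fun t : ℝ => f (t + c * I)) (f' (t + c * I)) t := fun t => by
    have := (hf t).comp_add_const (t : ℂ) (c * I)
    simpa using this.comp_ofReal
  rw [intervalIntegral.integral_eq_sub_of_hasDerivAt (fun t _ => h1 t)
    (hf'.intervalIntegrable _ _), hp]
  simp

/-! ### Functions invariant under `w ↦ Q w` -/

/-- `f` agrees near `w`, off `w`, with an analytic function. -/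
def RemovableAt (f : ℂ → ℂ) (w : ℂ) : Prop := ∃ g, AnalyticAt ℂ g w ∧ f =ᶠ[𝓝[≠] w] g

lemma _root_.AnalyticAt.removableAt {f : ℂ → ℂ} {w : ℂ} (h : AnalyticAt ℂ f w) : RemovableAt f w :=
  ⟨f, h, EventuallyEq.rfl⟩

lemma tendsto_mul_punctured {Q : ℂ} (hQ : Q ≠ 0) (w : ℂ) :
    Tendsto (fun v => Q * v) (𝓝[≠] w) (𝓝[≠] (Q * w)) := by
  refine tendsto_nhdsWithin_of_tendsto_nhds_of_eventually_within _ ?_ ?_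
  · exact ((continuous_const_mul Q).tendsto w).mono_left nhdsWithin_le_nhds
  · filter_upwards [self_mem_nhdsWithin] with v hv
    simpa [hQ] using hv

lemma removableAt_mul_iff {Q : ℂ} (hQ : Q ≠ 0) {f : ℂ → ℂ} {w : ℂ}
    (hper : ∀ᶠ v in 𝓝[≠] w, f (Q * v) = f v) : RemovableAt f (Q * w) ↔ RemovableAt f w := by
  constructor
  · rintro ⟨g, hg, hfg⟩
    refine ⟨fun v => g (Q * v), AnalyticAt.fun_comp (f := fun v => Q * v) hg (by fun_prop), ?_⟩
    filter_upwards [hper, (tendsto_mul_punctured hQ w).eventually hfg] with v h1 h2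
    rw [← h1, h2]
  · rintro ⟨g, hg, hfg⟩
    refine ⟨fun v => g (Q⁻¹ * v), ?_, ?_⟩
    · refine AnalyticAt.fun_comp (f := fun v => Q⁻¹ * v) (x := Q * w) ?_ (by fun_prop)
      rwa [inv_mul_cancel_left₀ hQ]
    · have ht := tendsto_mul_punctured (inv_ne_zero hQ) (Q * w)
      rw [inv_mul_cancel_left₀ hQ] at ht
      filter_upwards [ht.eventually hper, ht.eventually hfg] with v h1 h2
      rw [← h2, ← h1, mul_inv_cancel_left₀ hQ]

/-- Reduces the study of singularities to one representative of each orbit of multiplication by Q.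
-/
lemma removableAt_zpow_mul_iff {Q : ℂ} (hQ : Q ≠ 0) {f : ℂ → ℂ}
    (hper : ∀ w ≠ 0, ∀ᶠ v in 𝓝[≠] w, f (Q * v) = f v) {w : ℂ} (hw : w ≠ 0) (k : ℤ) :
    RemovableAt f (Q ^ k * w) ↔ RemovableAt f w := by
  induction k with
  | zero => simp
  | succ k ih =>
    rw [← ih, zpow_add_one₀ hQ, mul_comm _ Q, mul_assoc]
    exact removableAt_mul_iff hQ (hper _ (mul_ne_zero (zpow_ne_zero _ hQ) hw))
  | pred k ih =>
    rw [← ih, ← removableAt_mul_iff hQ (hper (Q ^ (-(k : ℤ) - 1) * w)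
      (mul_ne_zero (zpow_ne_zero _ hQ) hw)), ← mul_assoc, ← zpow_one_add₀ hQ]
    congr! 3
    ring

/-- Multiplicative form of Liouville's theorem for elliptic functions. -/
theorem eq_const_of_mul_periodic {Q : ℂ} (hQ0 : Q ≠ 0) (hQ : ‖Q‖ < 1) {f : ℂ → ℂ}
    (hrem : ∀ w ≠ 0, RemovableAt f w)
    (hper : ∀ w ≠ 0, ∀ᶠ v in 𝓝[≠] w, f (Q * v) = f v) :
    ∃ c, ∀ w ≠ 0, f =ᶠ[𝓝[≠] w] fun _ => c := by
  -- Replacing f by its punctured limits fills in the removable singularities and makes the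
  -- invariance under multiplication by Q exact away from 0.
  set F : ℂ → ℂ := fun w => limUnder (𝓝[≠] w) f with hF
  have hlim : ∀ {w : ℂ} {g : ℂ → ℂ}, ContinuousAt g w → f =ᶠ[𝓝[≠] w] g → F w = g w := by
    intro w g hg hfg
    exact Tendsto.limUnder_eq ((hg.tendsto.mono_left nhdsWithin_le_nhds).congr' hfg.symm)
  have hFg : ∀ w ≠ 0, AnalyticAt ℂ F w ∧ f =ᶠ[𝓝[≠] w] F := by
    intro w hw
    obtain ⟨g, hg, hfg⟩ := hrem w hw
    have h1 : F =ᶠ[𝓝 w] g := by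
      have h2 : ∀ᶠ v in 𝓝[≠] w, F v = g v := by
        have h3 : ∀ᶠ v in 𝓝[≠] w, f =ᶠ[𝓝 v] g := by
          have := eventually_eventually_nhdsWithin.mpr hfg
          filter_upwards [this, self_mem_nhdsWithin] with v hv hvw
          rwa [IsOpen.nhdsWithin_eq isOpen_compl_singleton hvw] at hv
        have h4 : ∀ᶠ v in 𝓝[≠] w, AnalyticAt ℂ g v :=
          hg.eventually_analyticAt.filter_mono nhdsWithin_le_nhds
        filter_upwards [h3, h4] with v h3 h4
        exact hlim h4.continuousAt (h3.filter_mono nhdsWithin_le_nhds)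
      rw [eventually_nhdsWithin_iff] at h2
      filter_upwards [h2] with v hv
      by_cases hvw : v = w
      · rw [hvw]; exact hlim hg.continuousAt hfg
      · exact hv hvw
    exact ⟨hg.congr h1.symm, hfg.trans (h1.symm.filter_mono nhdsWithin_le_nhds)⟩
  have hFper : ∀ w ≠ 0, F (Q * w) = F w := by
    intro w hw
    obtain ⟨h1, h2⟩ := hFg w hw
    obtain ⟨h3, h4⟩ := hFg (Q * w) (mul_ne_zero hQ0 hw)
    have t1 : Tendsto f (𝓝[≠] w) (𝓝 (F w)) :=
      (h1.continuousAt.tendsto.mono_left nhdsWithin_le_nhds).congr' h2.symm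
    have t2 : Tendsto f (𝓝[≠] (Q * w)) (𝓝 (F (Q * w))) :=
      (h3.continuousAt.tendsto.mono_left nhdsWithin_le_nhds).congr' h4.symm
    exact tendsto_nhds_unique ((t2.comp (tendsto_mul_punctured hQ0 w)).congr' (hper w hw)) t1
  have hFz : ∀ w ≠ 0, ∀ k : ℤ, F (Q ^ k * w) = F w := by
    intro w hw k
    induction k with
    | zero => simp
    | succ k ih =>
      rw [← ih, zpow_add_one₀ hQ0, mul_comm _ Q, mul_assoc]
      exact hFper _ (mul_ne_zero (zpow_ne_zero _ hQ0) hw)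
    | pred k ih =>
      rw [← ih, ← hFper _ (mul_ne_zero (zpow_ne_zero _ hQ0) hw), ← mul_assoc, ← zpow_one_add₀ hQ0]
      congr 3
      ring
  -- A fundamental annulus is compact, so ‖F‖ has a maximum on it. By invariance this is a maximum
  -- over the whole punctured plane, and the maximum principle applies.
  have hK : IsCompact {w : ℂ | ‖Q‖ ≤ ‖w‖ ∧ ‖w‖ ≤ 1} := by
    refine (isCompact_closedBall (0 : ℂ) 1).of_isClosed_subset ?_ fun w hw => by simpa using hw.2
    exact (isClosed_le continuous_const continuous_norm).inter
      (isClosed_le continuous_norm continuous_const)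
  have hQn : 0 < ‖Q‖ := norm_pos_iff.mpr hQ0
  have hne : ∀ w ∈ {w : ℂ | ‖Q‖ ≤ ‖w‖ ∧ ‖w‖ ≤ 1}, w ≠ 0 := fun w hw =>
    norm_pos_iff.mp (hQn.trans_le hw.1)
  obtain ⟨w0, hw0, hmax⟩ := hK.exists_isMaxOn ⟨1, by simpa using hQ.le⟩
    (f := fun w => ‖F w‖) fun w hw => ((hFg w (hne w hw)).1.continuousAt.norm).continuousWithinAt
  have hmax' : IsMaxOn (norm ∘ F) {0}ᶜ w0 := by
    intro w hw
    have hw' : w ≠ 0 := hw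
    -- Here ‖Q‖^{-k} < ‖w‖ ≤ ‖Q‖^{-(k+1)}, so multiplication by Q^{k+1} brings w into the annulus.
    obtain ⟨k, hk⟩ := exists_mem_Ioc_zpow (norm_pos_iff.mpr hw') (one_lt_inv₀ hQn |>.mpr hQ)
    have hmem : Q ^ (k + 1) * w ∈ {w : ℂ | ‖Q‖ ≤ ‖w‖ ∧ ‖w‖ ≤ 1} := by
      have e : ‖Q ^ (k + 1) * w‖ = ‖Q‖ ^ (k + 1) * ‖w‖ := by simp
      have hp : 0 < ‖Q‖ ^ (k + 1) := zpow_pos hQn _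
      have e1 : ‖Q‖ ^ (k + 1) * ‖Q‖⁻¹ ^ k = ‖Q‖ := by
        rw [inv_zpow, zpow_add_one₀ hQn.ne', mul_assoc, mul_comm ‖Q‖, ← mul_assoc,
          mul_inv_cancel₀ (zpow_ne_zero _ hQn.ne'), one_mul]
      have e2 : ‖Q‖ ^ (k + 1) * ‖Q‖⁻¹ ^ (k + 1) = 1 := by
        rw [inv_zpow, mul_inv_cancel₀ (zpow_ne_zero _ hQn.ne')]
      refine ⟨?_, ?_⟩
      · rw [e]
        exact e1.symm.le.trans (mul_le_mul_of_nonneg_left hk.1.le hp.le)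
      · rw [e]
        exact (mul_le_mul_of_nonneg_left hk.2 hp.le).trans e2.le
    have := hmax hmem
    simpa only [Function.comp, mem_ofPred_eq, hFz w hw'] using this
  have hconst := eqOn_of_isPreconnected_of_isMaxOn_norm
    (isConnected_compl_singleton_of_one_lt_rank (by simp) (0 : ℂ)).isPreconnected
    isOpen_compl_singleton
    (fun w hw => (hFg w hw).1.differentiableAt.differentiableWithinAt) (hne w0 hw0) hmax'
  refine ⟨F w0, fun w hw => (hFg w hw).2.trans ?_⟩
  have : ∀ᶠ v in 𝓝[≠] w, v ≠ 0 :=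
    (isOpen_compl_singleton.mem_nhds hw : ({0}ᶜ : Set ℂ) ∈ 𝓝 w) |> mem_nhdsWithin_of_mem_nhds
  filter_upwards [this] with v hv using hconst hv

/-! ### Power series, and polynomials in `cos x` -/

lemma coeff_eq_iteratedDeriv {c : ℕ → ℂ} {f : ℂ → ℂ} {R : ℝ} (hR : 0 < R)
    (hs : ∀ Q : ℂ, ‖Q‖ < R → HasSum (fun l => c l * Q ^ l) (f Q)) (l : ℕ) :
    c l = iteratedDeriv l f 0 / l.factorial := by
  have h1 : HasFPowerSeriesAt f (FormalMultilinearSeries.ofScalars ℂ c) 0 := by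
    rw [hasFPowerSeriesAt_iff]
    filter_upwards [ball_mem_nhds (0 : ℂ) hR] with z hz
    simpa [mul_comm] using hs z (by simpa using hz)
  have h2 := h1.analyticAt.hasFPowerSeriesAt
  have h3 := congrArg (fun p => FormalMultilinearSeries.coeff p l)
    (h1.eq_formalMultilinearSeries h2)
  simpa using h3

lemma differentiableOn_of_hasSum {c : ℕ → ℂ} {f : ℂ → ℂ} {R : ℝ}
    (hs : ∀ Q : ℂ, ‖Q‖ < R → HasSum (fun l => c l * Q ^ l) (f Q)) :
    DifferentiableOn ℂ f (ball 0 R) := by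
  intro Q hQ
  rw [mem_ball_zero_iff] at hQ
  obtain ⟨ρ, hρ1, hρ2⟩ := exists_between hQ
  have hρ : 0 < ρ := (norm_nonneg _).trans_lt hρ1
  have hu : Summable fun l => ‖c l * (ρ : ℂ) ^ l‖ :=
    (hs ρ (by simpa [abs_of_pos hρ] using hρ2)).summable.norm
  have hd := differentiableOn_tsum_of_summable_norm (F := fun l (Q : ℂ) => c l * Q ^ l)
    (U := ball 0 ρ) hu (fun l => (Differentiable.const_mul (by fun_prop) _).differentiableOn)
    isOpen_ball (fun l w hw => by
      rw [norm_mul, norm_mul, norm_pow, norm_pow]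
      gcongr
      simpa [abs_of_pos hρ] using (mem_ball_zero_iff.mp hw).le)
  refine ((hd.differentiableAt (isOpen_ball.mem_nhds (by simpa using hρ1))).congr_of_eventuallyEq
    ?_).differentiableWithinAt
  filter_upwards [isOpen_ball.mem_nhds (by simpa using hρ1 : Q ∈ ball (0 : ℂ) ρ)] with w hw
  exact (hs w ((mem_ball_zero_iff.mp hw).trans hρ2)).tsum_eq.symm

/-- Cauchy's estimate for the coefficients of a power series. -/
lemma norm_coeff_mul_pow_le {c : ℕ → ℂ} {f : ℂ → ℂ} {R r M : ℝ} (hr : 0 < r) (hrR : r < R)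
    (hs : ∀ Q : ℂ, ‖Q‖ < R → HasSum (fun l => c l * Q ^ l) (f Q))
    (hM : ∀ Q : ℂ, ‖Q‖ = r → ‖f Q‖ ≤ M) (l : ℕ) : ‖c l‖ * r ^ l ≤ M := by
  have h1 := norm_iteratedDeriv_le_of_forall_mem_sphere_norm_le l hr (f := f) (c := 0) (C := M)
    (((differentiableOn_of_hasSum hs).mono (by
      rw [closure_ball _ hr.ne']
      exact closedBall_subset_ball hrR)).diffContOnCl) (fun Q hQ => hM Q (by simpa using hQ))
  rw [coeff_eq_iteratedDeriv (hr.trans hrR) hs l, norm_div, Complex.norm_natCast]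
  have hf : (0 : ℝ) < l.factorial := by positivity
  rw [le_div_iff₀ (pow_pos hr l)] at h1
  rw [div_mul_eq_mul_div, div_le_iff₀ hf]
  linarith

/-- A polynomial in `cos y` of degree at most `N` that is bounded by `M` on the real line grows at
most like `M e^{N |Im y|}`. -/
lemma norm_eval_cos_le {p : Polynomial ℂ} {N : ℕ} (hp : p.natDegree ≤ N) {M : ℝ}
    (hM : ∀ t : ℝ, ‖p.eval (Complex.cos t)‖ ≤ M) (y : ℂ) :
    ‖p.eval (Complex.cos y)‖ ≤ M * Real.exp (N * |y.im|) := by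
  -- With ξ = e^{iy} this is ξ^N p(cos y), a polynomial in ξ because ξ cos y = (ξ² + 1)/2. Real y
  -- correspond to |ξ| = 1, and the maximum principle on the unit disc covers Im y ≥ 0.
  set H : ℂ → ℂ := fun ξ => ∑ k ∈ Finset.range (N + 1), p.coeff k * ((ξ ^ 2 + 1) / 2) ^ k *
    ξ ^ (N - k) with hH
  have hHy : ∀ y : ℂ, H (cexp (I * y)) = cexp (I * y) ^ N * p.eval (Complex.cos y) := by
    intro y
    rw [Polynomial.eval_eq_sum_range' (Nat.lt_succ_of_le hp), Finset.mul_sum]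
    refine Finset.sum_congr rfl fun k hk => ?_
    have hk' : k ≤ N := Nat.lt_succ_iff.mp (Finset.mem_range.mp hk)
    have e1 : (cexp (I * y) ^ 2 + 1) / 2 = cexp (I * y) * Complex.cos y := by
      rw [Complex.cos, neg_mul, Complex.exp_neg, mul_comm y I]
      have := Complex.exp_ne_zero (I * y)
      field_simp
    rw [e1, mul_pow, ← Nat.add_sub_of_le hk', pow_add, Nat.add_sub_cancel_left]
    ring
  have hbd : ∀ ξ ∈ frontier (ball (0 : ℂ) 1), ‖H ξ‖ ≤ M := by
    intro ξ hξ
    rw [frontier_ball _ one_ne_zero, mem_sphere_zero_iff_norm] at hξ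
    have e2 : ξ = cexp (I * (ξ.arg : ℂ)) := by
      have := Complex.norm_mul_exp_arg_mul_I ξ
      rw [hξ, ofReal_one, one_mul, mul_comm] at this
      exact this.symm
    rw [e2, hHy, norm_mul, norm_pow, ← e2, hξ, one_pow, one_mul]
    exact hM _
  have hup : ∀ y : ℂ, 0 ≤ y.im → ‖p.eval (Complex.cos y)‖ ≤ M * Real.exp (N * y.im) := by
    intro y hy
    have hn : ‖cexp (I * y)‖ = Real.exp (-y.im) := by rw [Complex.norm_exp]; simp
    have h1 := norm_le_of_forall_mem_frontier_norm_le (f := H) isBounded_ball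
      (Differentiable.diffContOnCl (by fun_prop)) hbd (z := cexp (I * y)) (by
        rw [closure_ball _ one_ne_zero, mem_closedBall_zero_iff, hn]
        exact Real.exp_le_one_iff.mpr (by linarith))
    rw [hHy, norm_mul, norm_pow, hn, ← Real.exp_nat_mul] at h1
    rw [← mul_le_mul_iff_right₀ (Real.exp_pos (N * -y.im))]
    refine h1.trans (le_of_eq ?_)
    rw [mul_left_comm, ← Real.exp_add]
    simp
  rcases le_total 0 y.im with h | h
  · rw [abs_of_nonneg h]; exact hup y h
  · rw [abs_of_nonpos h, ← Complex.cos_neg]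
    simpa using hup (-y) (by simpa using h)

/-- An even `2π`-periodic entire function that grows at most like `e^{N |Im x|}` is a polynomial in
`cos x` of degree at most `N`. -/
theorem exists_polynomial_cos {f : ℂ → ℂ} (hf : Differentiable ℂ f)
    (hper : ∀ x, f (x + 2 * Real.pi) = f x) (heven : ∀ x, f (-x) = f x) {C : ℝ} {N : ℕ}
    (hbd : ∀ x, ‖f x‖ ≤ C * Real.exp (N * |x.im|)) :
    ∃ p : Polynomial ℂ, p.natDegree ≤ N ∧ ∀ x, p.eval (Complex.cos x) = f x := by
  have hC : 0 ≤ C := by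
    have := (norm_nonneg _).trans (hbd 0)
    simpa using this
  set F : ℂ → ℂ := fun x => cexp (I * x) ^ N * f x with hFdef
  have hexp : ∀ x : ℂ, cexp (I * (x + 2 * Real.pi)) = cexp (I * x) := fun x => by
    rw [show I * (x + 2 * Real.pi) = I * x + 2 * Real.pi * I by ring]
    exact Complex.exp_periodic _
  have hFd : Differentiable ℂ F := by fun_prop
  have hFp : Function.Periodic F (2 * Real.pi : ℝ) := fun x => by
    simp only [hFdef]
    push_cast
    rw [hexp, hper]
  have hnorm : ∀ x : ℂ, ‖cexp (I * x)‖ = Real.exp (-x.im) := fun x => by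
    rw [Complex.norm_exp]; simp
  have hFn : ∀ x : ℂ, 0 ≤ x.im → ‖F x‖ ≤ C := by
    intro x hx
    have h1 := hbd x
    rw [abs_of_nonneg hx] at h1
    simp only [hFdef, norm_mul, norm_pow, hnorm, ← Real.exp_nat_mul]
    calc _ ≤ Real.exp (N * -x.im) * (C * Real.exp (N * x.im)) := by gcongr
      _ = C := by rw [mul_left_comm, ← Real.exp_add]; simp
  have h2pi : (0 : ℝ) < 2 * Real.pi := by positivity
  set G := Function.Periodic.cuspFunction (2 * Real.pi) F with hG
  have hq : ∀ x, Function.Periodic.qParam (2 * Real.pi) x = cexp (I * x) := fun x => by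
    rw [Function.Periodic.qParam]
    congr 1
    push_cast
    have : (Real.pi : ℂ) ≠ 0 := by exact_mod_cast Real.pi_ne_zero
    field_simp
  have hGF : ∀ x, G (cexp (I * x)) = F x := fun x => by
    rw [← hq]; exact Function.Periodic.eq_cuspFunction h2pi.ne' hFp x
  have hex : ∀ ξ : ℂ, ξ ≠ 0 → ∃ x, cexp (I * x) = ξ := fun ξ hξ =>
    ⟨-I * Complex.log ξ, by rw [← mul_assoc]; simp [Complex.exp_log hξ]⟩
  have hGd : Differentiable ℂ G := by
    intro ξ
    by_cases hξ : ξ = 0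
    · rw [hξ]
      refine Function.Periodic.differentiableAt_cuspFunction_zero h2pi hFp
        (.of_forall fun x => hFd x) ?_
      refine Asymptotics.IsBigO.of_bound C ?_
      have : ∀ᶠ x in comap im atTop, 0 ≤ x.im := (eventually_ge_atTop 0).comap im
      filter_upwards [this] with x hx
      simpa using hFn x hx
    · obtain ⟨x, rfl⟩ := hex ξ hξ
      rw [← hq]
      exact Function.Periodic.differentiableAt_cuspFunction h2pi.ne' hFp (hFd x)
  have hGb : ∀ ξ : ℂ, 1 ≤ ‖ξ‖ → ‖G ξ‖ ≤ C * ‖ξ‖ ^ (2 * N) := by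
    intro ξ hξ
    obtain ⟨x, rfl⟩ := hex ξ (norm_pos_iff.mp (by linarith))
    rw [hnorm] at hξ ⊢
    have hx : x.im ≤ 0 := by
      have := Real.one_le_exp_iff.mp hξ
      linarith
    have h1 := hbd x
    rw [abs_of_nonpos hx] at h1
    rw [hGF]
    simp only [hFdef, norm_mul, norm_pow, hnorm, ← Real.exp_nat_mul]
    calc _ ≤ Real.exp (N * -x.im) * (C * Real.exp (N * -x.im)) := by gcongr
      _ = _ := by
        rw [mul_left_comm, ← Real.exp_add]
        congr 2
        push_cast
        ring
  have hzero : ∀ k, 2 * N < k → iteratedDeriv k G 0 = 0 := by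
    intro k hk
    have hb : ∀ r : ℝ, 1 ≤ r → ‖iteratedDeriv k G 0‖ ≤ k.factorial * C * r⁻¹ := by
      intro r hr
      have hr0 : 0 < r := by linarith
      refine (norm_iteratedDeriv_le_of_forall_mem_sphere_norm_le k hr0
        hGd.diffContOnCl (C := C * r ^ (2 * N)) (fun ξ hξ => ?_)).trans ?_
      · rw [mem_sphere_zero_iff_norm] at hξ
        rw [← hξ] at hr ⊢
        exact hGb ξ hr
      · have e : (k.factorial : ℝ) * C * r⁻¹ * r ^ k = k.factorial * (C * (r⁻¹ * r ^ k)) := by ring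
        rw [div_le_iff₀ (by positivity), e]
        gcongr
        rw [← div_eq_inv_mul, le_div_iff₀ hr0, ← pow_succ]
        exact pow_le_pow_right₀ hr hk
    have ht : Tendsto (fun r : ℝ => k.factorial * C * r⁻¹) atTop (𝓝 0) := by
      simpa using tendsto_inv_atTop_zero.const_mul (k.factorial * C)
    have := ge_of_tendsto ht ((eventually_ge_atTop 1).mono fun r hr => hb r hr)
    exact norm_le_zero_iff.mp this
  have hGsum : ∀ ξ, G ξ = ∑ k ∈ Finset.range (2 * N + 1),
      ((k.factorial : ℂ)⁻¹ * iteratedDeriv k G 0) * ξ ^ k := by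
    intro ξ
    have h1 := Complex.hasSum_taylorSeries_of_entire hGd 0 ξ
    rw [← h1.tsum_eq, tsum_eq_sum (s := Finset.range (2 * N + 1))]
    · refine Finset.sum_congr rfl fun k _ => ?_
      simp only [sub_zero, smul_eq_mul]
      ring
    · intro k hk
      rw [hzero k (by simpa [Nat.lt_succ_iff] using hk)]
      simp
  set a : ℕ → ℂ := fun k => (k.factorial : ℂ)⁻¹ * iteratedDeriv k G 0
  have hfa : ∀ x, f x = ∑ k ∈ Finset.range (2 * N + 1), a k * cexp (((k : ℂ) - N) * (I * x)) := by
    intro x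
    have h1 := hGF x
    rw [hGsum] at h1
    have h2 := Complex.exp_ne_zero (I * x)
    have h3 : f x = (cexp (I * x) ^ N)⁻¹ * F x := by
      simp only [hFdef]
      field_simp
    rw [h3, ← h1, Finset.mul_sum]
    refine Finset.sum_congr rfl fun k _ => ?_
    rw [sub_mul, Complex.exp_sub, Complex.exp_nat_mul, Complex.exp_nat_mul]
    simp only [a]
    field_simp
  -- Averaging over x and -x, allowed by evenness, turns e^{i(k-N)x} into cos((k-N)x) = T_{k-N}(cos
  -- x).
  refine ⟨∑ k ∈ Finset.range (2 * N + 1), Polynomial.C (a k) *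
    Polynomial.Chebyshev.T ℂ ((k : ℤ) - N), ?_, fun x => ?_⟩
  · refine Polynomial.natDegree_sum_le_of_forall_le _ _ fun k hk => ?_
    refine (Polynomial.natDegree_C_mul_le _ _).trans ?_
    rw [Polynomial.Chebyshev.natDegree_T]
    have := Finset.mem_range.mp hk
    omega
  · have h1 : f x = (f x + f (-x)) / 2 := by rw [heven]; ring
    rw [h1, hfa, hfa, ← Finset.sum_add_distrib, Finset.sum_div, Polynomial.eval_finsetSum]
    refine Finset.sum_congr rfl fun k _ => ?_
    rw [Polynomial.eval_mul, Polynomial.eval_C, Polynomial.Chebyshev.T_complex_cos, Complex.cos]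
    push_cast
    ring_nf

/-! ### Lambert series -/

/-- `∑_{m ≥ 0} Q^m w / (1 - Q^m w)`. -/
def lam (w Q : ℂ) : ℂ := ∑' m : ℕ, Q ^ m * w / (1 - Q ^ m * w)

/-- `∑_{m ≥ 0} m Q^m w / (1 - Q^m w)`. -/
def lamW (w Q : ℂ) : ℂ := ∑' m : ℕ, (m : ℂ) * (Q ^ m * w / (1 - Q ^ m * w))

/-- `∑_{m ≥ 1} Q^m / (1 - Q^m)²`. -/
def lamSq (Q : ℂ) : ℂ := ∑' m : ℕ, Q ^ (m + 1) / (1 - Q ^ (m + 1)) ^ 2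

/-- The points `w` that are not of the form `Q^{-m}`, `m ≥ 0`. -/
def Regular (Q w : ℂ) : Prop := ∀ m : ℕ, Q ^ m * w ≠ 1

section
variable {Q : ℂ}

/-- The quotient tends to w, so no regularity of w is needed: at most finitely many denominators
vanish near infinity in m, and they do not affect the limit. -/
lemma isBigO_lambert (hQ : ‖Q‖ < 1) (w : ℂ) :
    (fun m : ℕ => w / (1 - Q ^ m * w)) =O[atTop] fun _ => (1 : ℝ) := by
  have h : Tendsto (fun m : ℕ => w / (1 - Q ^ m * w)) atTop (𝓝 (w / (1 - 0 * w))) := by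
    refine Tendsto.div tendsto_const_nhds ?_ (by simp)
    exact tendsto_const_nhds.sub ((tendsto_pow_atTop_nhds_zero_of_norm_lt_one hQ).mul_const w)
  exact h.isBigO_one ℝ

lemma summable_lam (hQ : ‖Q‖ < 1) (w : ℂ) :
    Summable fun m : ℕ => Q ^ m * w / (1 - Q ^ m * w) := by
  refine summable_of_isBigO_nat (g := fun m : ℕ => ‖Q‖ ^ m)
    (summable_geometric_of_lt_one (norm_nonneg _) hQ) ?_
  have h1 : (fun m : ℕ => Q ^ m) =O[atTop] fun m : ℕ => ‖Q‖ ^ m :=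
    Asymptotics.isBigO_of_le _ fun m => by simp
  simpa [mul_div_assoc] using h1.mul (isBigO_lambert hQ w)

lemma summable_lamW (hQ : ‖Q‖ < 1) (w : ℂ) :
    Summable fun m : ℕ => (m : ℂ) * (Q ^ m * w / (1 - Q ^ m * w)) := by
  have hs : Summable fun m : ℕ => (m : ℝ) * ‖Q‖ ^ m := by
    simpa using summable_pow_mul_geometric_of_norm_lt_one (R := ℝ) 1 (r := ‖Q‖) (by simpa using hQ)
  refine summable_of_isBigO_nat (g := fun m : ℕ => (m : ℝ) * ‖Q‖ ^ m) hs ?_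
  have h1 : (fun m : ℕ => (m : ℂ) * Q ^ m) =O[atTop] fun m : ℕ => (m : ℝ) * ‖Q‖ ^ m :=
    Asymptotics.isBigO_of_le _ fun m => by simp
  simpa [mul_div_assoc, mul_assoc] using h1.mul (isBigO_lambert hQ w)

/-- The term m = 0 split off. It holds for every w, since both sides use the same value 0 at a
vanishing denominator. -/
lemma lam_eq (hQ : ‖Q‖ < 1) (w : ℂ) : lam w Q = w / (1 - w) + lam (Q * w) Q := by
  rw [lam, (summable_lam hQ w).tsum_eq_zero_add, pow_zero, one_mul, lam]
  simp only [pow_succ, mul_assoc]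

lemma lamW_eq (hQ : ‖Q‖ < 1) (w : ℂ) : lamW w Q = lamW (Q * w) Q + lam (Q * w) Q := by
  rw [lamW, (summable_lamW hQ w).tsum_eq_zero_add, lamW, lam,
    ← (summable_lamW hQ _).tsum_add (summable_lam hQ _)]
  simp only [pow_succ, mul_assoc]
  push_cast
  simp only [add_mul, zero_mul, one_mul, zero_add]

lemma norm_one_sub_ge {Q w : ℂ} (hQ : ‖Q‖ < 1) {r : ℝ} (hw : ‖w‖ ≤ r) (m : ℕ) :
    1 - r ≤ ‖1 - Q ^ m * w‖ := by
  have h1 : ‖Q ^ m * w‖ ≤ r := by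
    rw [norm_mul, norm_pow]
    calc _ ≤ 1 * ‖w‖ := by gcongr; exact pow_le_one₀ (norm_nonneg _) hQ.le
      _ ≤ r := by rw [one_mul]; exact hw
  have := norm_sub_norm_le (1 : ℂ) (Q ^ m * w)
  rw [norm_one] at this
  linarith

lemma norm_lambert_le {Q w : ℂ} (hQ : ‖Q‖ < 1) {r : ℝ} (hr : r < 1) (hw : ‖w‖ ≤ r) (m : ℕ) :
    ‖Q ^ m * w / (1 - Q ^ m * w)‖ ≤ ‖Q‖ ^ m * (r / (1 - r)) := by
  have h2 := norm_one_sub_ge hQ hw m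
  rw [norm_div, norm_mul, norm_pow, mul_div_assoc]
  have h3 : 0 < 1 - r := by linarith
  gcongr
  exact (norm_nonneg _).trans hw

lemma one_sub_ne {Q w : ℂ} (hQ : ‖Q‖ < 1) (hw : ‖w‖ < 1) (m : ℕ) : 1 - Q ^ m * w ≠ 0 := by
  have := norm_one_sub_ge hQ le_rfl m (w := w)
  exact norm_pos_iff.mp (by linarith)

lemma regular_of_norm_lt {w : ℂ} (hQ : ‖Q‖ < 1) (hw : ‖w‖ < 1) : Regular Q w := fun m h =>
  one_sub_ne hQ hw m (by rw [h, sub_self])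

lemma Regular.mul {w : ℂ} (h : Regular Q w) : Regular Q (Q * w) := fun m => by
  rw [← mul_assoc, ← pow_succ]; exact h (m + 1)

lemma hasDerivAt_lambert_term {Q w : ℂ} (m : ℕ) (h : 1 - Q ^ m * w ≠ 0) :
    HasDerivAt (fun w => Q ^ m * w / (1 - Q ^ m * w)) (Q ^ m / (1 - Q ^ m * w) ^ 2) w := by
  have h1 : HasDerivAt (fun w : ℂ => Q ^ m * w) (Q ^ m) w := by
    simpa using (hasDerivAt_id w).const_mul (Q ^ m)
  convert! h1.div (h1.const_sub 1) h using 1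
  ring

/-- The Weierstrass M-test on a smaller disc around the point, with termwise differentiation. -/
lemma differentiableOn_of_series {f : ℕ → ℂ → ℂ} (hf : ∀ m, DifferentiableOn ℂ (f m) (ball 0 1))
    (hb : ∀ r : ℝ, 0 < r → r < 1 → ∃ u : ℕ → ℝ, Summable u ∧ ∀ m, ∀ w ∈ ball (0 : ℂ) r, ‖f m w‖ ≤ u m)
    {w : ℂ} (hw : ‖w‖ < 1) : AnalyticAt ℂ (fun w => ∑' m, f m w) w ∧
      HasSum (fun m => deriv (f m) w) (deriv (fun w => ∑' m, f m w) w) := by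
  obtain ⟨r, hr1, hr2⟩ := exists_between hw
  obtain ⟨u, hu, hfu⟩ := hb r ((norm_nonneg _).trans_lt hr1) hr2
  have hd : ∀ m, DifferentiableOn ℂ (f m) (ball 0 r) := fun m =>
    (hf m).mono (ball_subset_ball hr2.le)
  have hm : w ∈ ball (0 : ℂ) r := by simpa using hr1
  exact ⟨(differentiableOn_tsum_of_summable_norm hu hd isOpen_ball hfu).analyticAt
    (isOpen_ball.mem_nhds hm), hasSum_deriv_of_summable_norm hu hd isOpen_ball hfu hm⟩

lemma analyticAt_lam_of_norm_lt {w : ℂ} (hQ : ‖Q‖ < 1) (hw : ‖w‖ < 1) :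
    AnalyticAt ℂ (fun w => lam w Q) w ∧
      HasSum (fun m : ℕ => Q ^ m / (1 - Q ^ m * w) ^ 2) (deriv (fun w => lam w Q) w) := by
  obtain ⟨h1, h2⟩ := differentiableOn_of_series (f := fun m w => Q ^ m * w / (1 - Q ^ m * w))
    (fun m w hw => (hasDerivAt_lambert_term m
      (one_sub_ne hQ (by simpa using hw) m)).differentiableAt.differentiableWithinAt)
    (fun r _ hr => ⟨fun m => ‖Q‖ ^ m * (r / (1 - r)),
      (summable_geometric_of_lt_one (norm_nonneg _) hQ).mul_right _,
      fun m w hw => norm_lambert_le hQ hr (mem_ball_zero_iff.mp hw).le m⟩) hw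
  refine ⟨h1, ?_⟩
  simp only [(hasDerivAt_lambert_term _ (one_sub_ne hQ hw _)).deriv] at h2
  exact h2

lemma analyticAt_lamW_of_norm_lt {w : ℂ} (hQ : ‖Q‖ < 1) (hw : ‖w‖ < 1) :
    AnalyticAt ℂ (fun w => lamW w Q) w := by
  refine (differentiableOn_of_series (f := fun m w => m * (Q ^ m * w / (1 - Q ^ m * w)))
    (fun m w hw => ((hasDerivAt_lambert_term m
      (one_sub_ne hQ (by simpa using hw) m)).differentiableAt.const_mul _).differentiableWithinAt)
    (fun r _ hr => ⟨fun m => (m * ‖Q‖ ^ m) * (r / (1 - r)), Summable.mul_right _ ?_,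
      fun m w hw => ?_⟩) hw).1
  · simpa using summable_pow_mul_geometric_of_norm_lt_one (R := ℝ) 1 (r := ‖Q‖) (by simpa using hQ)
  · show _ ≤ m * ‖Q‖ ^ m * (r / (1 - r))
    rw [norm_mul, Complex.norm_natCast, mul_assoc]
    gcongr
    exact norm_lambert_le hQ hr (mem_ball_zero_iff.mp hw).le m

/-- Extension from the unit disc by a functional equation. -/
lemma regular_induction (hQ : ‖Q‖ < 1) {p : ℂ → Prop} (h0 : ∀ w, ‖w‖ < 1 → p w)
    (h1 : ∀ w, Regular Q w → p (Q * w) → p w) (w : ℂ) (hw : Regular Q w) : p w := by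
  have key : ∀ k : ℕ, ∀ w, Regular Q w → ‖Q ^ k * w‖ < 1 → p w := by
    intro k
    induction k with
    | zero => exact fun w _ h => h0 w (by simpa using h)
    | succ k ih =>
      intro w hw h
      exact h1 w hw (ih _ hw.mul (by rwa [← mul_assoc, ← pow_succ]))
  have ht : Tendsto (fun k : ℕ => ‖Q ^ k * w‖) atTop (𝓝 0) := by
    simpa using ((tendsto_pow_atTop_nhds_zero_of_norm_lt_one hQ).mul_const w).norm
  obtain ⟨k, hk⟩ := (ht.eventually_lt_const one_pos).exists
  exact key k w hw hk

lemma analyticAt_lam (hQ : ‖Q‖ < 1) {w : ℂ} (hw : Regular Q w) :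
    AnalyticAt ℂ (fun w => lam w Q) w := by
  refine regular_induction hQ (p := fun w => AnalyticAt ℂ (fun w => lam w Q) w)
    (fun w h => (analyticAt_lam_of_norm_lt hQ h).1) (fun w hw h => ?_) w hw
  rw [show (fun w => lam w Q) = fun w => w / (1 - w) + lam (Q * w) Q from funext (lam_eq hQ)]
  have h2 : 1 - w ≠ 0 := fun h => hw 0 (by linear_combination -h)
  exact (analyticAt_id.div (analyticAt_const.sub analyticAt_id) h2).add
    (AnalyticAt.fun_comp (f := fun w => Q * w) h (by fun_prop))

lemma analyticAt_lamW (hQ : ‖Q‖ < 1) {w : ℂ} (hw : Regular Q w) :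
    AnalyticAt ℂ (fun w => lamW w Q) w := by
  refine regular_induction hQ (p := fun w => AnalyticAt ℂ (fun w => lamW w Q) w)
    (fun w h => analyticAt_lamW_of_norm_lt hQ h) (fun w hw h => ?_) w hw
  rw [show (fun w => lamW w Q) = fun w => lamW (Q * w) Q + lam (Q * w) Q from
    funext (lamW_eq hQ)]
  exact (AnalyticAt.fun_comp (f := fun w => Q * w) h (by fun_prop)).add
    (AnalyticAt.fun_comp (f := fun w => Q * w) (analyticAt_lam hQ hw.mul) (by fun_prop))

lemma mul_deriv_lam_self (hQ : ‖Q‖ < 1) : Q * deriv (fun w => lam w Q) Q = lamSq Q := by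
  have h := (analyticAt_lam_of_norm_lt hQ hQ).2.mul_left Q
  rw [lamSq, ← h.tsum_eq]
  refine tsum_congr fun m => ?_
  rw [← pow_succ, pow_succ']
  ring

/-- Both sides expand to the absolutely convergent double series ∑ m Q^{mk} over m, k ≥ 1, summed in
the two orders. The identity fixes the constant in the heat equation. -/
lemma lamW_one (hQ : ‖Q‖ < 1) : lamW 1 Q = lamSq Q := by
  have hn : ∀ m : ℕ, ‖Q ^ (m + 1)‖ < 1 := fun m => by
    rw [norm_pow]; exact pow_lt_one₀ (norm_nonneg _) hQ (by simp)
  have e1 : lamW 1 Q = ∑' m : ℕ, ∑' k : ℕ, ((m + 1 : ℕ) : ℂ) * Q ^ ((m + 1) * (k + 1)) := by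
    rw [lamW, (summable_lamW hQ 1).tsum_eq_zero_add]
    simp only [mul_one, Nat.cast_zero, zero_mul, zero_add]
    refine tsum_congr fun m => ?_
    rw [tsum_mul_left]
    congr 1
    have := (hasSum_geometric_of_norm_lt_one (hn m)).mul_left (Q ^ (m + 1))
    rw [div_eq_mul_inv, ← this.tsum_eq]
    exact tsum_congr fun k => by rw [pow_mul, pow_succ' _ k]
  have e2 : lamSq Q = ∑' k : ℕ, ∑' m : ℕ, ((m + 1 : ℕ) : ℂ) * Q ^ ((m + 1) * (k + 1)) := by
    refine tsum_congr fun k => ?_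
    have h1 := hasSum_coe_mul_geometric_of_norm_lt_one (hn k)
    rw [← h1.tsum_eq, h1.summable.tsum_eq_zero_add]
    simp only [Nat.cast_zero, zero_mul, zero_add]
    exact tsum_congr fun m => by rw [mul_comm (m + 1) (k + 1), pow_mul]
  rw [e1, e2]
  refine (Summable.tsum_comm ?_).symm
  have h0 : Summable fun p : ℕ × ℕ => ((p.1 + 1 : ℕ) : ℝ) * ‖Q‖ ^ p.1 * ‖Q‖ ^ p.2 := by
    refine Summable.mul_of_nonneg (f := fun m : ℕ => ((m + 1 : ℕ) : ℝ) * ‖Q‖ ^ m)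
      (g := fun k : ℕ => ‖Q‖ ^ k) ?_ (summable_geometric_of_lt_one (norm_nonneg _) hQ)
      (fun m => mul_nonneg (Nat.cast_nonneg _) (pow_nonneg (norm_nonneg _) _))
      (fun m => pow_nonneg (norm_nonneg _) _)
    have := (summable_pow_mul_geometric_of_norm_lt_one (R := ℝ) 1 (r := ‖Q‖) (by simpa using hQ)).add
      (summable_geometric_of_lt_one (norm_nonneg _) hQ)
    refine this.congr fun m => ?_
    push_cast
    ring
  refine Summable.of_norm_bounded h0 fun p => ?_
  simp only [Function.uncurry]
  rw [norm_mul, Complex.norm_natCast, norm_pow, mul_assoc, ← pow_add]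
  have hpow : ‖Q‖ ^ ((p.1 + 1) * (p.2 + 1)) ≤ ‖Q‖ ^ (p.1 + p.2) := by
    refine pow_le_pow_of_le_one (norm_nonneg _) hQ.le ?_
    nlinarith [Nat.zero_le (p.1 * p.2)]
  exact mul_le_mul_of_nonneg_left hpow (Nat.cast_nonneg _)

end

/-! ### The logarithmic derivative of the theta function in the variable `w = e^{2ix}` -/

/-- `i θ₁'(x) / θ₁(x)` as a function of `w = e^{2ix}`. -/
def zetaW (Q w : ℂ) : ℂ := 1 + 2 * lam w Q - 2 * lam (Q * w⁻¹) Q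

/-- `zetaW` without its pole at `w = 1`. -/
def zetaReg (Q w : ℂ) : ℂ := 2 * lam (Q * w) Q - 2 * lam (Q * w⁻¹) Q

section
variable {Q : ℂ}

lemma zetaW_eq (hQ : ‖Q‖ < 1) {w : ℂ} (hw : w ≠ 1) :
    zetaW Q w = (1 + w) / (1 - w) + zetaReg Q w := by
  have : 1 - w ≠ 0 := sub_ne_zero.mpr hw.symm
  rw [zetaW, zetaReg, lam_eq hQ w]
  field_simp
  ring

lemma zetaReg_inv (w : ℂ) : zetaReg Q w⁻¹ = -zetaReg Q w := by
  rw [zetaReg, zetaReg, inv_inv]; ring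

lemma zetaW_inv (hQ : ‖Q‖ < 1) {w : ℂ} (h0 : w ≠ 0) (hw : w ≠ 1) : zetaW Q w⁻¹ = -zetaW Q w := by
  have h1 : 1 - w ≠ 0 := sub_ne_zero.mpr hw.symm
  have h2 : w - 1 ≠ 0 := sub_ne_zero.mpr hw
  rw [zetaW_eq hQ hw, zetaW_eq hQ (by simpa using hw), zetaReg_inv]
  field_simp
  ring

/-- The quasi-periodicity of θ₁ under x ↦ x + πτ in logarithmic form. The two Lambert series
exchange their first terms w/(1-w) and w⁻¹/(1-w⁻¹), whose sum is -1. -/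
lemma zetaW_mul (hQ : ‖Q‖ < 1) (hQ0 : Q ≠ 0) {w : ℂ} (h0 : w ≠ 0) (hw : w ≠ 1) :
    zetaW Q (Q * w) = zetaW Q w + 2 := by
  have h1 : 1 - w ≠ 0 := sub_ne_zero.mpr hw.symm
  have h2 : w - 1 ≠ 0 := sub_ne_zero.mpr hw
  have e : Q * (Q * w)⁻¹ = w⁻¹ := by field_simp
  rw [zetaW, zetaW, lam_eq hQ w, e, lam_eq hQ w⁻¹]
  field_simp
  ring

lemma eventually_ne_punctured (w c : ℂ) : ∀ᶠ v in 𝓝[≠] w, v ≠ c := by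
  by_cases h : w = c
  · subst h; exact self_mem_nhdsWithin
  · exact mem_nhdsWithin_of_mem_nhds (isOpen_compl_singleton.mem_nhds h)

lemma mul_deriv_zetaW_mul (hQ : ‖Q‖ < 1) (hQ0 : Q ≠ 0) {w : ℂ} (h0 : w ≠ 0) (hw : w ≠ 1) :
    (Q * w) * deriv (zetaW Q) (Q * w) = w * deriv (zetaW Q) w := by
  have h1 : (fun v => zetaW Q (Q * v)) =ᶠ[𝓝 w] fun v => zetaW Q v + 2 := by
    filter_upwards [isOpen_compl_singleton.mem_nhds (show w ∈ ({0}ᶜ : Set ℂ) from h0),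
      isOpen_compl_singleton.mem_nhds (show w ∈ ({1}ᶜ : Set ℂ) from hw)] with v hv0 hv1
    exact zetaW_mul hQ hQ0 hv0 hv1
  have h2 := h1.deriv_eq
  rw [deriv_comp_mul_left, deriv_add_const, smul_eq_mul] at h2
  rw [← h2]
  ring

lemma inv_mul_deriv_zetaW_inv (hQ : ‖Q‖ < 1) {w : ℂ} (h0 : w ≠ 0) (hw : w ≠ 1)
    (hd : DifferentiableAt ℂ (zetaW Q) w⁻¹) :
    w⁻¹ * deriv (zetaW Q) w⁻¹ = w * deriv (zetaW Q) w := by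
  have h1 : (fun v => zetaW Q v⁻¹) =ᶠ[𝓝 w] fun v => -zetaW Q v := by
    filter_upwards [isOpen_compl_singleton.mem_nhds (show w ∈ ({0}ᶜ : Set ℂ) from h0),
      isOpen_compl_singleton.mem_nhds (show w ∈ ({1}ᶜ : Set ℂ) from hw)] with v hv0 hv1
    exact zetaW_inv hQ hv0 hv1
  have h2 := h1.deriv_eq
  have h4 : deriv (fun v => zetaW Q v⁻¹) w = _ := (hd.hasDerivAt.comp w (hasDerivAt_inv h0)).deriv
  rw [h4, deriv.fun_neg] at h2
  have h3 : deriv (zetaW Q) w = deriv (zetaW Q) w⁻¹ * (w ^ 2)⁻¹ := by linear_combination h2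
  rw [h3]
  field_simp

/-- `w` is not an integral power of `Q`. -/
def Generic (Q w : ℂ) : Prop := w ≠ 0 ∧ ∀ k : ℤ, w ≠ Q ^ k

lemma Generic.regular {w : ℂ} (h : Generic Q w) : Regular Q w := fun m hm => by
  refine h.2 (-(m : ℤ)) ?_
  rw [zpow_neg, zpow_natCast, eq_inv_of_mul_eq_one_right hm]

lemma Generic.inv {w : ℂ} (h : Generic Q w) : Generic Q w⁻¹ :=
  ⟨inv_ne_zero h.1, fun k hk => h.2 (-k) (by rw [zpow_neg, ← hk, inv_inv])⟩

lemma Generic.ne_one {w : ℂ} (h : Generic Q w) : w ≠ 1 := by simpa using h.2 0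

lemma analyticAt_zetaW (hQ : ‖Q‖ < 1) {w : ℂ} (hw : Generic Q w) :
    AnalyticAt ℂ (zetaW Q) w := by
  refine (analyticAt_const.add (analyticAt_const.mul (analyticAt_lam hQ (hw.regular)))).sub
    (analyticAt_const.mul ?_)
  exact AnalyticAt.fun_comp (f := fun w => Q * w⁻¹) (analyticAt_lam hQ (hw.inv.regular).mul)
    (analyticAt_const.mul (analyticAt_id.inv hw.1))

lemma regular_self (hQ : ‖Q‖ < 1) : Regular Q Q := regular_of_norm_lt hQ hQ

lemma analyticAt_comp_inv_one {f : ℂ → ℂ} (hf : AnalyticAt ℂ f Q) :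
    AnalyticAt ℂ (fun w => f (Q * w)) 1 ∧ AnalyticAt ℂ (fun w => f (Q * w⁻¹)) 1 := by
  constructor
  · exact AnalyticAt.fun_comp (f := fun w => Q * w) (x := 1) (by simpa using hf) (by fun_prop)
  · exact AnalyticAt.fun_comp (f := fun w => Q * w⁻¹) (x := 1) (by simpa using hf)
      (analyticAt_const.mul (analyticAt_id.inv one_ne_zero))

lemma analyticAt_zetaReg_one (hQ : ‖Q‖ < 1) : AnalyticAt ℂ (zetaReg Q) 1 := by
  obtain ⟨h1, h2⟩ := analyticAt_comp_inv_one (analyticAt_lam hQ (regular_self hQ))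
  exact (analyticAt_const.mul h1).sub (analyticAt_const.mul h2)

lemma zetaReg_one : zetaReg Q 1 = 0 := by simp [zetaReg]

lemma deriv_zetaReg_one (hQ : ‖Q‖ < 1) : deriv (zetaReg Q) 1 = 4 * lamSq Q := by
  have h := (analyticAt_lam hQ (regular_self hQ)).differentiableAt.hasDerivAt
  have h1 : HasDerivAt (fun w => lam (Q * w) Q) (deriv (fun w => lam w Q) Q * Q) 1 := by
    have h2 : HasDerivAt (fun w : ℂ => Q * w) Q 1 := by simpa using (hasDerivAt_id (1 : ℂ)).const_mul Q
    exact HasDerivAt.comp (h₂ := fun w => lam w Q) (h := fun w => Q * w) 1 (by simpa using h) h2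
  have h3 : HasDerivAt (fun w => lam (Q * w⁻¹) Q) (deriv (fun w => lam w Q) Q * -Q) 1 := by
    have h2 : HasDerivAt (fun w : ℂ => Q * w⁻¹) (-Q) 1 := by
      simpa using (hasDerivAt_inv (one_ne_zero (α := ℂ))).const_mul Q
    exact HasDerivAt.comp (h₂ := fun w => lam w Q) (h := fun w => Q * w⁻¹) 1 (by simpa using h) h2
  have h4 := ((h1.const_mul 2).sub (h3.const_mul 2)).deriv
  rw [show (zetaReg Q) = fun w => 2 * lam (Q * w) Q - 2 * lam (Q * w⁻¹) Q from rfl]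
  refine h4.trans ?_
  rw [← mul_deriv_lam_self hQ]
  ring

/-- Factorization of an analytic function at a zero. -/
lemma exists_eq_sub_mul {f : ℂ → ℂ} {a : ℂ} (hf : AnalyticAt ℂ f a) (h0 : f a = 0) :
    ∃ k : ℂ → ℂ, AnalyticAt ℂ k a ∧ (∀ w, f w = (w - a) * k w) ∧ k a = deriv f a := by
  refine ⟨dslope f a, ?_, fun w => ?_, dslope_same f a⟩
  · obtain ⟨p, hp⟩ := hf
    exact ⟨_, hp.has_fpower_series_dslope_fslope⟩
  · have := sub_smul_dslope f a w
    rw [h0, sub_zero, smul_eq_mul] at this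
    exact this.symm

lemma deriv_zetaW_near_one (hQ : ‖Q‖ < 1) : ∀ᶠ w in 𝓝[≠] (1 : ℂ),
    deriv (zetaW Q) w = 2 / (1 - w) ^ 2 + deriv (zetaReg Q) w := by
  have h1 := (analyticAt_zetaReg_one hQ).eventually_analyticAt.filter_mono
    (nhdsWithin_le_nhds (s := {1}ᶜ))
  filter_upwards [h1, self_mem_nhdsWithin] with w hw hw1
  have h2 : 1 - w ≠ 0 := sub_ne_zero.mpr (Ne.symm hw1)
  have h3 : zetaW Q =ᶠ[𝓝 w] fun w => (1 + w) / (1 - w) + zetaReg Q w := by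
    filter_upwards [isOpen_compl_singleton.mem_nhds hw1] with v hv using zetaW_eq hQ hv
  rw [h3.deriv_eq]
  have h4 := (((hasDerivAt_id w).const_add 1).div ((hasDerivAt_id w).const_sub 1) h2).add
    hw.differentiableAt.hasDerivAt
  refine h4.deriv.trans ?_
  simp only [id]
  congr 1
  field_simp
  ring

lemma eq_of_eventually_punctured {f : ℂ → ℂ} {w c : ℂ} (hf : ContinuousAt f w)
    (h : f =ᶠ[𝓝[≠] w] fun _ => c) : f w = c :=
  tendsto_nhds_unique (hf.tendsto.mono_left nhdsWithin_le_nhds)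
    (tendsto_const_nhds.congr' h.symm)

lemma value_eq_of_eventually {f g : ℂ → ℂ} {w c : ℂ} (hg : ContinuousAt g w)
    (hfg : f =ᶠ[𝓝[≠] w] g) (h : f =ᶠ[𝓝[≠] w] fun _ => c) : g w = c :=
  eq_of_eventually_punctured hg (hfg.symm.trans h)

/-- The heat equation for the theta function, in logarithmic form. -/
theorem heat_identity (hQ : ‖Q‖ < 1) (hQ0 : Q ≠ 0) {w : ℂ} (hw : Generic Q w) :
    4 * (lamW 1 Q + lamW w Q + lamW w⁻¹ Q) =
      (2 * (w * deriv (zetaW Q) w) - zetaW Q w ^ 2 + 1) / 2 := by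
  -- The difference of the two sides: invariant under multiplication by Q and analytic away from the
  -- powers of Q.
  set f : ℂ → ℂ := fun w => 4 * (lamW 1 Q + lamW w Q + lamW w⁻¹ Q) -
      (2 * (w * deriv (zetaW Q) w) - zetaW Q w ^ 2 + 1) / 2 with hf
  have hreg : ∀ w, Generic Q w → AnalyticAt ℂ f w := by
    intro w hw
    have h1 := analyticAt_zetaW hQ hw
    have h2 := h1.deriv
    have h3 := analyticAt_lamW hQ (hw.regular)
    have h4 : AnalyticAt ℂ (fun w => lamW w⁻¹ Q) w :=
      AnalyticAt.fun_comp (f := fun w => w⁻¹) (analyticAt_lamW hQ (hw.inv.regular))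
        (analyticAt_id.inv hw.1)
    fun_prop
  have hper : ∀ w ≠ 0, ∀ᶠ v in 𝓝[≠] w, f (Q * v) = f v := by
    intro w _
    filter_upwards [eventually_ne_punctured w 0, eventually_ne_punctured w 1] with v h0 h1
    have e1 := lamW_eq hQ v
    have e2 := lamW_eq hQ (Q * v)⁻¹
    have e3 : Q * (Q * v)⁻¹ = v⁻¹ := by field_simp
    rw [e3] at e2
    have e4 : zetaW Q v = 1 + 2 * (v / (1 - v) + lam (Q * v) Q) -
        2 * lam (Q * v⁻¹) Q := by rw [zetaW, ← lam_eq hQ v]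
    have e5 := lam_eq hQ v⁻¹
    have e6 : v⁻¹ / (1 - v⁻¹) = - 1 / (1 - v) := by
      have : 1 - v ≠ 0 := sub_ne_zero.mpr h1.symm
      have : v - 1 ≠ 0 := sub_ne_zero.mpr h1
      field_simp
      ring
    have e7 : v / (1 - v) = 1 / (1 - v) - 1 := by
      have : 1 - v ≠ 0 := sub_ne_zero.mpr h1.symm
      field_simp
      ring
    simp only [hf]
    rw [mul_deriv_zetaW_mul hQ hQ0 h0 h1, zetaW_mul hQ hQ0 h0 h1]
    rw [e7] at e4
    rw [e6] at e5
    linear_combination 4 * e2 - 4 * e1 + 2 * e4 + 4 * e5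
  -- the behaviour at `1`
  have hQr := regular_self hQ
  obtain ⟨b1, b2⟩ := analyticAt_comp_inv_one (analyticAt_lamW hQ hQr)
  obtain ⟨b3, b4⟩ := analyticAt_comp_inv_one (analyticAt_lam hQ hQr)
  have b5 := analyticAt_zetaReg_one hQ
  have b6 := b5.deriv
  obtain ⟨k, hk, hke, hk1⟩ := exists_eq_sub_mul b5 zetaReg_one
  -- The double poles cancel because 4w - (1+w)² = -(1-w)². The cross term (1+w)/(1-w) · `zetaReg`
  -- loses its pole through the factorization `zetaReg` = (w-1)k.
  set g : ℂ → ℂ := fun w => 4 * (lamW 1 Q + (lamW (Q * w) Q + lam (Q * w) Q) +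
      (lamW (Q * w⁻¹) Q + lam (Q * w⁻¹) Q)) -
      (2 * (w * deriv (zetaReg Q) w) + 2 * (1 + w) * k w - zetaReg Q w ^ 2) / 2 with hg
  have hga : AnalyticAt ℂ g 1 := by fun_prop
  have hfg : f =ᶠ[𝓝[≠] 1] g := by
    filter_upwards [deriv_zetaW_near_one hQ, self_mem_nhdsWithin] with w h1 h2
    have h3 : 1 - w ≠ 0 := sub_ne_zero.mpr (Ne.symm h2)
    have e := hke w
    simp only [hf, hg]
    rw [h1, lamW_eq hQ w, lamW_eq hQ w⁻¹, zetaW_eq hQ h2, e]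
    field_simp
    ring
  obtain ⟨c, hc⟩ := eq_const_of_mul_periodic hQ0 hQ (f := f) (fun w h0 => by
    by_cases h : Generic Q w
    · exact (hreg w h).removableAt
    · simp only [Generic, not_and, not_forall, not_not] at h
      obtain ⟨k, hk⟩ := h h0
      rw [hk, ← mul_one (Q ^ k), removableAt_zpow_mul_iff hQ0 hper one_ne_zero]
      exact ⟨g, hga, hfg⟩) hper
  -- At w = 1 the value is 12 `lamW 1 Q` - 12 `lamSq Q`, which vanishes.
  have hc0 : c = 0 := by
    rw [← value_eq_of_eventually hga.continuousAt hfg (hc 1 one_ne_zero)]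
    simp only [hg, hk1, zetaReg_one, deriv_zetaReg_one hQ, mul_one, inv_one]
    rw [← lamW_one hQ]
    have := lamW_eq hQ 1
    rw [mul_one] at this
    linear_combination -8 * this
  have := eq_of_eventually_punctured (hreg w hw).continuousAt (hc w hw.1)
  rw [hc0] at this
  exact sub_eq_zero.mp this

/-- The addition theorem for the logarithmic derivative of the theta function. -/
theorem addition_identity (hQ : ‖Q‖ < 1) (hQ0 : Q ≠ 0) {a b c : ℂ} (ha : Generic Q a)
    (hb : Generic Q b) (hc : Generic Q c) (habc : a * b * c = 1) :
    -(zetaW Q a + zetaW Q b + zetaW Q c) ^ 2 + 2 * (a * deriv (zetaW Q) a + b * deriv (zetaW Q) b +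
      c * deriv (zetaW Q) c) = -1 + 24 * lamSq Q := by
  -- With b fixed and c = (ab)⁻¹, replacing a by Qa shifts the first and third logarithmic
  -- derivatives by +2 and -2, so their sum is invariant.
  set f : ℂ → ℂ := fun a => -(zetaW Q a + zetaW Q b + zetaW Q (a * b)⁻¹) ^ 2 +
    2 * (a * deriv (zetaW Q) a + b * deriv (zetaW Q) b +
      (a * b)⁻¹ * deriv (zetaW Q) (a * b)⁻¹) with hf
  have hb0 := hb.1
  have hreg : ∀ a, Generic Q a → Generic Q (a * b)⁻¹ → AnalyticAt ℂ f a := by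
    intro a ha hc
    have h0 := ha.1
    have h1 := analyticAt_zetaW hQ ha
    have h2 := h1.deriv
    have h3 : AnalyticAt ℂ (fun a => (a * b)⁻¹) a :=
      (analyticAt_id.mul analyticAt_const).inv (mul_ne_zero h0 hb0)
    have h4 := (analyticAt_zetaW hQ hc)
    have h5 := AnalyticAt.fun_comp (f := fun a => (a * b)⁻¹) h4 h3
    have h6 := AnalyticAt.fun_comp (f := fun a => (a * b)⁻¹) h4.deriv h3
    fun_prop
  have hper : ∀ w ≠ 0, ∀ᶠ v in 𝓝[≠] w, f (Q * v) = f v := by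
    intro w _
    filter_upwards [eventually_ne_punctured w 0, eventually_ne_punctured w 1,
      eventually_ne_punctured w (Q * b)⁻¹] with v h0 h1 h2
    have h3 : (Q * v * b)⁻¹ ≠ 1 := by
      intro h
      rw [inv_eq_one] at h
      exact h2 (eq_inv_of_mul_eq_one_left (by linear_combination h))
    have h4 : (Q * v * b)⁻¹ ≠ 0 := inv_ne_zero (mul_ne_zero (mul_ne_zero hQ0 h0) hb0)
    have e0 : Q * (Q * v * b)⁻¹ = (v * b)⁻¹ := by field_simp
    have e1 := zetaW_mul hQ hQ0 h4 h3
    have e2 := mul_deriv_zetaW_mul hQ hQ0 h4 h3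
    rw [e0] at e1 e2
    simp only [hf]
    rw [mul_deriv_zetaW_mul hQ hQ0 h0 h1, zetaW_mul hQ hQ0 h0 h1, e1, e2]
    ring
  have b5 := analyticAt_zetaReg_one hQ
  have b6 := b5.deriv
  obtain ⟨k, hk, hke, hk1⟩ := exists_eq_sub_mul b5 zetaReg_one
  have hbi := analyticAt_zetaW hQ hb.inv
  have hinv : AnalyticAt ℂ (fun a => (a * b)⁻¹) 1 :=
    (analyticAt_id.mul analyticAt_const).inv (by simpa using hb0)
  have hbi' : AnalyticAt ℂ (zetaW Q) (1 * b)⁻¹ := by rwa [one_mul]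
  have b7 := AnalyticAt.fun_comp (f := fun a => (a * b)⁻¹) hbi' hinv
  have b8 := AnalyticAt.fun_comp (f := fun a => (a * b)⁻¹) hbi'.deriv hinv
  have b9 : AnalyticAt ℂ (fun a => zetaW Q b + zetaW Q (a * b)⁻¹) 1 := analyticAt_const.add b7
  -- At a = 1 the other two terms cancel by oddness; this zero absorbs the simple pole of the cross
  -- term.
  obtain ⟨e, he, hee, he1⟩ := exists_eq_sub_mul b9 (by
    rw [one_mul, zetaW_inv hQ hb0 hb.ne_one, add_neg_cancel])
  set g : ℂ → ℂ := fun w => -1 + 2 * (w * deriv (zetaReg Q) w) + 2 * (1 + w) * k w - zetaReg Q w ^ 2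
    + 2 * (1 + w) * e w - 2 * zetaReg Q w * (zetaW Q b + zetaW Q (w * b)⁻¹)
    - (zetaW Q b + zetaW Q (w * b)⁻¹) ^ 2
    + 2 * (b * deriv (zetaW Q) b + (w * b)⁻¹ * deriv (zetaW Q) (w * b)⁻¹) with hg
  have hga : AnalyticAt ℂ g 1 := by fun_prop
  have hfg : f =ᶠ[𝓝[≠] 1] g := by
    filter_upwards [deriv_zetaW_near_one hQ, self_mem_nhdsWithin] with w h1 h2
    have h3 : 1 - w ≠ 0 := sub_ne_zero.mpr (Ne.symm h2)
    have e1 := hke w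
    have e2 := hee w
    have e3 : zetaW Q (w * b)⁻¹ = (w - 1) * e w - zetaW Q b := by linear_combination e2
    simp only [hf, hg]
    rw [h1, zetaW_eq hQ h2, e1, e3]
    field_simp
    ring
  have hone : RemovableAt f 1 := ⟨g, hga, hfg⟩
  -- At a = b⁻¹ it is c that reaches 1. The expression is symmetric in a and c, so the substitution
  -- a ↦ (ab)⁻¹ moves this point to 1.
  have hbinv : RemovableAt f b⁻¹ := by
    refine ⟨fun a => g (a * b)⁻¹, ?_, ?_⟩
    · refine AnalyticAt.fun_comp (f := fun a => (a * b)⁻¹) (x := b⁻¹) ?_ ?_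
      · rwa [inv_mul_cancel₀ hb0, inv_one]
      · exact (analyticAt_id.mul analyticAt_const).inv (mul_ne_zero (inv_ne_zero hb0) hb0)
    · have ht : Tendsto (fun a => (a * b)⁻¹) (𝓝[≠] b⁻¹) (𝓝[≠] 1) := by
        refine tendsto_nhdsWithin_of_tendsto_nhds_of_eventually_within _ ?_ ?_
        · have : ContinuousAt (fun a => (a * b)⁻¹) b⁻¹ :=
            (continuousAt_id.mul continuousAt_const).inv₀ (mul_ne_zero (inv_ne_zero hb0) hb0)
          have h2 := this.tendsto.mono_left (nhdsWithin_le_nhds (s := {b⁻¹}ᶜ))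
          rwa [inv_mul_cancel₀ hb0, inv_one] at h2
        · filter_upwards [self_mem_nhdsWithin] with v hv h
          rw [mem_singleton_iff, inv_eq_one] at h
          exact hv (eq_inv_of_mul_eq_one_left h)
      filter_upwards [ht.eventually hfg, eventually_ne_punctured b⁻¹ 0] with v h1 h0
      rw [← h1]
      have e1 : ((v * b)⁻¹ * b)⁻¹ = v := by field_simp
      simp only [hf, e1]
      ring
  obtain ⟨C, hC⟩ := eq_const_of_mul_periodic hQ0 hQ (f := f) (fun w h0 => by
    by_cases h : Generic Q w
    · by_cases h' : Generic Q (w * b)⁻¹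
      · exact (hreg w h h').removableAt
      · simp only [Generic, not_and, not_forall, not_not] at h'
        obtain ⟨k, hk⟩ := h' (inv_ne_zero (mul_ne_zero h0 hb0))
        have : w = Q ^ (-k) * b⁻¹ := by
          rw [zpow_neg, ← hk]
          field_simp
        rw [this, removableAt_zpow_mul_iff hQ0 hper (inv_ne_zero hb0)]
        exact hbinv
    · simp only [Generic, not_and, not_forall, not_not] at h
      obtain ⟨k, hk⟩ := h h0
      rw [hk, ← mul_one (Q ^ k), removableAt_zpow_mul_iff hQ0 hper one_ne_zero]
      exact hone) hper
  have hc' : c = (a * b)⁻¹ := eq_inv_of_mul_eq_one_right habc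
  have h1 := eq_of_eventually_punctured (hreg a ha (hc' ▸ hc)).continuousAt (hC a ha.1)
  -- The constant is evaluated at a = 1: the terms in b cancel by parity, and `zetaReg` contributes
  -- (8 + 16) `lamSq Q`.
  have h2 := value_eq_of_eventually hga.continuousAt hfg (hC 1 one_ne_zero)
  have e1 : deriv (fun a => zetaW Q b + zetaW Q (a * b)⁻¹) 1 = -(b⁻¹ * deriv (zetaW Q) b⁻¹) := by
    have h3 : HasDerivAt (fun a : ℂ => (a * b)⁻¹) (-b⁻¹) 1 := by
      have := ((hasDerivAt_id (1 : ℂ)).mul_const b).inv (by simpa using hb0)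
      refine this.congr_deriv ?_
      simp only [id]
      field_simp
    have h4 := HasDerivAt.comp (h₂ := zetaW Q) (h := fun a => (a * b)⁻¹) 1
      hbi'.differentiableAt.hasDerivAt h3
    refine (h4.const_add (zetaW Q b)).deriv.trans ?_
    rw [one_mul]
    ring
  have e2 := inv_mul_deriv_zetaW_inv hQ hb0 hb.ne_one hbi.differentiableAt
  have e3 := zetaW_inv hQ hb0 hb.ne_one
  simp only [hg, hk1, he1, e1, one_mul, zetaReg_one, deriv_zetaReg_one hQ, e2, e3] at h2
  simp only [hf, ← hc'] at h1
  rw [h1, ← h2]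
  ring

end

attribute [local fun_prop] analyticAt_fst analyticAt_snd

/-! ### The logarithm of the theta function as a function of `x` and `Q = q²` -/

/-- `∑_{m ≥ 0} log (1 - Q^m w)` as a function of `(w, Q)`. -/
def logQPoch (p : ℂ × ℂ) : ℂ := ∑' m : ℕ, Complex.log (1 - p.2 ^ m * p.1)

/-- The open bidisc. -/
def bidisc : Set (ℂ × ℂ) := {p | ‖p.1‖ < 1 ∧ ‖p.2‖ < 1}

lemma isOpen_bidisc : IsOpen bidisc :=
  (isOpen_lt (continuous_fst.norm) continuous_const).inter
    (isOpen_lt (continuous_snd.norm) continuous_const)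

lemma norm_pow_mul_lt {w Q : ℂ} (hw : ‖w‖ < 1) (hQ : ‖Q‖ < 1) (m : ℕ) : ‖Q ^ m * w‖ < 1 := by
  rw [norm_mul, norm_pow]
  calc _ ≤ 1 * ‖w‖ := by gcongr; exact pow_le_one₀ (norm_nonneg _) hQ.le
    _ < 1 := by rwa [one_mul]

lemma one_sub_mem_slitPlane {z : ℂ} (hz : ‖z‖ < 1) : 1 - z ∈ slitPlane := by
  refine Or.inl ?_
  have := (re_le_norm z).trans_lt hz
  simpa using this

lemma norm_log_one_sub_le {z : ℂ} {r : ℝ} (hr : r < 1) (hz : ‖z‖ ≤ r) :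
    ‖Complex.log (1 - z)‖ ≤ ‖z‖ * (1 - r)⁻¹ := by
  have h1 := Complex.norm_log_one_add_le (z := -z) (by rw [norm_neg]; linarith)
  rw [norm_neg, ← sub_eq_add_neg] at h1
  refine h1.trans ?_
  have h2 : 0 < 1 - r := by linarith
  have h3 : (1 - ‖z‖)⁻¹ ≤ (1 - r)⁻¹ := inv_anti₀ h2 (by linarith)
  have h0 := norm_nonneg z
  have h4 : 0 < (1 - r)⁻¹ := inv_pos.mpr h2
  have h5 : (1 - r) * (1 - r)⁻¹ = 1 := mul_inv_cancel₀ h2.ne'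
  have h6 : ‖z‖ ^ 2 * (1 - ‖z‖)⁻¹ / 2 ≤ ‖z‖ * (r * (1 - r)⁻¹) := by
    calc ‖z‖ ^ 2 * (1 - ‖z‖)⁻¹ / 2 ≤ ‖z‖ ^ 2 * (1 - r)⁻¹ / 2 := by gcongr
      _ ≤ ‖z‖ ^ 2 * (1 - r)⁻¹ := by
        have : 0 ≤ ‖z‖ ^ 2 * (1 - r)⁻¹ := by positivity
        linarith
      _ = ‖z‖ * (‖z‖ * (1 - r)⁻¹) := by ring
      _ ≤ _ := by gcongr
  calc _ ≤ ‖z‖ * (r * (1 - r)⁻¹) + ‖z‖ * ((1 - r) * (1 - r)⁻¹) := by rw [h5]; linarith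
    _ = _ := by ring

lemma norm_log_term_le {w Q : ℂ} {r s : ℝ} (hr : r < 1) (hw : ‖w‖ ≤ r) (hs : s < 1) (hQ : ‖Q‖ ≤ s)
    (m : ℕ) : ‖Complex.log (1 - Q ^ m * w)‖ ≤ s ^ m * (r * (1 - r)⁻¹) := by
  have h0 := norm_nonneg Q
  have h1 : ‖Q ^ m * w‖ ≤ s ^ m * r := by
    rw [norm_mul, norm_pow]
    have := h0.trans hQ
    gcongr
  have h2 : s ^ m ≤ 1 := pow_le_one₀ (h0.trans hQ) hs.le
  have h3 : 0 ≤ r := (norm_nonneg w).trans hw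
  have h5 : (0 : ℝ) < (1 - r)⁻¹ := inv_pos.mpr (by linarith)
  refine (norm_log_one_sub_le hr (h1.trans (mul_le_of_le_one_left h3 h2))).trans ?_
  rw [← mul_assoc]
  exact mul_le_mul_of_nonneg_right h1 h5.le

lemma analyticOnNhd_logQPoch : AnalyticOnNhd ℂ logQPoch bidisc := by
  refine analyticOnNhd_tsum isOpen_bidisc (fun m p hp => ?_) fun p hp => ?_
  · refine AnalyticAt.clog (by fun_prop) ?_
    exact one_sub_mem_slitPlane (norm_pow_mul_lt hp.1 hp.2 m)
  · obtain ⟨r, hr1, hr2⟩ := exists_between hp.1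
    obtain ⟨s, hs1, hs2⟩ := exists_between hp.2
    refine ⟨{p | ‖p.1‖ < r ∧ ‖p.2‖ < s}, ?_, fun m => s ^ m * (r * (1 - r)⁻¹), ?_, ?_⟩
    · exact ((isOpen_lt (continuous_fst.norm) continuous_const).inter
        (isOpen_lt (continuous_snd.norm) continuous_const)).mem_nhds ⟨hr1, hs1⟩
    · exact (summable_geometric_of_lt_one ((norm_nonneg _).trans hs1.le) hs2).mul_right _
    · exact fun m q hq => norm_log_term_le hr2 hq.1.le hs2 hq.2.le m

lemma mul_dfst_logQPoch {w Q : ℂ} (hw : ‖w‖ < 1) (hQ : ‖Q‖ < 1) :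
    w * dfst logQPoch (w, Q) = -lam w Q := by
  have hd : ∀ (m : ℕ) (w : ℂ), ‖w‖ < 1 → HasDerivAt (fun w : ℂ => Complex.log (1 - Q ^ m * w))
      (-(Q ^ m) / (1 - Q ^ m * w)) w := fun m w hw => by
    have h1 : HasDerivAt (fun w : ℂ => 1 - Q ^ m * w) (-(Q ^ m)) w := by
      simpa using ((hasDerivAt_id w).const_mul (Q ^ m)).const_sub 1
    exact h1.clog (one_sub_mem_slitPlane (norm_pow_mul_lt hw hQ m))
  have h := (differentiableOn_of_series (f := fun m w => Complex.log (1 - Q ^ m * w))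
    (fun m w hw => (hd m w (by simpa using hw)).differentiableAt.differentiableWithinAt)
    (fun r _ hr => ⟨fun m => ‖Q‖ ^ m * (r * (1 - r)⁻¹),
      (summable_geometric_of_lt_one (norm_nonneg _) hQ).mul_right _,
      fun m w hw => norm_log_term_le hr (mem_ball_zero_iff.mp hw).le hQ le_rfl m⟩) hw).2
  have h2 := h.mul_left w
  rw [show dfst logQPoch (w, Q) = deriv (fun w => ∑' m : ℕ, Complex.log (1 - Q ^ m * w)) w from rfl,
    ← h2.tsum_eq, lam, ← tsum_neg]
  refine tsum_congr fun m => ?_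
  rw [(hd m w hw).deriv]
  ring

lemma mul_dsnd_logQPoch {w Q : ℂ} (hw : ‖w‖ < 1) (hQ : ‖Q‖ < 1) :
    Q * dsnd logQPoch (w, Q) = -lamW w Q := by
  have hd : ∀ (m : ℕ) (Q : ℂ), ‖Q‖ < 1 → HasDerivAt (fun Q : ℂ => Complex.log (1 - Q ^ m * w))
      (-(m * Q ^ (m - 1) * w) / (1 - Q ^ m * w)) Q := fun m Q hQ => by
    have h1 : HasDerivAt (fun Q : ℂ => 1 - Q ^ m * w) (-(m * Q ^ (m - 1) * w)) Q := by
      simpa using ((hasDerivAt_pow m Q).mul_const w).const_sub 1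
    exact h1.clog (one_sub_mem_slitPlane (norm_pow_mul_lt hw hQ m))
  have h := (differentiableOn_of_series (f := fun m Q => Complex.log (1 - Q ^ m * w))
    (fun m Q hQ => (hd m Q (by simpa using hQ)).differentiableAt.differentiableWithinAt)
    (fun s hs0 hs => ⟨fun m => s ^ m * (‖w‖ * (1 - ‖w‖)⁻¹),
      (summable_geometric_of_lt_one hs0.le hs).mul_right _,
      fun m Q hQ => norm_log_term_le hw le_rfl hs (mem_ball_zero_iff.mp hQ).le m⟩) hQ).2
  have h2 := h.mul_left Q
  rw [show dsnd logQPoch (w, Q) = deriv (fun Q => ∑' m : ℕ, Complex.log (1 - Q ^ m * w)) Q from rfl,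
    ← h2.tsum_eq, lamW, ← tsum_neg]
  refine tsum_congr fun m => ?_
  rw [(hd m Q hQ).deriv]
  rcases m with _ | m
  · simp
  · rw [Nat.add_sub_cancel, pow_succ]
    ring

/-- The strip `|Q| e^{2 |Im x|} < 1`. -/
def stripQ : Set (ℂ × ℂ) := {p | ‖p.2‖ * Real.exp (2 * |p.1.im|) < 1}

lemma isOpen_stripQ : IsOpen stripQ :=
  isOpen_lt (by fun_prop) continuous_const

lemma norm_lt_of_mem_stripQ {p : ℂ × ℂ} (hp : p ∈ stripQ) : ‖p.2‖ < 1 := by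
  have h1 : (1 : ℝ) ≤ Real.exp (2 * |p.1.im|) := Real.one_le_exp (by positivity)
  have h2 := norm_nonneg p.2
  have h3 : ‖p.2‖ * Real.exp (2 * |p.1.im|) < 1 := hp
  nlinarith

lemma norm_mul_exp_lt {p : ℂ × ℂ} (hp : p ∈ stripQ) :
    ‖p.2 * cexp (2 * I * p.1)‖ < 1 ∧ ‖p.2 * cexp (-(2 * I * p.1))‖ < 1 := by
  have h : ∀ y : ℝ, y ≤ 2 * |p.1.im| → ‖p.2‖ * Real.exp y < 1 := fun y hy =>
    lt_of_le_of_lt (mul_le_mul_of_nonneg_left (Real.exp_le_exp.mpr hy) (norm_nonneg _)) hp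
  have h1 := neg_abs_le p.1.im
  have h2 := le_abs_self p.1.im
  rw [norm_mul, norm_mul, Complex.norm_exp, Complex.norm_exp]
  constructor <;> refine h _ ?_ <;> simp <;> linarith

/-- The logarithm of `θ₁(x) / sin x` as a function of `(x, Q)`. -/
def logTheta (p : ℂ × ℂ) : ℂ :=
  logQPoch (p.2, p.2) + logQPoch (p.2 * cexp (2 * I * p.1), p.2) +
    logQPoch (p.2 * cexp (-(2 * I * p.1)), p.2)

/-- The dependence on τ is only through Q = q², which lets the functions be studied up to and
including Q = 0. -/
lemma logThetaReg_eq {x τ : ℂ} (hτ : 0 < τ.im) :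
    logThetaReg x τ = logTheta (x, nome τ ^ 2) := by
  have s0 : Summable fun m : ℕ => Complex.log (1 - nome τ ^ (2 * (m + 1))) := by
    simpa using summable_log_factor hτ 1
  have sp := summable_log_factor hτ (cexp (2 * I * x))
  have sm := summable_log_factor hτ (cexp (-(2 * I * x)))
  have e : ∀ m : ℕ, nome τ ^ (2 * (m + 1)) = (nome τ ^ 2) ^ m * nome τ ^ 2 := fun m => by
    rw [pow_mul, pow_succ]
  rw [logThetaReg, (s0.add sp).tsum_add sm, s0.tsum_add sp, logTheta, logQPoch, logQPoch, logQPoch]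
  simp only [e, mul_assoc]

lemma analyticAt_logTheta {p : ℂ × ℂ} (hp : p ∈ stripQ) : AnalyticAt ℂ logTheta p := by
  have hQ := norm_lt_of_mem_stripQ hp
  obtain ⟨h1, h2⟩ := norm_mul_exp_lt hp
  refine AnalyticAt.add (AnalyticAt.add ?_ ?_) ?_
  · exact AnalyticAt.fun_comp (f := fun p : ℂ × ℂ => (p.2, p.2))
      (analyticOnNhd_logQPoch _ ⟨hQ, hQ⟩) (by fun_prop)
  · exact AnalyticAt.fun_comp (f := fun p : ℂ × ℂ => (p.2 * cexp (2 * I * p.1), p.2))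
      (analyticOnNhd_logQPoch _ ⟨h1, hQ⟩) (by fun_prop)
  · exact AnalyticAt.fun_comp (f := fun p : ℂ × ℂ => (p.2 * cexp (-(2 * I * p.1)), p.2))
      (analyticOnNhd_logQPoch _ ⟨h2, hQ⟩) (by fun_prop)

lemma logTheta_neg (x Q : ℂ) : logTheta (-x, Q) = logTheta (x, Q) := by
  simp only [logTheta, mul_neg, neg_neg]
  ring

lemma logTheta_add_pi (x Q : ℂ) : logTheta (x + Real.pi, Q) = logTheta (x, Q) := by
  have h1 : cexp (2 * I * (x + Real.pi)) = cexp (2 * I * x) := by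
    rw [show 2 * I * (x + Real.pi) = 2 * I * x + 2 * Real.pi * I by ring]
    exact Complex.exp_periodic _
  simp only [logTheta, Complex.exp_neg, h1]

/-- `θ₁'/θ₁ - cot` as a function of `(x, Q)`. -/
def rho : ℂ × ℂ → ℂ := dfst logTheta

/-- The derivative of `rho` in `x`. -/
def rho' : ℂ × ℂ → ℂ := dfst rho

lemma analyticAt_rho {p : ℂ × ℂ} (hp : p ∈ stripQ) : AnalyticAt ℂ rho p :=
  (analyticAt_logTheta hp).dfst

lemma analyticAt_rho' {p : ℂ × ℂ} (hp : p ∈ stripQ) : AnalyticAt ℂ rho' p :=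
  (analyticAt_rho hp).dfst

lemma hasDerivAt_comp_exp (f : ℂ → ℂ) (c : ℂ) {f' x : ℂ} (hf : HasDerivAt f f' (cexp (c * x))) :
    HasDerivAt (fun x => f (cexp (c * x))) (f' * (cexp (c * x) * c)) x := by
  have h : HasDerivAt (fun x => cexp (c * x)) (cexp (c * x) * c) x := by
    simpa using ((hasDerivAt_id x).const_mul c).cexp
  exact hf.comp x h

lemma rho_eq {x Q : ℂ} (hp : (x, Q) ∈ stripQ) : rho (x, Q) = -I * zetaReg Q (cexp (2 * I * x)) := by
  have hQ := norm_lt_of_mem_stripQ hp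
  obtain ⟨h1, h2⟩ := norm_mul_exp_lt hp
  have hc : ∀ c : ℂ, ‖Q * cexp (c * x)‖ < 1 →
      HasDerivAt (fun x => logQPoch (Q * cexp (c * x), Q)) (-c * lam (Q * cexp (c * x)) Q) x := by
    intro c h
    have d1 := hasDerivAt_dfst (analyticOnNhd_logQPoch (Q * cexp (c * x), Q) ⟨h, hQ⟩)
    have d2 : HasDerivAt (fun w => logQPoch (Q * w, Q)) (dfst logQPoch (Q * cexp (c * x), Q) * Q)
        (cexp (c * x)) := by
      have d3 : HasDerivAt (fun w : ℂ => Q * w) Q (cexp (c * x)) := by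
        simpa using (hasDerivAt_id (cexp (c * x))).const_mul Q
      exact HasDerivAt.comp (h₂ := fun w => logQPoch (w, Q)) _ d1 d3
    refine (hasDerivAt_comp_exp _ c d2).congr_deriv ?_
    linear_combination c * mul_dfst_logQPoch h hQ
  have e := ((hc (2 * I) h1).const_add (logQPoch (Q, Q))).add
    (hc (-(2 * I)) (by simpa only [neg_mul] using h2))
  have e2 : rho (x, Q) = _ := (e.congr_of_eventuallyEq (f₁ := fun x => logTheta (x, Q))
    (.of_forall fun x => by simp only [logTheta, neg_mul]; rfl)).deriv
  rw [e2, zetaReg, ← Complex.exp_neg, neg_mul (2 * I)]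
  ring_nf

lemma hasDerivAt_zetaReg {Q w : ℂ} (hQ : ‖Q‖ < 1) (h0 : w ≠ 0) (h1 : ‖Q * w‖ < 1)
    (h2 : ‖Q * w⁻¹‖ < 1) : DifferentiableAt ℂ (zetaReg Q) w := by
  have a1 := (analyticAt_lam hQ (regular_of_norm_lt hQ h1)).differentiableAt
  have a2 := (analyticAt_lam hQ (regular_of_norm_lt hQ h2)).differentiableAt
  refine DifferentiableAt.sub (DifferentiableAt.const_mul ?_ _) (DifferentiableAt.const_mul ?_ _)
  · exact DifferentiableAt.comp (g := fun w => lam w Q) (f := fun w => Q * w) w a1 (by fun_prop)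
  · exact DifferentiableAt.comp (g := fun w => lam w Q) (f := fun w => Q * w⁻¹) w a2
      ((differentiableAt_inv h0).const_mul Q)

lemma rho'_eq {x Q : ℂ} (hp : (x, Q) ∈ stripQ) :
    rho' (x, Q) = 2 * (cexp (2 * I * x) * deriv (zetaReg Q) (cexp (2 * I * x))) := by
  have hQ := norm_lt_of_mem_stripQ hp
  obtain ⟨h1, h2⟩ := norm_mul_exp_lt hp
  rw [Complex.exp_neg] at h2
  have hd := (hasDerivAt_zetaReg hQ (Complex.exp_ne_zero _) h1 h2).hasDerivAt
  have e := (hasDerivAt_comp_exp _ _ hd).const_mul (-I)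
  have hev : (fun x => rho (x, Q)) =ᶠ[𝓝 x] fun x => -I * zetaReg Q (cexp (2 * I * x)) := by
    have hO : IsOpen {x | (x, Q) ∈ stripQ} := isOpen_stripQ.preimage (by fun_prop)
    filter_upwards [hO.mem_nhds hp] with x hx using rho_eq hx
  have e2 : rho' (x, Q) = _ := (e.congr_of_eventuallyEq hev).deriv
  rw [e2]
  linear_combination (-2 * cexp (2 * I * x) * deriv (zetaReg Q) (cexp (2 * I * x))) * I_sq

/-- Q enters each factor both as the base and through the argument Qw. The two contributions `lam (Q
* w) Q` and `lamW (Q * w) Q` recombine by `lamW_eq`. -/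
lemma mul_dsnd_logTheta {x Q : ℂ} (hp : (x, Q) ∈ stripQ) :
    Q * dsnd logTheta (x, Q) =
      -(lamW 1 Q + lamW (cexp (2 * I * x)) Q + lamW (cexp (2 * I * x))⁻¹ Q) := by
  have hQ := norm_lt_of_mem_stripQ hp
  obtain ⟨h1, h2⟩ := norm_mul_exp_lt hp
  have hc : ∀ w : ℂ, ‖Q * w‖ < 1 → HasDerivAt (fun Q => logQPoch (Q * w, Q))
      (dfst logQPoch (Q * w, Q) * w + dsnd logQPoch (Q * w, Q)) Q ∧
      Q * (dfst logQPoch (Q * w, Q) * w + dsnd logQPoch (Q * w, Q)) = -lamW w Q := by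
    intro w hw
    have ha := analyticOnNhd_logQPoch (Q * w, Q) ⟨hw, hQ⟩
    constructor
    · have d1 : HasDerivAt (fun Q : ℂ => (Q * w, Q)) (w, 1) Q := by
        simpa using ((hasDerivAt_id Q).mul_const w).prodMk (hasDerivAt_id Q)
      have d2 := HasFDerivAt.comp_hasDerivAt (f := fun Q : ℂ => (Q * w, Q)) Q
        ha.differentiableAt.hasFDerivAt d1
      refine d2.congr_deriv ?_
      have e1 : dfst logQPoch (Q * w, Q) = _ := ha.hasDerivAt_fst.deriv
      have e2 : dsnd logQPoch (Q * w, Q) = _ := ha.hasDerivAt_snd.deriv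
      rw [e1, e2, show ((w, 1) : ℂ × ℂ) = w • ((1, 0) : ℂ × ℂ) + (0, 1) by simp, map_add, map_smul,
        smul_eq_mul, mul_comm]
    · have e1 := mul_dfst_logQPoch hw hQ
      have e2 := mul_dsnd_logQPoch hw hQ
      rw [lamW_eq hQ w]
      linear_combination e1 + e2
  obtain ⟨a1, b1⟩ := hc 1 (by simpa using hQ)
  obtain ⟨a2, b2⟩ := hc _ h1
  obtain ⟨a3, b3⟩ := hc _ h2
  have e : dsnd logTheta (x, Q) = _ := (((a1.add a2).add a3).congr_of_eventuallyEq
    (f₁ := fun Q => logTheta (x, Q)) (.of_forall fun x => by simp only [logTheta, mul_one]; rfl)).deriv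
  rw [e, mul_add, mul_add, b1, b2, b3, Complex.exp_neg]
  ring

/-- `θ₁'/θ₁` as a function of `(x, Q)`. -/
def phi (p : ℂ × ℂ) : ℂ := Complex.cos p.1 / Complex.sin p.1 + rho p

/-- The derivative of `phi` in `x`. -/
def phi' (p : ℂ × ℂ) : ℂ := -1 / Complex.sin p.1 ^ 2 + rho' p

lemma hasDerivAt_cot {x : ℂ} (hx : Complex.sin x ≠ 0) :
    HasDerivAt (fun x => Complex.cos x / Complex.sin x) (-1 / Complex.sin x ^ 2) x := by
  refine ((Complex.hasDerivAt_cos x).div (Complex.hasDerivAt_sin x) hx).congr_deriv ?_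
  congr 1
  linear_combination -Complex.sin_sq_add_cos_sq x

lemma hasDerivAt_phi {x Q : ℂ} (hp : (x, Q) ∈ stripQ) (hx : Complex.sin x ≠ 0) :
    HasDerivAt (fun x => phi (x, Q)) (phi' (x, Q)) x :=
  (hasDerivAt_cot hx).add (hasDerivAt_dfst (analyticAt_rho hp))

lemma exp_ne_one_of_sin_ne_zero {x : ℂ} (hx : Complex.sin x ≠ 0) : cexp (2 * I * x) ≠ 1 := by
  intro h
  rw [Complex.exp_eq_one_iff] at h
  obtain ⟨n, hn⟩ := h
  apply hx
  have : x = n * Real.pi := by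
    have h2 : (2 * I : ℂ) ≠ 0 := by simp
    apply mul_left_cancel₀ h2
    rw [hn]; ring
  rw [this]
  exact Complex.sin_int_mul_pi n

lemma phi_eq {x Q : ℂ} (hp : (x, Q) ∈ stripQ) (hx : Complex.sin x ≠ 0) :
    phi (x, Q) = -I * zetaW Q (cexp (2 * I * x)) ∧
    phi' (x, Q) = 2 * (cexp (2 * I * x) * deriv (zetaW Q) (cexp (2 * I * x))) := by
  have hQ := norm_lt_of_mem_stripQ hp
  obtain ⟨h1, h2⟩ := norm_mul_exp_lt hp
  rw [Complex.exp_neg] at h2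
  have hw := exp_ne_one_of_sin_ne_zero hx
  have hw' : 1 - cexp (2 * I * x) ≠ 0 := sub_ne_zero.mpr hw.symm
  have hE := Complex.exp_ne_zero (x * I)
  have e2 : cexp (2 * I * x) = cexp (x * I) ^ 2 := by
    rw [← Complex.exp_nat_mul]; congr 1; push_cast; ring
  have e3 : Complex.sin x = (cexp (x * I) ^ 2 - 1) / (2 * I * cexp (x * I)) := by
    rw [Complex.sin, show -x * I = -(x * I) by ring, Complex.exp_neg]
    field_simp
    linear_combination (1 - cexp (x * I) ^ 2) * I_sq
  have e4 : Complex.cos x = (cexp (x * I) ^ 2 + 1) / (2 * cexp (x * I)) := by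
    rw [Complex.cos, show -x * I = -(x * I) by ring, Complex.exp_neg]
    field_simp
  have hd := hasDerivAt_zetaReg hQ (Complex.exp_ne_zero _) h1 h2
  rw [e2] at hw'
  have hw'' : cexp (x * I) ^ 2 - 1 ≠ 0 := fun h => hw' (by linear_combination -h)
  constructor
  · rw [phi, rho_eq hp, zetaW_eq hQ hw]
    simp only [e3, e4, e2]
    field_simp
    ring
  · rw [phi', rho'_eq hp]
    have h3 : zetaW Q =ᶠ[𝓝 (cexp (2 * I * x))] fun w => (1 + w) / (1 - w) + zetaReg Q w := by
      filter_upwards [isOpen_compl_singleton.mem_nhds hw] with v hv using zetaW_eq hQ hv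
    have h4 := (((hasDerivAt_id (cexp (2 * I * x))).const_add 1).div
      ((hasDerivAt_id (cexp (2 * I * x))).const_sub 1) (by simpa only [id, e2] using hw')).add
      hd.hasDerivAt
    have h5 : deriv (zetaW Q) (cexp (2 * I * x)) = _ := h3.deriv_eq.trans h4.deriv
    rw [h5]
    simp only [id, e3, e2]
    field_simp
    linear_combination (-2 * (1 - cexp (x * I) ^ 2) ^ 2) * I_sq

/-- If w = Q^k, the strip conditions ‖Qw‖ < 1 and ‖Qw⁻¹‖ < 1 force |k| < 1; then w = 1, which is a
zero of the sine. -/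
lemma generic_exp {x Q : ℂ} (hp : (x, Q) ∈ stripQ) (hQ0 : Q ≠ 0) (hx : Complex.sin x ≠ 0) :
    Generic Q (cexp (2 * I * x)) := by
  have hQ := norm_lt_of_mem_stripQ hp
  obtain ⟨h1, h2⟩ := norm_mul_exp_lt hp
  refine ⟨Complex.exp_ne_zero _, fun k hk => ?_⟩
  have hQn : 0 < ‖Q‖ := norm_pos_iff.mpr hQ0
  rw [Complex.exp_neg] at h2
  simp only [hk] at h1 h2
  rw [← zpow_one_add₀ hQ0, norm_zpow] at h1
  rw [← zpow_neg, ← zpow_one_add₀ hQ0, norm_zpow] at h2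
  have a1 : 0 < 1 + k := by
    by_contra h
    exact absurd h1 (not_lt.mpr (one_le_zpow_of_nonpos₀ hQn hQ.le (not_lt.mp h)))
  have a2 : 0 < 1 + -k := by
    by_contra h
    exact absurd h2 (not_lt.mpr (one_le_zpow_of_nonpos₀ hQn hQ.le (not_lt.mp h)))
  have : k = 0 := by omega
  rw [this, zpow_zero] at hk
  exact exp_ne_one_of_sin_ne_zero hx hk

/-- The heat equation for `θ₁`. -/
theorem heat_logTheta {x Q : ℂ} (hp : (x, Q) ∈ stripQ) (hQ0 : Q ≠ 0) (hx : Complex.sin x ≠ 0) :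
    -4 * (Q * dsnd logTheta (x, Q)) = (phi' (x, Q) + phi (x, Q) ^ 2 + 1) / 2 := by
  obtain ⟨e1, e2⟩ := phi_eq hp hx
  have h := heat_identity (norm_lt_of_mem_stripQ hp) hQ0 (generic_exp hp hQ0 hx)
  rw [mul_dsnd_logTheta hp, e1, e2]
  linear_combination h + (-zetaW Q (cexp (2 * I * x)) ^ 2 / 2) * I_sq

/-- The addition theorem for `θ₁'/θ₁`. -/
theorem addition_phi {x y z Q : ℂ} (hx : (x, Q) ∈ stripQ) (hy : (y, Q) ∈ stripQ)
    (hz : (z, Q) ∈ stripQ) (hQ0 : Q ≠ 0) (hx0 : Complex.sin x ≠ 0) (hy0 : Complex.sin y ≠ 0)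
    (hz0 : Complex.sin z ≠ 0) (h : x + y + z = 0) :
    (phi (x, Q) + phi (y, Q) + phi (z, Q)) ^ 2 + (phi' (x, Q) + phi' (y, Q) + phi' (z, Q)) =
      -1 + 24 * lamSq Q := by
  have := addition_identity (norm_lt_of_mem_stripQ hx) hQ0 (generic_exp hx hQ0 hx0)
    (generic_exp hy hQ0 hy0) (generic_exp hz hQ0 hz0) (by
      rw [← Complex.exp_add, ← Complex.exp_add, ← mul_add, ← mul_add, h, mul_zero, Complex.exp_zero])
  rw [(phi_eq hx hx0).1, (phi_eq hx hx0).2, (phi_eq hy hy0).1, (phi_eq hy hy0).2,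
    (phi_eq hz hz0).1, (phi_eq hz hz0).2]
  linear_combination this + (zetaW Q (cexp (2 * I * x)) + zetaW Q (cexp (2 * I * y)) +
    zetaW Q (cexp (2 * I * z))) ^ 2 * I_sq

/-! ### The Weierstrass function -/

/-- `1 / sin² u` as a function of `W = e^{2iu}`. -/
def cscSqW (W : ℂ) : ℂ := -4 * (W / (1 - W) ^ 2)

/-- The partial fraction expansion of 1/sin², taken from the q-expansion of ∑ (z+m)^{-2} in the
upper half-plane. -/
lemma hasSum_row_of_pos {u : ℂ} (hu : 0 < u.im) :
    HasSum (fun m : ℤ => 1 / (u - m * Real.pi) ^ 2) (cscSqW (cexp (2 * I * u))) := by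
  have hpi : (Real.pi : ℂ) ≠ 0 := by exact_mod_cast Real.pi_ne_zero
  have hz : 0 < (u / Real.pi).im := by
    rw [Complex.div_ofReal_im]; exact div_pos hu Real.pi_pos
  have hs : Summable fun m : ℤ => 1 / (u / Real.pi + m) ^ 2 := by
    have := EisensteinSeries.linear_right_summable (u / Real.pi) 1 (k := 2) le_rfl
    refine this.congr fun m => ?_
    simp
  have hW : ‖cexp (2 * I * u)‖ < 1 := by
    rw [Complex.norm_exp]
    exact Real.exp_lt_one_iff.mpr (by simpa using hu)
  have h1 := EisensteinSeries.qExpansion_identity (k := 1) le_rfl ⟨u / Real.pi, hz⟩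
  have h2 := hs.hasSum
  rw [show ∑' m : ℤ, 1 / (u / Real.pi + m) ^ 2 = _ from h1] at h2
  have e1 : cexp (2 * Real.pi * I * (u / Real.pi)) = cexp (2 * I * u) := by
    congr 1; field_simp
  simp only [pow_one, e1] at h2
  rw [tsum_coe_mul_geometric_of_norm_lt_one hW] at h2
  have h3 := ((Equiv.neg ℤ).hasSum_iff.mpr h2).mul_left (1 / (Real.pi : ℂ) ^ 2)
  convert! h3 using 1
  · funext m
    simp only [Function.comp, Equiv.neg_apply]
    push_cast
    rw [show u / Real.pi + -(m : ℂ) = (u - m * Real.pi) / Real.pi by field_simp; ring, div_pow]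
    field_simp
  · rw [cscSqW]
    simp only [Nat.factorial_one, Nat.cast_one, div_one]
    field_simp
    linear_combination (-4 * (Real.pi : ℂ) ^ 2 / (1 - cexp (2 * I * u)) ^ 2) * I_sq

lemma hasSum_row_of_neg {u : ℂ} (hu : u.im < 0) :
    HasSum (fun m : ℤ => 1 / (u - m * Real.pi) ^ 2) (cscSqW (cexp (-(2 * I * u)))) := by
  have h := (Equiv.neg ℤ).hasSum_iff.mpr (hasSum_row_of_pos (u := -u) (by simpa using hu))
  rw [mul_neg] at h
  refine h.congr_fun fun m => ?_
  simp only [Function.comp, Equiv.neg_apply]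
  push_cast
  ring

/-- Twice ζ(2)/π². The term m = 0 is 1/0 = 0, as in the lattice sum for ℘. -/
lemma hasSum_row_zero : HasSum (fun m : ℤ => 1 / ((m : ℂ) * Real.pi) ^ 2) (1 / 3) := by
  have hpi : (Real.pi : ℂ) ≠ 0 := by exact_mod_cast Real.pi_ne_zero
  have h1 : HasSum (fun n : ℕ => (1 : ℂ) / (n : ℂ) ^ 2) ((Real.pi : ℂ) ^ 2 / 6) := by
    have := Complex.hasSum_ofReal.mpr hasSum_zeta_two
    push_cast at this
    exact this
  have h2 := HasSum.of_nat_of_neg_add_one (f := fun m : ℤ => (1 : ℂ) / (m : ℂ) ^ 2)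
    (m := (Real.pi : ℂ) ^ 2 / 6) (m' := (Real.pi : ℂ) ^ 2 / 6) (by simpa using h1) (by
      have h3 := (hasSum_nat_add_iff' 1).mpr h1
      simp only [Finset.sum_range_one, Nat.cast_zero, ne_eq, OfNat.ofNat_ne_zero, not_false_eq_true,
        zero_pow, div_zero, sub_zero] at h3
      refine h3.congr_fun fun n => ?_
      push_cast
      ring)
  have h4 := h2.mul_left (1 / (Real.pi : ℂ) ^ 2)
  convert! h4 using 1
  · funext m; rw [mul_pow]; field_simp
  · field_simp; norm_num

/-- The termwise derivative of the Lambert series; its terms are the rows of the lattice sum at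
heights ±(m+1)πτ. -/
lemma mul_deriv_zetaReg {Q w : ℂ} (hQ : ‖Q‖ < 1) (h0 : w ≠ 0) (h1 : ‖Q * w‖ < 1)
    (h2 : ‖Q * w⁻¹‖ < 1) : HasSum (fun m : ℕ => cscSqW (Q ^ (m + 1) * w) + cscSqW (Q ^ (m + 1) * w⁻¹))
      (-2 * (w * deriv (zetaReg Q) w)) := by
  obtain ⟨a1, b1⟩ := analyticAt_lam_of_norm_lt hQ h1
  obtain ⟨a2, b2⟩ := analyticAt_lam_of_norm_lt hQ h2
  have d1 : HasDerivAt (fun w => lam (Q * w) Q) (deriv (fun w => lam w Q) (Q * w) * Q) w := by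
    have d : HasDerivAt (fun w : ℂ => Q * w) Q w := by simpa using (hasDerivAt_id w).const_mul Q
    exact HasDerivAt.comp (h₂ := fun w => lam w Q) w a1.differentiableAt.hasDerivAt d
  have d2 : HasDerivAt (fun w => lam (Q * w⁻¹) Q)
      (deriv (fun w => lam w Q) (Q * w⁻¹) * (Q * -(w ^ 2)⁻¹)) w := by
    have d := (hasDerivAt_inv h0).const_mul Q
    exact HasDerivAt.comp (h₂ := fun w => lam w Q) (h := fun w => Q * w⁻¹) w
      a2.differentiableAt.hasDerivAt d
  have d3 : deriv (zetaReg Q) w = _ := ((d1.const_mul 2).sub (d2.const_mul 2)).deriv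
  have h := (b1.mul_left (-4 * (Q * w))).add (b2.mul_left (-4 * (Q * w⁻¹)))
  convert! h using 1
  · funext m
    simp only [cscSqW, pow_succ]
    ring
  · rw [d3]
    field_simp
    ring

lemma nome_pow (τ : ℂ) (k : ℕ) : (nome τ ^ 2) ^ k = cexp (2 * I * (k * (Real.pi * τ))) := by
  rw [nome, ← pow_mul, ← Complex.exp_nat_mul]
  congr 1
  push_cast
  ring

lemma etaOverPi_eq (τ : ℂ) : etaOverPi τ = 1 / 12 - 2 * lamSq (nome τ ^ 2) := by
  simp only [etaOverPi, lamSq, pow_mul]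

lemma mem_stripQ_nome {x τ : ℂ} : (x, nome τ ^ 2) ∈ stripQ ↔ |x.im| < Real.pi * τ.im := by
  show ‖nome τ ^ 2‖ * Real.exp (2 * |x.im|) < 1 ↔ _
  rw [norm_pow, norm_nome, ← Real.exp_nat_mul, ← Real.exp_add, Real.exp_lt_one_iff]
  push_cast
  constructor <;> intro h <;> linarith

lemma nome_ne_zero (τ : ℂ) : nome τ ≠ 0 := Complex.exp_ne_zero _

/-- The lattice sum of ℘ is evaluated row by row in the direction π. For 0 < Im x < π Im τ every
shifted point x - nπτ is off the real line, so each row is a 1/sin². The subtracted terms give -1/3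
from the central row and 8 `lamSq` from the others, together -4η₁/π. -/
lemma wp_eq_of_im_pos {τ : UpperHalfPlane} {x : ℂ} (h0 : 0 < x.im) (h1 : x.im < Real.pi * τ.im) :
    wp τ x = -phi' (x, nome τ ^ 2) - 4 * etaOverPi τ := by
  set Q := nome τ ^ 2 with hQdef
  have hp : (x, Q) ∈ stripQ := mem_stripQ_nome.mpr (by rw [abs_of_pos h0]; exact h1)
  have hQ := norm_lt_of_mem_stripQ hp
  obtain ⟨n1, n2⟩ := norm_mul_exp_lt hp
  simp only [Complex.exp_neg] at n1 n2 hQ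
  set w := cexp (2 * I * x) with hw
  have hτ : 0 < Real.pi * τ.im := mul_pos Real.pi_pos τ.im_pos
  have hs := ((periods τ).latticeEquivProd.symm.toEquiv.hasSum_iff).mpr
    ((periods τ).hasSum_weierstrassP x)
  have hs2 := (Equiv.prodComm ℤ ℤ).hasSum_iff.mpr hs
  have hterm : ∀ p : ℤ × ℤ, (((fun l : (periods τ).lattice => 1 / (x - l) ^ 2 - 1 / (l : ℂ) ^ 2) ∘
      (periods τ).latticeEquivProd.symm.toEquiv) ∘ (Equiv.prodComm ℤ ℤ)) p =
      1 / (x - p.1 * (Real.pi * τ) - p.2 * Real.pi) ^ 2 -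
        1 / (-(p.1 * (Real.pi * τ)) - p.2 * Real.pi) ^ 2 := by
    intro p
    have e : (((periods τ).latticeEquivProd.symm.toEquiv (p.2, p.1) : (periods τ).lattice) : ℂ) =
        p.2 * Real.pi + p.1 * (Real.pi * τ) :=
      (periods τ).latticeEquiv_symm_apply (p.2, p.1)
    simp only [Function.comp, Equiv.prodComm_apply, Prod.swap, e]
    congr 2 <;> ring
  have hs3 : HasSum (fun p : ℤ × ℤ => 1 / (x - p.1 * (Real.pi * τ) - p.2 * Real.pi) ^ 2 -
      1 / (-(p.1 * (Real.pi * τ)) - p.2 * Real.pi) ^ 2) (wp τ x) := by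
    refine hs2.congr_fun fun p => (hterm p).symm
  set row : ℤ → ℂ := fun n => ∑' m : ℤ, (1 / (x - n * (Real.pi * τ) - m * Real.pi) ^ 2 -
      1 / (-(n * (Real.pi * τ)) - m * Real.pi) ^ 2) with hrow
  have hrows : HasSum row (wp τ x) := hs3.prod_fiberwise fun n => (hs3.summable.prod_factor n).hasSum
  have hr0 : row 0 = cscSqW w - 1 / 3 := by
    have := (hasSum_row_of_pos h0).sub hasSum_row_zero
    rw [← this.tsum_eq]
    refine tsum_congr fun m => ?_
    simp
  have hk : ∀ k : ℕ, (0 : ℝ) < (((k + 1 : ℕ) : ℂ) * (Real.pi * (τ : ℂ))).im ∧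
      x.im < (((k + 1 : ℕ) : ℂ) * (Real.pi * (τ : ℂ))).im := fun k => by
    have e : (((k + 1 : ℕ) : ℂ) * (Real.pi * (τ : ℂ))).im = (k + 1) * (Real.pi * τ.im) := by
      rw [show (((k + 1 : ℕ) : ℂ) * (Real.pi * (τ : ℂ))) = (((k + 1 : ℝ) * Real.pi : ℝ) : ℂ) * τ by
        push_cast; ring, Complex.im_ofReal_mul]
      exact mul_assoc _ _ _
    rw [e]
    have : 0 ≤ (k : ℝ) * (Real.pi * τ.im) := by positivity
    constructor <;> linarith
  have hpos : ∀ k : ℕ, row ((k + 1 : ℕ) : ℤ) = cscSqW (Q ^ (k + 1) * w⁻¹) - cscSqW (Q ^ (k + 1)) := by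
    intro k
    obtain ⟨k1, k2⟩ := hk k
    have a1 := hasSum_row_of_neg (u := x - ((k + 1 : ℕ) : ℂ) * (Real.pi * (τ : ℂ))) (by
      rw [sub_im]; linarith)
    have a2 := hasSum_row_of_neg (u := -(((k + 1 : ℕ) : ℂ) * (Real.pi * (τ : ℂ)))) (by
      rw [neg_im]; linarith)
    have := (a1.sub a2).tsum_eq
    rw [hQdef, nome_pow, hw, ← Complex.exp_neg, ← Complex.exp_add]
    rw [show -(2 * I * (x - ((k + 1 : ℕ) : ℂ) * (Real.pi * (τ : ℂ)))) =
      2 * I * (((k + 1 : ℕ) : ℂ) * (Real.pi * (τ : ℂ))) + -(2 * I * x) by ring,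
      show -(2 * I * -(((k + 1 : ℕ) : ℂ) * (Real.pi * (τ : ℂ)))) =
      2 * I * (((k + 1 : ℕ) : ℂ) * (Real.pi * (τ : ℂ))) by ring] at this
    rw [← this]
    simp only [hrow, Int.cast_natCast]
  have hneg : ∀ k : ℕ, row (-((k + 1 : ℕ) : ℤ)) = cscSqW (Q ^ (k + 1) * w) - cscSqW (Q ^ (k + 1)) := by
    intro k
    obtain ⟨k1, k2⟩ := hk k
    have a1 := hasSum_row_of_pos (u := x + ((k + 1 : ℕ) : ℂ) * (Real.pi * (τ : ℂ))) (by
      rw [add_im]; linarith)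
    have a2 := hasSum_row_of_pos (u := (((k + 1 : ℕ) : ℂ) * (Real.pi * (τ : ℂ)))) k1
    have := (a1.sub a2).tsum_eq
    rw [hQdef, nome_pow, hw, ← Complex.exp_add]
    rw [mul_add, add_comm (2 * I * x)] at this
    rw [← this]
    simp only [hrow, Int.cast_neg, Int.cast_natCast, neg_mul, neg_neg, sub_neg_eq_add]
  have hsum := hrows.nat_add_neg
  have hsum2 := (hasSum_nat_add_iff' 1).mpr hsum
  simp only [Finset.sum_range_one, Nat.cast_zero, neg_zero, hpos, hneg] at hsum2
  have hz := mul_deriv_zetaReg hQ (Complex.exp_ne_zero _) n1 n2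
  have hsq : HasSum (fun m : ℕ => cscSqW (Q ^ (m + 1))) (-4 * lamSq Q) := by
    have hd := (analyticAt_lam_of_norm_lt hQ hQ).2.mul_left (-4 * Q)
    rw [mul_assoc, mul_deriv_lam_self hQ] at hd
    refine hd.congr_fun fun m => ?_
    rw [cscSqW, ← pow_succ, pow_succ']
    ring
  have hall := (hz.sub (hsq.mul_left 2)).unique (hsum2.congr_fun fun m => by ring)
  have hsin : Complex.sin x ≠ 0 := by
    intro h
    rw [Complex.sin_eq_zero_iff] at h
    obtain ⟨k, hk⟩ := h
    rw [hk] at h0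
    simp at h0
  have hcsc : 1 / Complex.sin x ^ 2 = cscSqW w := by
    have hw1 := exp_ne_one_of_sin_ne_zero hsin
    have hw' : 1 - w ≠ 0 := sub_ne_zero.mpr hw1.symm
    have e : Complex.sin x ^ 2 = -(1 - w) ^ 2 / (4 * w) := by
      have e2 : w = cexp (x * I) ^ 2 := by
        rw [hw, ← Complex.exp_nat_mul]; congr 1; push_cast; ring
      have hE := Complex.exp_ne_zero (x * I)
      rw [Complex.sin, show -x * I = -(x * I) by ring, Complex.exp_neg, e2]
      field_simp
      linear_combination 4 * (1 - cexp (x * I) ^ 2) ^ 2 * I_sq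
    rw [e, cscSqW]
    have : w ≠ 0 := Complex.exp_ne_zero _
    field_simp
  rw [phi', rho'_eq hp, etaOverPi_eq]
  rw [hr0] at hall
  rw [neg_div, hcsc, ← hw]
  linear_combination -hall

/-- `℘ = -(log θ₁)'' - 4 η₁/π`. -/
theorem wp_eq {τ : UpperHalfPlane} {x : ℂ} (h1 : |x.im| < Real.pi * τ.im) (hx : Complex.sin x ≠ 0) :
    wp τ x = -phi' (x, nome τ ^ 2) - 4 * etaOverPi τ := by
  have hneg : ∀ y : ℂ, |y.im| < Real.pi * τ.im → phi' (-y, nome τ ^ 2) = phi' (y, nome τ ^ 2) := by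
    intro y hy
    have hev : ∀ z, logTheta (-z, nome τ ^ 2) = logTheta (z, nome τ ^ 2) := fun z => logTheta_neg z _
    have e1 : ∀ z, rho (-z, nome τ ^ 2) = -rho (z, nome τ ^ 2) := fun z => by
      have := deriv_comp_neg (fun z => logTheta (z, nome τ ^ 2)) z
      simp only [hev] at this
      rw [rho, dfst, dfst]
      simp only
      rw [this, neg_neg]
    have e2 : rho' (-y, nome τ ^ 2) = rho' (y, nome τ ^ 2) := by
      have := deriv_comp_neg (fun z => rho (z, nome τ ^ 2)) y
      simp only [e1, deriv.fun_neg] at this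
      rw [rho', dfst, dfst]
      exact (neg_injective this).symm
    rw [phi', phi', e2]
    simp
  have hpos : ∀ x : ℂ, 0 < x.im → x.im < Real.pi * τ.im →
      wp τ x = -phi' (x, nome τ ^ 2) - 4 * etaOverPi τ := fun x => wp_eq_of_im_pos
  rcases lt_trichotomy x.im 0 with h | h | h
  · rw [← hneg x h1, ← hpos (-x) (by simpa using h) (by rw [neg_im]; linarith [(abs_lt.mp h1).1])]
    exact ((periods τ).weierstrassP_neg x).symm
  · have hp : (x, nome τ ^ 2) ∈ stripQ := mem_stripQ_nome.mpr h1
    have c1 : ContinuousAt (fun x => -phi' (x, nome τ ^ 2) - 4 * etaOverPi τ) x := by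
      have a1 : ContinuousAt (fun x => rho' (x, nome τ ^ 2)) x :=
        (hasDerivAt_dfst (analyticAt_rho' hp)).continuousAt
      refine ContinuousAt.sub (ContinuousAt.neg ?_) continuousAt_const
      refine ContinuousAt.add (ContinuousAt.div continuousAt_const (by fun_prop) ?_) a1
      exact pow_ne_zero 2 hx
    have hl : x ∉ (periods τ).lattice := by
      rw [PeriodPair.mem_lattice]
      rintro ⟨m, n, hmn⟩
      have him := congrArg Complex.im hmn
      have hn : n = 0 := by
        have : (n : ℝ) * (Real.pi * τ.im) = 0 := by
          rw [h] at him
          simpa [periods] using him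
        have hne : Real.pi * τ.im ≠ 0 := (mul_pos Real.pi_pos τ.im_pos).ne'
        exact_mod_cast (mul_eq_zero.mp this).resolve_right hne
      rw [hn] at hmn
      apply hx
      rw [← hmn]
      simp only [Int.cast_zero, zero_mul, add_zero]
      exact Complex.sin_int_mul_pi m
    have c2 : ContinuousAt (wp τ) x :=
      ((periods τ).analyticOnNhd_weierstrassP x hl).continuousAt
    -- For Im x = 0 both sides are continuous at x, and the identity is already known just above it.
    have hpath : Tendsto (fun t : ℝ => x + t * I) (𝓝[>] 0) (𝓝 x) := by
      have : Continuous fun t : ℝ => x + t * I := by fun_prop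
      have h2 := this.tendsto 0
      simp only [ofReal_zero, zero_mul, add_zero] at h2
      exact h2.mono_left nhdsWithin_le_nhds
    refine tendsto_nhds_unique (c2.tendsto.comp hpath)
      ((c1.tendsto.comp hpath).congr' ?_)
    have hτ : 0 < Real.pi * τ.im := mul_pos Real.pi_pos τ.im_pos
    filter_upwards [Ioo_mem_nhdsGT hτ] with t ht
    simp only [Function.comp]
    rw [hpos]
    · simp [h, ht.1]
    · simpa [h] using ht.2
  · exact hpos x h (by rwa [abs_of_pos h] at h1)

/-! ### The equation for the factor multiplying the power of the theta function -/

/-- A square lies on the cut (-∞, 0] only if its root is purely imaginary, and Re sin x = sin(Re x)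
cosh(Im x). -/
lemma sin_sq_mem_slitPlane {x : ℂ} (hx : Real.sin x.re ≠ 0) : Complex.sin x ^ 2 ∈ slitPlane := by
  have h1 : (Complex.sin x).re ≠ 0 := by
    have h : (Complex.sin x).re = Real.sin x.re * Real.cosh x.im := by
      rw [Complex.sin_eq, ← Complex.ofReal_sin, ← Complex.ofReal_cos, ← Complex.ofReal_sinh,
        ← Complex.ofReal_cosh]
      simp only [add_re, mul_re, ofReal_re, ofReal_im, I_re, I_im, mul_im]
      ring
    rw [h]
    exact mul_ne_zero hx (Real.cosh_pos _).ne'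
  rw [Complex.mem_slitPlane_iff, pow_two, mul_re, mul_im]
  by_cases h : (Complex.sin x).im = 0
  · left
    rw [h]
    have := mul_self_pos.mpr h1
    linarith
  · right
    intro h2
    have : (Complex.sin x).re * (Complex.sin x).im = 0 := by linarith
    exact (mul_ne_zero h1 h) this

lemma sin_ne_zero_of_re {x : ℂ} (hx : Real.sin x.re ≠ 0) : Complex.sin x ≠ 0 := by
  intro h
  have := Complex.slitPlane_ne_zero (sin_sq_mem_slitPlane hx)
  rw [h] at this
  simp at this

/-- `(θ₁(x)²)^s` as a function of `x` and `Q = q²`. -/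
def thetaPow (s : ℂ) (p : ℂ × ℂ) : ℂ := (Complex.sin p.1 ^ 2) ^ s * cexp (2 * s * logTheta p)

lemma theta1SqPow_eq {s x τ : ℂ} (hτ : 0 < τ.im) :
    theta1SqPow s x τ = thetaPow s (x, nome τ ^ 2) := by
  rw [theta1SqPow, thetaPow, logThetaReg_eq hτ]

lemma thetaPow_ne_zero {s : ℂ} {p : ℂ × ℂ} (hx : Real.sin p.1.re ≠ 0) : thetaPow s p ≠ 0 := by
  refine mul_ne_zero ?_ (Complex.exp_ne_zero _)
  rw [Complex.cpow_ne_zero_iff]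
  exact Or.inl (pow_ne_zero 2 (sin_ne_zero_of_re hx))

lemma analyticAt_thetaPow (s : ℂ) {p : ℂ × ℂ} (hp : p ∈ stripQ) (hx : Real.sin p.1.re ≠ 0) :
    AnalyticAt ℂ (thetaPow s) p := by
  refine AnalyticAt.mul (AnalyticAt.cpow ?_ analyticAt_const (sin_sq_mem_slitPlane hx)) ?_
  · exact (Complex.analyticAt_sin.comp analyticAt_fst).pow 2
  · exact (analyticAt_const.mul (analyticAt_logTheta hp)).cexp

lemma hasDerivAt_thetaPow_fst (s : ℂ) {x Q : ℂ} (hp : (x, Q) ∈ stripQ) (hx : Real.sin x.re ≠ 0) :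
    HasDerivAt (fun x => thetaPow s (x, Q)) (thetaPow s (x, Q) * (2 * s * phi (x, Q))) x := by
  have h0 := sin_ne_zero_of_re hx
  have h1 := (((Complex.hasDerivAt_sin x).pow 2).cpow_const (c := s) (sin_sq_mem_slitPlane hx)).mul
    (((hasDerivAt_dfst (analyticAt_logTheta hp)).const_mul (2 * s)).cexp)
  refine h1.congr_deriv ?_
  simp only [Pi.pow_apply]
  rw [Complex.cpow_sub _ _ (pow_ne_zero 2 h0), Complex.cpow_one]
  simp only [thetaPow, phi, rho]
  field_simp
  push_cast
  ring

lemma hasDerivAt_thetaPow_snd (s : ℂ) {x Q : ℂ} (hp : (x, Q) ∈ stripQ) :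
    HasDerivAt (fun Q => thetaPow s (x, Q)) (thetaPow s (x, Q) * (2 * s * dsnd logTheta (x, Q))) Q := by
  have h1 := (((hasDerivAt_dsnd (analyticAt_logTheta hp)).const_mul (2 * s)).cexp).const_mul
    ((Complex.sin x ^ 2) ^ s)
  refine h1.congr_deriv ?_
  simp only [thetaPow]
  ring

/-- The differential operator for the factor `f` in `ψ = (θ₁²)^{g/2} f`, in `x` and `Q = q²`. -/
def reducedOp (κ g : ℂ) (f : ℂ × ℂ → ℂ) (p : ℂ × ℂ) : ℂ :=
  -4 * κ * (p.2 * dsnd f p) - dfst (dfst f) p - 2 * g * phi p * dfst f p +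
    ((κ * g / 2 - g ^ 2) * (phi' p + phi p ^ 2) + κ * g / 2 -
      4 * g * (g - 1) * (1 / 12 - 2 * lamSq p.2)) * f p

lemma hasDerivAt_nome_sq (τ : ℂ) :
    HasDerivAt (fun t => nome t ^ 2) (2 * Real.pi * I * nome τ ^ 2) τ := by
  have h : HasDerivAt nome (cexp (Real.pi * I * τ) * (Real.pi * I)) τ := by
    exact (((hasDerivAt_id τ).const_mul ((Real.pi : ℂ) * I)).cexp).congr_deriv (by simp)
  refine (h.pow 2).congr_deriv ?_
  simp only [nome]
  push_cast
  ring

lemma eventually_slice_fst {s : Set (ℂ × ℂ)} {x Q : ℂ} (h : s ∈ 𝓝 (x, Q)) :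
    ∀ᶠ u in 𝓝 x, (u, Q) ∈ s :=
  (Continuous.prodMk_left Q).continuousAt.eventually h

lemma eventually_slice_snd {s : Set (ℂ × ℂ)} {x Q : ℂ} (h : s ∈ 𝓝 (x, Q)) :
    ∀ᶠ u in 𝓝 Q, (x, u) ∈ s :=
  (Continuous.prodMk_right x).continuousAt.eventually h

lemma isOpen_sin_re : IsOpen {x : ℂ | Real.sin x.re ≠ 0} :=
  isOpen_ne_fun (by fun_prop) (by fun_prop)

/-- Conjugation by the nowhere vanishing power of θ₁. Since ∂_τ = 2πi Q∂_Q, the coefficient 2iκ/π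
becomes -4κ. The heat equation replaces the Q-derivative of log θ₁ by φ' + φ² + 1, and ℘ is replaced
by -φ' - 4η₁/π. -/
lemma lameEqAt_iff {κ g : ℝ} {f : ℂ × ℂ → ℂ} {ψ : ℂ → ℂ → ℂ} {E x : ℂ} {τ : UpperHalfPlane}
    (h1 : |x.im| < Real.pi * τ.im) (hx : Real.sin x.re ≠ 0)
    (hf : AnalyticAt ℂ f (x, nome τ ^ 2))
    (hψ : ∀ᶠ p in 𝓝 (x, (τ : ℂ)),
      ψ p.1 p.2 = theta1SqPow ((g / 2 : ℝ) : ℂ) p.1 p.2 * f (p.1, nome p.2 ^ 2)) :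
    LameEqAt κ g ψ E x τ ↔ reducedOp κ g f (x, nome τ ^ 2) = E * f (x, nome τ ^ 2) := by
  have hpi : (Real.pi : ℂ) ≠ 0 := by exact_mod_cast Real.pi_ne_zero
  set Q := nome τ ^ 2 with hQ
  have hp : (x, Q) ∈ stripQ := mem_stripQ_nome.mpr h1
  have hQ0 : Q ≠ 0 := pow_ne_zero 2 (nome_ne_zero _)
  have hsin := sin_ne_zero_of_re hx
  set s : ℂ := ((g / 2 : ℝ) : ℂ) with hs
  have h2s : 2 * s = g := by rw [hs]; push_cast; ring
  have hT : ∀ᶠ t in 𝓝 (τ : ℂ), ψ x t = thetaPow s (x, nome t ^ 2) * f (x, nome t ^ 2) := by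
    filter_upwards [eventually_slice_snd hψ, (isOpen_lt continuous_const Complex.continuous_im).mem_nhds
      τ.im_pos] with t ht ht'
    rw [ht, theta1SqPow_eq ht']
  have hX : ∀ᶠ u in 𝓝 x, ψ u τ = thetaPow s (u, Q) * f (u, Q) := by
    filter_upwards [eventually_slice_fst hψ] with t ht
    rw [ht, theta1SqPow_eq τ.im_pos]
  have d1 : deriv (fun t : ℂ => ψ x t) (τ : ℂ) = (thetaPow s (x, Q) * (g * dsnd logTheta (x, Q)) *
      f (x, Q) + thetaPow s (x, Q) * dsnd f (x, Q)) * (2 * Real.pi * I * Q) := by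
    have := HasDerivAt.comp (h := fun t => nome t ^ 2) (τ : ℂ)
      ((hasDerivAt_thetaPow_snd s hp).mul (hasDerivAt_dsnd hf)) (hasDerivAt_nome_sq τ)
    rw [h2s] at this
    exact (this.congr_of_eventuallyEq hT).deriv
  have hev : ∀ᶠ u in 𝓝 x, HasDerivAt (fun u => thetaPow s (u, Q) * f (u, Q))
      (thetaPow s (u, Q) * (g * phi (u, Q) * f (u, Q) + dfst f (u, Q))) u := by
    filter_upwards [eventually_slice_fst (isOpen_stripQ.mem_nhds hp),
      eventually_slice_fst hf.eventually_analyticAt, isOpen_sin_re.mem_nhds hx] with u a1 a2 a3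
    refine ((hasDerivAt_thetaPow_fst s a1 a3).mul (hasDerivAt_dfst a2)).congr_deriv ?_
    rw [h2s]
    ring
  have d2 : iteratedDeriv 2 (fun u : ℂ => ψ u (τ : ℂ)) x = thetaPow s (x, Q) *
      (dfst (dfst f) (x, Q) + 2 * g * phi (x, Q) * dfst f (x, Q) +
        (g * phi' (x, Q) + g ^ 2 * phi (x, Q) ^ 2) * f (x, Q)) := by
    rw [Filter.EventuallyEq.iteratedDeriv_eq 2 hX, iteratedDeriv_succ, iteratedDeriv_one]
    rw [Filter.EventuallyEq.deriv_eq (hev.mono fun u hu => hu.deriv)]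
    have := (hasDerivAt_thetaPow_fst s hp hx).mul
      ((((hasDerivAt_phi hp hsin).const_mul (g : ℂ)).mul (hasDerivAt_dfst hf)).add
        (hasDerivAt_dfst hf.dfst))
    rw [h2s] at this
    refine this.deriv.trans ?_
    simp only [Pi.add_apply, Pi.mul_apply]
    ring
  rw [LameEqAt, d1, d2, hX.self_of_nhds, wp_eq h1 hsin, etaOverPi_eq, ← hQ, reducedOp]
  have hheat := heat_logTheta hp hQ0 hsin
  have hne : thetaPow s (x, Q) ≠ 0 := thetaPow_ne_zero hx
  have hd : 2 * I / (Real.pi : ℂ) * κ * ((thetaPow s (x, Q) * (g * dsnd logTheta (x, Q)) *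
      f (x, Q) + thetaPow s (x, Q) * dsnd f (x, Q)) * (2 * Real.pi * I * Q)) =
      -4 * κ * thetaPow s (x, Q) * (g * (Q * dsnd logTheta (x, Q)) * f (x, Q) +
        Q * dsnd f (x, Q)) := by
    field_simp
    rw [I_sq]
    ring
  push_cast at hd ⊢
  rw [hd]
  set T := thetaPow s (x, Q)
  constructor
  · intro h
    refine mul_left_cancel₀ hne ?_
    linear_combination h - κ * g * T * f (x, Q) * hheat
  · intro h
    linear_combination T * h + κ * g * T * f (x, Q) * hheat

/-! ### Series of polynomials in `cos y` -/

/-- The bound on the coefficients of a series `∑ p_ℓ(cos y) Q^ℓ` that makes it converge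
locally uniformly for `|Q| e^{2|Im y|} < 1`. -/
def CosSeriesBound (n : ℕ) (p : ℕ → Polynomial ℂ) : Prop :=
  ∀ σ : ℝ, 0 < σ → σ < 1 → ∃ M : ℝ, ∀ ℓ (y : ℂ),
    ‖(p ℓ).eval (Complex.cos y)‖ * σ ^ ℓ ≤ M * Real.exp (n * |y.im|) * Real.exp (2 * |y.im|) ^ ℓ

/-- `∑ p_ℓ(cos y) Q^ℓ`. -/
def cosSeries (p : ℕ → Polynomial ℂ) (x : ℂ × ℂ) : ℂ :=
  ∑' ℓ, (p ℓ).eval (Complex.cos x.1) * x.2 ^ ℓ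

lemma mem_domain_of_abs_le_one {z : ℝ} (hz : z ∈ Icc (-1 : ℝ) 1) {q : ℂ} (hq : ‖q‖ < 1) :
    ((z : ℂ), q) ∈ domain := by
  refine ⟨Real.arccos z, ?_, ?_⟩
  · rw [← Complex.ofReal_cos, Real.cos_arccos hz.1 hz.2]
  · simpa using hq

/-- Cauchy's estimate in Q for z ∈ [-1, 1] bounds each coefficient on the real y-line. The degree
bound n + 2ℓ then controls its growth in the imaginary direction. -/
lemma HasGegenbauerForm.cosSeriesBound {n : ℕ} {P : ℂ → ℂ → ℂ} {p : ℕ → Polynomial ℂ}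
    (hA : AnalyticOnNhd ℂ (fun p : ℂ × ℂ => P p.1 p.2) domain)
    (hdeg : ∀ ℓ, (p ℓ).natDegree ≤ n + 2 * ℓ)
    (hs : ∀ z q : ℂ, (z, q) ∈ domain → HasSum (fun ℓ => (p ℓ).eval z * q ^ (2 * ℓ)) (P z q)) :
    CosSeriesBound n p := by
  intro σ hσ0 hσ1
  have hK : IsCompact (((fun t : ℝ => (t : ℂ)) '' Icc (-1 : ℝ) 1) ×ˢ closedBall (0 : ℂ) (√σ)) :=
    (isCompact_Icc.image Complex.continuous_ofReal).prod (isCompact_closedBall _ _)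
  have hsq : √σ < 1 := by rw [Real.sqrt_lt' one_pos]; simpa using hσ1
  have hKd : ((fun t : ℝ => (t : ℂ)) '' Icc (-1 : ℝ) 1) ×ˢ closedBall (0 : ℂ) (√σ) ⊆ domain := by
    rintro ⟨z, q⟩ ⟨⟨t, ht, rfl⟩, hq⟩
    exact mem_domain_of_abs_le_one ht ((mem_closedBall_zero_iff.mp hq).trans_lt hsq)
  obtain ⟨M, hM⟩ := hK.exists_bound_of_continuousOn (hA.continuousOn.mono hKd)
  refine ⟨M, fun ℓ y => ?_⟩
  have hreal : ∀ t : ℝ, ‖(p ℓ).eval (Complex.cos t)‖ ≤ M / σ ^ ℓ := by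
    intro t
    rw [le_div_iff₀ (by positivity)]
    -- Only even powers of q occur, so any square root of Q serves; no continuity of the root is
    -- needed.
    have hq : ∀ Q : ℂ, (Q ^ (1 / 2 : ℂ)) ^ 2 = Q := fun Q => by
      rw [← Complex.cpow_nat_mul]; norm_num
    have hqn : ∀ Q : ℂ, ‖Q ^ (1 / 2 : ℂ)‖ ^ 2 = ‖Q‖ := fun Q => by rw [← norm_pow, hq]
    have hct : Real.cos t ∈ Icc (-1 : ℝ) 1 := ⟨Real.neg_one_le_cos t, Real.cos_le_one t⟩
    rw [← Complex.ofReal_cos]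
    refine norm_coeff_mul_pow_le (c := fun ℓ => (p ℓ).eval ((Real.cos t : ℝ) : ℂ))
      (f := fun Q => P ((Real.cos t : ℝ) : ℂ) (Q ^ (1 / 2 : ℂ))) hσ0 hσ1 (fun Q hQ => ?_)
      (fun Q hQ => ?_) ℓ
    · have := hs _ (Q ^ (1 / 2 : ℂ)) (mem_domain_of_abs_le_one hct (by
        rw [← hqn] at hQ
        nlinarith [norm_nonneg (Q ^ (1 / 2 : ℂ))]))
      simp only [pow_mul, hq] at this
      exact this
    · refine hM (_, _) ⟨⟨_, hct, rfl⟩, ?_⟩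
      rw [mem_closedBall_zero_iff]
      refine Real.le_sqrt_of_sq_le ?_
      rw [hqn, hQ]
  have h := norm_eval_cos_le (hdeg ℓ) hreal y
  have e : Real.exp (((n + 2 * ℓ : ℕ) : ℝ) * |y.im|) =
      Real.exp (n * |y.im|) * Real.exp (2 * |y.im|) ^ ℓ := by
    rw [← Real.exp_nat_mul, ← Real.exp_add]
    congr 1
    push_cast
    ring
  rw [e] at h
  calc _ ≤ M / σ ^ ℓ * (Real.exp (n * |y.im|) * Real.exp (2 * |y.im|) ^ ℓ) * σ ^ ℓ := by gcongr
    _ = _ := by field_simp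

namespace CosSeriesBound

variable {n : ℕ} {p : ℕ → Polynomial ℂ}

/-- With |Q| e^{2|Im y|} < t < σ < 1 near the point, the terms are dominated by a geometric series
of ratio t/σ. -/
lemma locally_summable (h : CosSeriesBound n p) {x : ℂ × ℂ} (hx : x ∈ stripQ) :
    ∃ V ∈ 𝓝 x, ∃ u : ℕ → ℝ, Summable u ∧
      ∀ ℓ, ∀ y ∈ V, ‖(p ℓ).eval (Complex.cos y.1) * y.2 ^ ℓ‖ ≤ u ℓ := by
  obtain ⟨t, ht1, ht2⟩ := exists_between (show ‖x.2‖ * Real.exp (2 * |x.1.im|) < 1 from hx)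
  obtain ⟨σ, hσ1, hσ2⟩ := exists_between ht2
  have ht0 : 0 ≤ t := le_trans (by positivity) ht1.le
  have hσ0 : 0 < σ := ht0.trans_lt hσ1
  obtain ⟨M, hM⟩ := h σ hσ0 hσ2
  refine ⟨{y | ‖y.2‖ * Real.exp (2 * |y.1.im|) < t} ∩ {y | |y.1.im| < |x.1.im| + 1}, ?_,
    fun ℓ => |M| * Real.exp (n * (|x.1.im| + 1)) * (t / σ) ^ ℓ, ?_, ?_⟩
  · refine Filter.inter_mem ((isOpen_lt (by fun_prop) continuous_const).mem_nhds ht1)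
      ((isOpen_lt (by fun_prop) continuous_const).mem_nhds ?_)
    show |x.1.im| < |x.1.im| + 1
    linarith
  · exact (summable_geometric_of_lt_one (by positivity) ((div_lt_one hσ0).mpr hσ1)).mul_left _
  · rintro ℓ y ⟨hy1, hy2⟩
    rw [mem_ofPred_eq] at hy1 hy2
    rw [norm_mul, norm_pow]
    have hb : ‖(p ℓ).eval (Complex.cos y.1)‖ * σ ^ ℓ ≤
        |M| * Real.exp (n * (|x.1.im| + 1)) * Real.exp (2 * |y.1.im|) ^ ℓ := by
      refine (hM ℓ y.1).trans ?_
      have := le_abs_self M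
      gcongr
    have hc : (‖y.2‖ * Real.exp (2 * |y.1.im|)) ^ ℓ ≤ t ^ ℓ := by gcongr
    beta_reduce
    rw [div_pow, ← mul_div_assoc, le_div_iff₀ (by positivity)]
    calc ‖(p ℓ).eval (Complex.cos y.1)‖ * ‖y.2‖ ^ ℓ * σ ^ ℓ
        = ‖(p ℓ).eval (Complex.cos y.1)‖ * σ ^ ℓ * ‖y.2‖ ^ ℓ := by ring
      _ ≤ |M| * Real.exp (n * (|x.1.im| + 1)) * Real.exp (2 * |y.1.im|) ^ ℓ * ‖y.2‖ ^ ℓ := by gcongr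
      _ = |M| * Real.exp (n * (|x.1.im| + 1)) * (‖y.2‖ * Real.exp (2 * |y.1.im|)) ^ ℓ := by
        rw [mul_pow]; ring
      _ ≤ _ := by gcongr

lemma hasSum (h : CosSeriesBound n p) {x : ℂ × ℂ} (hx : x ∈ stripQ) :
    HasSum (fun ℓ => (p ℓ).eval (Complex.cos x.1) * x.2 ^ ℓ) (cosSeries p x) := by
  obtain ⟨V, hV, u, hu, hb⟩ := h.locally_summable hx
  exact (Summable.of_norm_bounded hu fun ℓ => hb ℓ x (mem_of_mem_nhds hV)).hasSum

lemma analyticOnNhd_cosSeries (h : CosSeriesBound n p) : AnalyticOnNhd ℂ (cosSeries p) stripQ := by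
  refine analyticOnNhd_tsum isOpen_stripQ (fun ℓ x _ => ?_) fun x hx => h.locally_summable hx
  refine AnalyticAt.mul ?_ (analyticAt_snd.pow ℓ)
  have h1 : AnalyticAt ℂ (fun y : ℂ × ℂ => Complex.cos y.1) x :=
    Complex.analyticAt_cos.comp analyticAt_fst
  simpa [Polynomial.coe_aeval_eq_eval] using h1.aeval_polynomial (p ℓ)

end CosSeriesBound

/-- A nonconstant analytic function is open, also at its critical points. Hence local statements in
x pass to z = cos x, including z = ±1. -/
lemma nhds_cos_le (x q : ℂ) :
    𝓝 (Complex.cos x, q) ≤ map (fun p : ℂ × ℂ => (Complex.cos p.1, p.2)) (𝓝 (x, q)) := by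
  have h1 : 𝓝 (Complex.cos x) ≤ map Complex.cos (𝓝 x) := by
    refine (Complex.analyticAt_cos.eventually_constant_or_nhds_le_map_nhds).resolve_left ?_
    intro h
    have hd : ∀ᶠ z in 𝓝 x, Complex.sin z = 0 := by
      filter_upwards [h.eventually_nhds] with z hz
      have h2 := (Complex.hasDerivAt_cos z).unique
        ((hasDerivAt_const z (Complex.cos x)).congr_of_eventuallyEq hz)
      simpa using h2
    have h3 := (Complex.hasDerivAt_sin x).unique
        ((hasDerivAt_const x (0 : ℂ)).congr_of_eventuallyEq hd)
    have h4 := hd.self_of_nhds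
    have h5 := Complex.sin_sq_add_cos_sq x
    rw [h3, h4] at h5
    norm_num at h5
  rw [nhds_prod_eq, nhds_prod_eq]
  refine (Filter.prod_mono h1 le_rfl).trans ?_
  rw [← Filter.map_id (f := 𝓝 q), Filter.prod_map_map_eq, Filter.map_id]
  rfl

lemma sq_mem_stripQ {x q : ℂ} (h : ‖q‖ * Real.exp |x.im| < 1) : (x, q ^ 2) ∈ stripQ := by
  show ‖q ^ 2‖ * Real.exp (2 * |x.im|) < 1
  rw [norm_pow, two_mul, Real.exp_add]
  have : 0 ≤ ‖q‖ * Real.exp |x.im| := by positivity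
  nlinarith

lemma isOpen_domain : IsOpen domain := by
  rw [isOpen_iff_mem_nhds]
  rintro ⟨z, q⟩ ⟨x, rfl, hx⟩
  refine nhds_cos_le x q ?_
  rw [Filter.mem_map]
  filter_upwards [(isOpen_lt (f := fun p : ℂ × ℂ => ‖p.2‖ * Real.exp |p.1.im|) (by fun_prop)
    continuous_const).mem_nhds hx] with p hp
  exact ⟨p.1, rfl, hp⟩

lemma mem_domain_nome {x τ : ℂ} (h : |x.im| < Real.pi * τ.im) : (Complex.cos x, nome τ) ∈ domain := by
  refine ⟨x, rfl, ?_⟩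
  simp only
  rw [norm_nome, ← Real.exp_add, Real.exp_lt_one_iff]
  linarith

/-- The converse of `HasGegenbauerForm.cosSeriesBound`: local summability in (y, Q) descends to (z,
q) because cos is open. -/
theorem hasGegenbauerForm_of_cosSeriesBound {g : ℝ} {n : ℕ} {p : ℕ → Polynomial ℂ}
    (h0 : p 0 = gegenbauer g n) (hdeg : ∀ ℓ, (p ℓ).natDegree ≤ n + 2 * ℓ)
    (hp : CosSeriesBound n p) :
    HasGegenbauerForm g n fun z q => ∑' ℓ, (p ℓ).eval z * q ^ (2 * ℓ) := by
  refine ⟨?_, p, h0, hdeg, ?_⟩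
  · refine analyticOnNhd_tsum isOpen_domain (fun ℓ x _ => ?_) ?_
    · refine AnalyticAt.mul ?_ (analyticAt_snd.pow _)
      simpa [Polynomial.coe_aeval_eq_eval] using (analyticAt_fst (p := x)).aeval_polynomial (p ℓ)
    · rintro ⟨z, q⟩ ⟨x, rfl, hx⟩
      obtain ⟨V, hV, u, hu, hb⟩ := hp.locally_summable (sq_mem_stripQ hx)
      refine ⟨(fun p : ℂ × ℂ => (Complex.cos p.1, p.2)) '' ((fun p : ℂ × ℂ => (p.1, p.2 ^ 2)) ⁻¹' V),
        ?_, u, hu, ?_⟩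
      · refine nhds_cos_le x q (Filter.image_mem_map ?_)
        have : Continuous fun p : ℂ × ℂ => (p.1, p.2 ^ 2) := by fun_prop
        exact this.continuousAt hV
      · rintro ℓ _ ⟨y, hy, rfl⟩
        simp only [pow_mul]
        exact hb ℓ _ hy
  · rintro z q ⟨x, rfl, hx⟩
    have := (hp.hasSum (sq_mem_stripQ hx)).summable.hasSum
    simpa only [pow_mul] using this

/-! ### Contour integrals depending on two complex parameters -/

/-- The derivative of a function of three variables along `v`. -/
def pderiv (v : ℂ × ℂ × ℂ) (F : ℂ × ℂ × ℂ → ℂ) (p : ℂ × ℂ × ℂ) : ℂ := fderiv ℂ F p v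

lemma analyticAt_pderiv {F : ℂ × ℂ × ℂ → ℂ} {p : ℂ × ℂ × ℂ} (v : ℂ × ℂ × ℂ)
    (hF : AnalyticAt ℂ F p) : AnalyticAt ℂ (pderiv v F) p :=
  (ContinuousLinearMap.apply ℂ ℂ v).analyticAt _ |>.comp hF.fderiv

lemma hasDerivAt_pderiv_one {F : ℂ × ℂ × ℂ → ℂ} {x Q y : ℂ} (hF : AnalyticAt ℂ F (x, Q, y)) :
    HasDerivAt (fun x => F (x, Q, y)) (pderiv (1, 0, 0) F (x, Q, y)) x :=
  HasFDerivAt.comp_hasDerivAt (f := fun x => (x, Q, y)) (l := F) x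
    hF.differentiableAt.hasFDerivAt
    ((hasDerivAt_id x).prodMk ((hasDerivAt_const x Q).prodMk (hasDerivAt_const x y)))

lemma hasDerivAt_pderiv_two {F : ℂ × ℂ × ℂ → ℂ} {x Q y : ℂ} (hF : AnalyticAt ℂ F (x, Q, y)) :
    HasDerivAt (fun Q => F (x, Q, y)) (pderiv (0, 1, 0) F (x, Q, y)) Q :=
  HasFDerivAt.comp_hasDerivAt (f := fun Q => (x, Q, y)) (l := F) Q
    hF.differentiableAt.hasFDerivAt
    ((hasDerivAt_const Q x).prodMk ((hasDerivAt_id Q).prodMk (hasDerivAt_const Q y)))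

lemma hasDerivAt_pderiv_three {F : ℂ × ℂ × ℂ → ℂ} {x Q y : ℂ} (hF : AnalyticAt ℂ F (x, Q, y)) :
    HasDerivAt (fun y => F (x, Q, y)) (pderiv (0, 0, 1) F (x, Q, y)) y :=
  HasFDerivAt.comp_hasDerivAt (f := fun y => (x, Q, y)) (l := F) y
    hF.differentiableAt.hasFDerivAt
    ((hasDerivAt_const y x).prodMk ((hasDerivAt_const y Q).prodMk (hasDerivAt_id y)))

/-- The integral of `F` over the line from `-π + iε` to `π + iε` in the third variable. -/
def lineIntegral (ε : ℝ) (F : ℂ × ℂ × ℂ → ℂ) (p : ℂ × ℂ) : ℂ :=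
  ∫ t in (-Real.pi)..Real.pi, F (p.1, p.2, t + ε * I)

section

variable {ε : ℝ} {F : ℂ × ℂ × ℂ → ℂ} {U : Set (ℂ × ℂ)}

lemma continuousOn_line (hF : ∀ p ∈ U, ∀ t : ℝ, AnalyticAt ℂ F (p.1, p.2, t + ε * I)) :
    ContinuousOn (fun p : (ℂ × ℂ) × ℝ => F (p.1.1, p.1.2, p.2 + ε * I)) (U ×ˢ univ) := by
  rintro ⟨p, t⟩ ⟨hp, -⟩
  have h := (hF p hp t).continuousAt
  have hc : Continuous fun p : (ℂ × ℂ) × ℝ => (p.1.1, p.1.2, (p.2 : ℂ) + ε * I) := by fun_prop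
  exact (ContinuousAt.comp (f := fun p : (ℂ × ℂ) × ℝ => (p.1.1, p.1.2, (p.2 : ℂ) + ε * I))
    h hc.continuousAt).continuousWithinAt

lemma continuous_line {p : ℂ × ℂ} (hF : ∀ t : ℝ, AnalyticAt ℂ F (p.1, p.2, t + ε * I)) :
    Continuous fun t : ℝ => F (p.1, p.2, t + ε * I) := by
  rw [continuous_iff_continuousAt]
  intro t
  have hc : Continuous fun t : ℝ => (p.1, p.2, (t : ℂ) + ε * I) := by fun_prop
  exact ContinuousAt.comp (f := fun t : ℝ => (p.1, p.2, (t : ℂ) + ε * I))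
    (hF t).continuousAt hc.continuousAt

lemma hasDerivAt_lineIntegral_fst (hU : IsOpen U)
    (hF : ∀ p ∈ U, ∀ t : ℝ, AnalyticAt ℂ F (p.1, p.2, t + ε * I)) {x Q : ℂ} (hp : (x, Q) ∈ U) :
    HasDerivAt (fun x => lineIntegral ε F (x, Q)) (lineIntegral ε (pderiv (1, 0, 0) F) (x, Q)) x := by
  have hm : ∀ q : ℂ × ℝ, q ∈ {x | (x, Q) ∈ U} ×ˢ univ → ((q.1, Q), q.2) ∈ U ×ˢ (univ : Set ℝ) :=
    fun q hq => ⟨hq.1, trivial⟩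
  refine hasDerivAt_intervalIntegral (U := {x | (x, Q) ∈ U})
    (F := fun x t => F (x, Q, t + ε * I)) (F' := fun x t => pderiv (1, 0, 0) F (x, Q, t + ε * I))
    (hU.preimage (by fun_prop)) ?_ ?_ ?_ hp
  · exact (continuousOn_line hF).comp (f := fun q : ℂ × ℝ => ((q.1, Q), q.2)) (by fun_prop) hm
  · exact (continuousOn_line fun p hp t => analyticAt_pderiv _ (hF p hp t)).comp
      (f := fun q : ℂ × ℝ => ((q.1, Q), q.2)) (by fun_prop) hm
  · exact fun z hz t => hasDerivAt_pderiv_one (hF _ hz t)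

lemma hasDerivAt_lineIntegral_snd (hU : IsOpen U)
    (hF : ∀ p ∈ U, ∀ t : ℝ, AnalyticAt ℂ F (p.1, p.2, t + ε * I)) {x Q : ℂ} (hp : (x, Q) ∈ U) :
    HasDerivAt (fun Q => lineIntegral ε F (x, Q)) (lineIntegral ε (pderiv (0, 1, 0) F) (x, Q)) Q := by
  have hm : ∀ q : ℂ × ℝ, q ∈ {Q | (x, Q) ∈ U} ×ˢ univ → ((x, q.1), q.2) ∈ U ×ˢ (univ : Set ℝ) :=
    fun q hq => ⟨hq.1, trivial⟩
  refine hasDerivAt_intervalIntegral (U := {Q | (x, Q) ∈ U})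
    (F := fun Q t => F (x, Q, t + ε * I)) (F' := fun Q t => pderiv (0, 1, 0) F (x, Q, t + ε * I))
    (hU.preimage (by fun_prop)) ?_ ?_ ?_ hp
  · exact (continuousOn_line hF).comp (f := fun q : ℂ × ℝ => ((x, q.1), q.2)) (by fun_prop) hm
  · exact (continuousOn_line fun p hp t => analyticAt_pderiv _ (hF p hp t)).comp
      (f := fun q : ℂ × ℝ => ((x, q.1), q.2)) (by fun_prop) hm
  · exact fun z hz t => hasDerivAt_pderiv_two (hF _ hz t)

/-- Differentiation under the integral in each variable separately, then Osgood's lemma. -/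
lemma analyticOnNhd_lineIntegral (hU : IsOpen U)
    (hF : ∀ p ∈ U, ∀ t : ℝ, AnalyticAt ℂ F (p.1, p.2, t + ε * I)) :
    AnalyticOnNhd ℂ (lineIntegral ε F) U :=
  analyticOnNhd_of_separately hU (continuousOn_intervalIntegral (continuousOn_line hF))
    (fun _ hp => (hasDerivAt_lineIntegral_fst hU hF hp).differentiableAt)
    (fun _ hp => (hasDerivAt_lineIntegral_snd hU hF hp).differentiableAt)

lemma dfst_lineIntegral (hU : IsOpen U)
    (hF : ∀ p ∈ U, ∀ t : ℝ, AnalyticAt ℂ F (p.1, p.2, t + ε * I)) {p : ℂ × ℂ} (hp : p ∈ U) :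
    dfst (lineIntegral ε F) p = lineIntegral ε (pderiv (1, 0, 0) F) p :=
  (hasDerivAt_lineIntegral_fst hU hF hp).deriv

lemma dsnd_lineIntegral (hU : IsOpen U)
    (hF : ∀ p ∈ U, ∀ t : ℝ, AnalyticAt ℂ F (p.1, p.2, t + ε * I)) {p : ℂ × ℂ} (hp : p ∈ U) :
    dsnd (lineIntegral ε F) p = lineIntegral ε (pderiv (0, 1, 0) F) p :=
  (hasDerivAt_lineIntegral_snd hU hF hp).deriv

lemma dfst_dfst_lineIntegral (hU : IsOpen U)
    (hF : ∀ p ∈ U, ∀ t : ℝ, AnalyticAt ℂ F (p.1, p.2, t + ε * I)) {p : ℂ × ℂ} (hp : p ∈ U) :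
    dfst (dfst (lineIntegral ε F)) p =
      lineIntegral ε (pderiv (1, 0, 0) (pderiv (1, 0, 0) F)) p := by
  rw [← dfst_lineIntegral hU (fun p hp t => analyticAt_pderiv _ (hF p hp t)) hp]
  refine Filter.EventuallyEq.deriv_eq ?_
  filter_upwards [eventually_slice_fst (x := p.1) (Q := p.2) (hU.mem_nhds hp)] with u hu
  exact dfst_lineIntegral hU hF hu

end

/-! ### The integrand without the prefactor -/

/-- The logarithm of `(1 - e^{2ix}) θ₁(x) / sin x` for `Im x > 0`. -/
def upperLog (p : ℂ × ℂ) : ℂ := Complex.log (1 - cexp (2 * I * p.1)) + logTheta p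

lemma norm_exp_lt_one {x : ℂ} (hx : 0 < x.im) : ‖cexp (2 * I * x)‖ < 1 := by
  rw [Complex.norm_exp]
  exact Real.exp_lt_one_iff.mpr (by simpa using hx)

lemma sin_ne_zero_of_im_pos {x : ℂ} (hx : 0 < x.im) : Complex.sin x ≠ 0 := by
  intro h
  rw [Complex.sin_eq_zero_iff] at h
  obtain ⟨k, hk⟩ := h
  rw [hk] at hx
  simp at hx

lemma analyticAt_upperLog {p : ℂ × ℂ} (hp : p ∈ stripQ) (h : 0 < p.1.im) :
    AnalyticAt ℂ upperLog p := by
  refine AnalyticAt.add (AnalyticAt.clog ?_ (one_sub_mem_slitPlane (norm_exp_lt_one h)))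
    (analyticAt_logTheta hp)
  exact analyticAt_const.sub (analyticAt_const.mul analyticAt_fst).cexp

/-- The extra i comes from 1 - e^{2ix} = -2i e^{ix} sin x. -/
lemma hasDerivAt_upperLog_fst {x Q : ℂ} (hp : (x, Q) ∈ stripQ) (h : 0 < x.im) :
    HasDerivAt (fun x => upperLog (x, Q)) (phi (x, Q) + I) x := by
  have h1 : HasDerivAt (fun x => 1 - cexp (2 * I * x)) (-(cexp (2 * I * x) * (2 * I))) x := by
    simpa using (((hasDerivAt_id x).const_mul (2 * I)).cexp).const_sub 1
  have h2 := (h1.clog (one_sub_mem_slitPlane (norm_exp_lt_one h))).add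
    (hasDerivAt_dfst (analyticAt_logTheta hp))
  refine h2.congr_deriv ?_
  have h3 := one_sub_ne_zero_of_norm_lt (norm_exp_lt_one h)
  have h4 := sin_ne_zero_of_im_pos h
  have e : -(cexp (2 * I * x) * (2 * I)) / (1 - cexp (2 * I * x)) =
      Complex.cos x / Complex.sin x + I := by
    have e2 : cexp (2 * I * x) = cexp (x * I) ^ 2 := by
      rw [← Complex.exp_nat_mul]; congr 1; push_cast; ring
    have hE := Complex.exp_ne_zero (x * I)
    rw [div_eq_iff h3]
    field_simp
    rw [Complex.sin, Complex.cos, show -x * I = -(x * I) by ring, Complex.exp_neg, e2]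
    field_simp
    ring_nf
    simp only [I_sq]
    ring
  rw [e, phi, rho]
  ring

lemma hasDerivAt_upperLog_snd {x Q : ℂ} (hp : (x, Q) ∈ stripQ) :
    HasDerivAt (fun Q => upperLog (x, Q)) (dsnd logTheta (x, Q)) Q :=
  (hasDerivAt_dsnd (analyticAt_logTheta hp)).const_add (Complex.log (1 - cexp (2 * I * x)))

lemma phi_neg (x Q : ℂ) : phi (-x, Q) = -phi (x, Q) := by
  have := deriv_comp_neg (fun z => logTheta (z, Q)) x
  simp only [logTheta_neg] at this
  simp only [phi, rho, dfst, Complex.cos_neg, Complex.sin_neg]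
  rw [← neg_eq_iff_eq_neg.mpr this]
  ring

lemma phi'_neg (x Q : ℂ) : phi' (-x, Q) = phi' (x, Q) := by
  have e1 : ∀ z, rho (-z, Q) = -rho (z, Q) := fun z => by
    have := deriv_comp_neg (fun z => logTheta (z, Q)) z
    simp only [logTheta_neg] at this
    rw [rho, dfst, dfst]
    simp only
    rw [this, neg_neg]
  have := deriv_comp_neg (fun z => rho (z, Q)) x
  simp only [e1, deriv.fun_neg] at this
  simp only [phi', Complex.sin_neg, even_two.neg_pow]
  rw [rho', dfst, dfst]
  rw [neg_injective this]

lemma phi_add_pi (x Q : ℂ) : phi (x + Real.pi, Q) = phi (x, Q) := by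
  have := deriv_comp_add_const (fun z => logTheta (z, Q)) Real.pi x
  simp only [logTheta_add_pi] at this
  simp only [phi, rho, dfst, Complex.cos_add_pi, Complex.sin_add_pi]
  rw [← this]
  ring

/-- The points `(x, Q, y)` with `|Im x| < Im y` and `|Q| e^{2 Im y} < 1`. -/
def contourDomain : Set (ℂ × ℂ × ℂ) :=
  {p | |p.1.im| < p.2.2.im ∧ ‖p.2.1‖ * Real.exp (2 * p.2.2.im) < 1}

lemma isOpen_contourDomain : IsOpen contourDomain :=
  (isOpen_lt (f := fun p : ℂ × ℂ × ℂ => |p.1.im|) (g := fun p => p.2.2.im) (by fun_prop)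
    (by fun_prop)).inter (isOpen_lt (f := fun p : ℂ × ℂ × ℂ => ‖p.2.1‖ * Real.exp (2 * p.2.2.im))
      (by fun_prop) continuous_const)

section

variable {x Q y : ℂ}

lemma mem_stripQ_of_abs_le (h : (x, Q, y) ∈ contourDomain) {z : ℂ} (hz : |z.im| ≤ y.im) :
    (z, Q) ∈ stripQ := by
  have h1 : ‖Q‖ * Real.exp (2 * |z.im|) ≤ ‖Q‖ * Real.exp (2 * y.im) := by gcongr
  exact h1.trans_lt h.2

lemma half_sum_im_pos (h : (x, Q, y) ∈ contourDomain) : 0 < ((y + x) / 2).im ∧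
    0 < ((y - x) / 2).im ∧ 0 < y.im := by
  have h1 := abs_lt.mp (show |x.im| < y.im from h.1)
  have h2 := abs_nonneg x.im
  have h3 : |x.im| < y.im := h.1
  refine ⟨?_, ?_, by linarith⟩
  · rw [show ((y + x) / 2).im = (y.im + x.im) / 2 by simp]; linarith
  · rw [show ((y - x) / 2).im = (y.im - x.im) / 2 by simp]; linarith

lemma half_sum_mem_stripQ (h : (x, Q, y) ∈ contourDomain) : ((y + x) / 2, Q) ∈ stripQ ∧
    ((y - x) / 2, Q) ∈ stripQ ∧ (y, Q) ∈ stripQ ∧ (x, Q) ∈ stripQ := by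
  obtain ⟨a, b, c⟩ := half_sum_im_pos h
  have h1 := abs_lt.mp (show |x.im| < y.im from h.1)
  refine ⟨mem_stripQ_of_abs_le h ?_, mem_stripQ_of_abs_le h ?_,
    mem_stripQ_of_abs_le h (abs_of_pos c).le, mem_stripQ_of_abs_le h h.1.le⟩
  · rw [abs_of_pos a, show ((y + x) / 2).im = (y.im + x.im) / 2 by simp]; linarith
  · rw [abs_of_pos b, show ((y - x) / 2).im = (y.im - x.im) / 2 by simp]; linarith

end

/-- The logarithm of `(θ₁(y)²)^g / (θ₁((x+y)/2) θ₁((x-y)/2))^s`. -/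
def logKernel (g s : ℂ) (p : ℂ × ℂ × ℂ) : ℂ :=
  g * (Real.pi * I - 2 * I * p.2.2 - (Real.log 4 : ℂ) + 2 * upperLog (p.2.2, p.2.1)) -
    s * (-(Real.log 4 : ℂ) - I * p.2.2 + upperLog ((p.2.2 + p.1) / 2, p.2.1) +
      upperLog ((p.2.2 - p.1) / 2, p.2.1))

section

variable {g s x Q y : ℂ}

lemma analyticAt_logKernel (h : (x, Q, y) ∈ contourDomain) :
    AnalyticAt ℂ (logKernel g s) (x, Q, y) := by
  obtain ⟨a, b, c⟩ := half_sum_im_pos h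
  obtain ⟨a', b', c', -⟩ := half_sum_mem_stripQ h
  have p1 : AnalyticAt ℂ (fun p : ℂ × ℂ × ℂ => p.1) (x, Q, y) := analyticAt_fst
  have p2 : AnalyticAt ℂ (fun p : ℂ × ℂ × ℂ => p.2.1) (x, Q, y) :=
    analyticAt_fst.comp analyticAt_snd
  have p3 : AnalyticAt ℂ (fun p : ℂ × ℂ × ℂ => p.2.2) (x, Q, y) :=
    analyticAt_snd.comp analyticAt_snd
  have l1 : AnalyticAt ℂ (fun p : ℂ × ℂ × ℂ => upperLog (p.2.2, p.2.1)) (x, Q, y) :=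
    AnalyticAt.fun_comp (f := fun p : ℂ × ℂ × ℂ => (p.2.2, p.2.1)) (analyticAt_upperLog c' c)
      (p3.prod p2)
  have l2 : AnalyticAt ℂ (fun p : ℂ × ℂ × ℂ => upperLog ((p.2.2 + p.1) / 2, p.2.1)) (x, Q, y) :=
    AnalyticAt.fun_comp (f := fun p : ℂ × ℂ × ℂ => ((p.2.2 + p.1) / 2, p.2.1))
      (analyticAt_upperLog a' a) ((p3.add p1).div_const.prod p2)
  have l3 : AnalyticAt ℂ (fun p : ℂ × ℂ × ℂ => upperLog ((p.2.2 - p.1) / 2, p.2.1)) (x, Q, y) :=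
    AnalyticAt.fun_comp (f := fun p : ℂ × ℂ × ℂ => ((p.2.2 - p.1) / 2, p.2.1))
      (analyticAt_upperLog b' b) ((p3.sub p1).div_const.prod p2)
  refine AnalyticAt.sub (analyticAt_const.mul ?_) (analyticAt_const.mul ?_)
  · exact ((analyticAt_const.sub (analyticAt_const.mul p3)).sub analyticAt_const).add
      (analyticAt_const.mul l1)
  · exact ((analyticAt_const.sub (analyticAt_const.mul p3)).add l2).add l3

lemma hasDerivAt_half_add (x y : ℂ) : HasDerivAt (fun x => (y + x) / 2) (1 / 2) x :=
  ((hasDerivAt_id x).const_add y).div_const 2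

lemma hasDerivAt_half_sub (x y : ℂ) : HasDerivAt (fun x => (y - x) / 2) (-1 / 2) x :=
  ((hasDerivAt_id x).const_sub y).div_const 2

lemma hasDerivAt_half_add' (x y : ℂ) : HasDerivAt (fun y => (y + x) / 2) (1 / 2) y :=
  ((hasDerivAt_id y).add_const x).div_const 2

lemma hasDerivAt_half_sub' (x y : ℂ) : HasDerivAt (fun y => (y - x) / 2) (1 / 2) y :=
  ((hasDerivAt_id y).sub_const x).div_const 2

lemma hasDerivAt_logKernel_one (h : (x, Q, y) ∈ contourDomain) :
    HasDerivAt (fun x => logKernel g s (x, Q, y))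
      (-(s / 2) * (phi ((y + x) / 2, Q) - phi ((y - x) / 2, Q))) x := by
  obtain ⟨a, b, c⟩ := half_sum_im_pos h
  obtain ⟨a', b', c', -⟩ := half_sum_mem_stripQ h
  have d1 := HasDerivAt.comp (h₂ := fun u => upperLog (u, Q)) x (hasDerivAt_upperLog_fst a' a)
    (hasDerivAt_half_add x y)
  have d2 := HasDerivAt.comp (h₂ := fun u => upperLog (u, Q)) x (hasDerivAt_upperLog_fst b' b)
    (hasDerivAt_half_sub x y)
  refine ((((d1.const_add (-(Real.log 4 : ℂ) - I * y)).add d2).const_mul s).const_sub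
    (g * (Real.pi * I - 2 * I * y - (Real.log 4 : ℂ) + 2 * upperLog (y, Q)))).congr_deriv ?_
  ring

lemma hasDerivAt_logKernel_two (h : (x, Q, y) ∈ contourDomain) :
    HasDerivAt (fun Q => logKernel g s (x, Q, y))
      (2 * g * dsnd logTheta (y, Q) -
        s * (dsnd logTheta ((y + x) / 2, Q) + dsnd logTheta ((y - x) / 2, Q))) Q := by
  obtain ⟨a', b', c', -⟩ := half_sum_mem_stripQ h
  refine ((((hasDerivAt_upperLog_snd c').const_mul 2).const_add
    (Real.pi * I - 2 * I * y - (Real.log 4 : ℂ))).const_mul g |>.sub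
    (((((hasDerivAt_upperLog_snd a').const_add (-(Real.log 4 : ℂ) - I * y)).add
      (hasDerivAt_upperLog_snd b')).const_mul s))).congr_deriv ?_
  ring

lemma hasDerivAt_logKernel_three (h : (x, Q, y) ∈ contourDomain) :
    HasDerivAt (fun y => logKernel g s (x, Q, y))
      (2 * g * phi (y, Q) - s / 2 * (phi ((y + x) / 2, Q) + phi ((y - x) / 2, Q))) y := by
  obtain ⟨a, b, c⟩ := half_sum_im_pos h
  obtain ⟨a', b', c', -⟩ := half_sum_mem_stripQ h
  have d1 := HasDerivAt.comp (h₂ := fun u => upperLog (u, Q)) y (hasDerivAt_upperLog_fst a' a)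
    (hasDerivAt_half_add' x y)
  have d2 := HasDerivAt.comp (h₂ := fun u => upperLog (u, Q)) y (hasDerivAt_upperLog_fst b' b)
    (hasDerivAt_half_sub' x y)
  have d3 := (((((hasDerivAt_id y).const_mul (2 * I)).const_sub (Real.pi * I)).sub_const
    (Real.log 4 : ℂ)).add ((hasDerivAt_upperLog_fst c' c).const_mul 2)).const_mul g
  have d4 := ((((((hasDerivAt_id y).const_mul I).const_sub (-(Real.log 4 : ℂ))).add d1).add
    d2).const_mul s)
  refine (d3.sub d4).congr_deriv ?_
  ring

end

lemma analyticAt_phi {p : ℂ × ℂ} (hp : p ∈ stripQ) (h : Complex.sin p.1 ≠ 0) :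
    AnalyticAt ℂ phi p :=
  ((Complex.analyticAt_cos.comp analyticAt_fst).div (Complex.analyticAt_sin.comp analyticAt_fst)
    h).add (analyticAt_rho hp)

lemma analyticAt_phi' {p : ℂ × ℂ} (hp : p ∈ stripQ) (h : Complex.sin p.1 ≠ 0) :
    AnalyticAt ℂ phi' p :=
  (analyticAt_const.div ((Complex.analyticAt_sin.comp analyticAt_fst).pow 2)
    (pow_ne_zero 2 h)).add (analyticAt_rho' hp)

/-- The integrand without the prefactor, a function of `(x, Q, y)`. -/
def kernelFn (g s : ℂ) (f : ℂ × ℂ → ℂ) (p : ℂ × ℂ × ℂ) : ℂ :=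
  cexp (logKernel g s p) * f (p.2.2, p.2.1)

/-- The function whose `y`-derivative is the defect of the kernel identity. -/
def fluxFn (g s : ℂ) (f : ℂ × ℂ → ℂ) (p : ℂ × ℂ × ℂ) : ℂ :=
  cexp (logKernel g s p) * (dfst f (p.2.2, p.2.1) +
    s / 2 * (phi ((p.2.2 + p.1) / 2, p.2.1) + phi ((p.2.2 - p.1) / 2, p.2.1)) * f (p.2.2, p.2.1))

section

variable {g s x Q y : ℂ} {f : ℂ × ℂ → ℂ}

lemma analyticAt_kernelFn (hf : AnalyticOnNhd ℂ f stripQ) (h : (x, Q, y) ∈ contourDomain) :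
    AnalyticAt ℂ (kernelFn g s f) (x, Q, y) := by
  obtain ⟨-, -, c', -⟩ := half_sum_mem_stripQ h
  refine (analyticAt_logKernel h).cexp.mul ?_
  exact AnalyticAt.fun_comp (f := fun p : ℂ × ℂ × ℂ => (p.2.2, p.2.1)) (hf _ c')
    ((analyticAt_snd.comp analyticAt_snd).prod (analyticAt_fst.comp analyticAt_snd))

lemma analyticAt_fluxFn (hf : AnalyticOnNhd ℂ f stripQ) (h : (x, Q, y) ∈ contourDomain) :
    AnalyticAt ℂ (fluxFn g s f) (x, Q, y) := by
  obtain ⟨a, b, c⟩ := half_sum_im_pos h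
  obtain ⟨a', b', c', -⟩ := half_sum_mem_stripQ h
  have p1 : AnalyticAt ℂ (fun p : ℂ × ℂ × ℂ => p.1) (x, Q, y) := analyticAt_fst
  have p2 : AnalyticAt ℂ (fun p : ℂ × ℂ × ℂ => p.2.1) (x, Q, y) :=
    analyticAt_fst.comp analyticAt_snd
  have p3 : AnalyticAt ℂ (fun p : ℂ × ℂ × ℂ => p.2.2) (x, Q, y) :=
    analyticAt_snd.comp analyticAt_snd
  have l1 : AnalyticAt ℂ (fun p : ℂ × ℂ × ℂ => f (p.2.2, p.2.1)) (x, Q, y) :=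
    AnalyticAt.fun_comp (f := fun p : ℂ × ℂ × ℂ => (p.2.2, p.2.1)) (hf _ c') (p3.prod p2)
  have l0 : AnalyticAt ℂ (fun p : ℂ × ℂ × ℂ => dfst f (p.2.2, p.2.1)) (x, Q, y) :=
    AnalyticAt.fun_comp (f := fun p : ℂ × ℂ × ℂ => (p.2.2, p.2.1)) (hf _ c').dfst (p3.prod p2)
  have l2 : AnalyticAt ℂ (fun p : ℂ × ℂ × ℂ => phi ((p.2.2 + p.1) / 2, p.2.1)) (x, Q, y) :=
    AnalyticAt.fun_comp (f := fun p : ℂ × ℂ × ℂ => ((p.2.2 + p.1) / 2, p.2.1))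
      (analyticAt_phi a' (sin_ne_zero_of_im_pos a)) ((p3.add p1).div_const.prod p2)
  have l3 : AnalyticAt ℂ (fun p : ℂ × ℂ × ℂ => phi ((p.2.2 - p.1) / 2, p.2.1)) (x, Q, y) :=
    AnalyticAt.fun_comp (f := fun p : ℂ × ℂ × ℂ => ((p.2.2 - p.1) / 2, p.2.1))
      (analyticAt_phi b' (sin_ne_zero_of_im_pos b)) ((p3.sub p1).div_const.prod p2)
  exact (analyticAt_logKernel h).cexp.mul (l0.add ((analyticAt_const.mul (l2.add l3)).mul l1))

lemma pderiv_one_kernelFn (hf : AnalyticOnNhd ℂ f stripQ) (h : (x, Q, y) ∈ contourDomain) :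
    pderiv (1, 0, 0) (kernelFn g s f) (x, Q, y) = cexp (logKernel g s (x, Q, y)) *
      (-(s / 2) * (phi ((y + x) / 2, Q) - phi ((y - x) / 2, Q))) * f (y, Q) :=
  (hasDerivAt_pderiv_one (analyticAt_kernelFn hf h)).unique
    ((hasDerivAt_logKernel_one h).cexp.mul_const (f (y, Q)))

lemma pderiv_one_one_kernelFn (hf : AnalyticOnNhd ℂ f stripQ) (h : (x, Q, y) ∈ contourDomain) :
    pderiv (1, 0, 0) (pderiv (1, 0, 0) (kernelFn g s f)) (x, Q, y) =
      cexp (logKernel g s (x, Q, y)) *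
      ((-(s / 2) * (phi ((y + x) / 2, Q) - phi ((y - x) / 2, Q))) ^ 2 -
        s / 4 * (phi' ((y + x) / 2, Q) + phi' ((y - x) / 2, Q))) * f (y, Q) := by
  obtain ⟨a, b, c⟩ := half_sum_im_pos h
  obtain ⟨a', b', c', -⟩ := half_sum_mem_stripQ h
  have d1 := HasDerivAt.comp (h₂ := fun u => phi (u, Q)) x
    (hasDerivAt_phi a' (sin_ne_zero_of_im_pos a)) (hasDerivAt_half_add x y)
  have d2 := HasDerivAt.comp (h₂ := fun u => phi (u, Q)) x
    (hasDerivAt_phi b' (sin_ne_zero_of_im_pos b)) (hasDerivAt_half_sub x y)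
  have d3 := ((hasDerivAt_logKernel_one (g := g) (s := s) h).cexp.mul
    ((d1.sub d2).const_mul (-(s / 2)))).mul_const (f (y, Q))
  have hev : ∀ᶠ u in 𝓝 x, pderiv (1, 0, 0) (kernelFn g s f) (u, Q, y) =
      cexp (logKernel g s (u, Q, y)) *
      (-(s / 2) * (phi ((y + u) / 2, Q) - phi ((y - u) / 2, Q))) * f (y, Q) := by
    have hc : Continuous fun u : ℂ => (u, Q, y) := by fun_prop
    filter_upwards [hc.continuousAt.eventually (isOpen_contourDomain.mem_nhds h)] with u hu
    exact pderiv_one_kernelFn hf hu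
  refine ((hasDerivAt_pderiv_one (analyticAt_pderiv (1, 0, 0)
    (analyticAt_kernelFn (g := g) (s := s) hf h))).unique
    (d3.congr_of_eventuallyEq hev)).trans ?_
  simp only [Function.comp, Pi.sub_apply]
  ring

lemma pderiv_two_kernelFn (hf : AnalyticOnNhd ℂ f stripQ) (h : (x, Q, y) ∈ contourDomain) :
    pderiv (0, 1, 0) (kernelFn g s f) (x, Q, y) = cexp (logKernel g s (x, Q, y)) *
      ((2 * g * dsnd logTheta (y, Q) -
        s * (dsnd logTheta ((y + x) / 2, Q) + dsnd logTheta ((y - x) / 2, Q))) * f (y, Q) +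
        dsnd f (y, Q)) := by
  obtain ⟨-, -, c', -⟩ := half_sum_mem_stripQ h
  refine ((hasDerivAt_pderiv_two (analyticAt_kernelFn hf h)).unique
    ((hasDerivAt_logKernel_two h).cexp.mul (hasDerivAt_dsnd (hf _ c')))).trans ?_
  ring

lemma pderiv_three_fluxFn (hf : AnalyticOnNhd ℂ f stripQ) (h : (x, Q, y) ∈ contourDomain) :
    pderiv (0, 0, 1) (fluxFn g s f) (x, Q, y) = cexp (logKernel g s (x, Q, y)) *
      ((2 * g * phi (y, Q) - s / 2 * (phi ((y + x) / 2, Q) + phi ((y - x) / 2, Q))) *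
        (dfst f (y, Q) + s / 2 * (phi ((y + x) / 2, Q) + phi ((y - x) / 2, Q)) * f (y, Q)) +
      dfst (dfst f) (y, Q) + s / 4 * (phi' ((y + x) / 2, Q) + phi' ((y - x) / 2, Q)) * f (y, Q) +
      s / 2 * (phi ((y + x) / 2, Q) + phi ((y - x) / 2, Q)) * dfst f (y, Q)) := by
  obtain ⟨a, b, c⟩ := half_sum_im_pos h
  obtain ⟨a', b', c', -⟩ := half_sum_mem_stripQ h
  have d1 := HasDerivAt.comp (h₂ := fun u => phi (u, Q)) y
    (hasDerivAt_phi a' (sin_ne_zero_of_im_pos a)) (hasDerivAt_half_add' x y)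
  have d2 := HasDerivAt.comp (h₂ := fun u => phi (u, Q)) y
    (hasDerivAt_phi b' (sin_ne_zero_of_im_pos b)) (hasDerivAt_half_sub' x y)
  have d3 := (hasDerivAt_logKernel_three (g := g) (s := s) h).cexp.mul
    ((hasDerivAt_dfst (hf _ c').dfst).add
      (((d1.add d2).const_mul (s / 2)).mul (hasDerivAt_dfst (hf _ c'))))
  refine ((hasDerivAt_pderiv_three (analyticAt_fluxFn (g := g) (s := s) hf h)).unique
    d3).trans ?_
  simp only [Function.comp, Pi.add_apply, Pi.mul_apply]
  ring

/-- The shift of the energy, as a function of `Q = q²`. -/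
def energyShiftQ (g κ Q : ℂ) : ℂ :=
  4 * κ * (1 - 2 * g - κ) * (1 / 12 - 2 * lamSq Q) - 12 * κ * (2 * g + κ) * lamSq Q

/-- After the common exponential is factored out, the heat equation removes the Q-derivatives of log
θ₁ at y and (y ± x)/2. The equation for f removes its second y-derivative and its Q-derivative. The
remaining quadratic expression in φ is closed by the addition theorem at two zero-sum triples, and
the constants -1 + 24 `lamSq Q` of that theorem account for the energy shift. -/
theorem kernel_identity {κ E : ℂ} (hf : AnalyticOnNhd ℂ f stripQ) (h : (x, Q, y) ∈ contourDomain)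
    (hQ : Q ≠ 0) (hx : Complex.sin x ≠ 0) (hE : reducedOp κ g f (y, Q) = E * f (y, Q)) :
    -4 * κ * (Q * pderiv (0, 1, 0) (kernelFn g (2 * g + κ) f) (x, Q, y)) -
      pderiv (1, 0, 0) (pderiv (1, 0, 0) (kernelFn g (2 * g + κ) f)) (x, Q, y) -
      2 * (g + κ) * phi (x, Q) * pderiv (1, 0, 0) (kernelFn g (2 * g + κ) f) (x, Q, y) +
      ((κ * (g + κ) / 2 - (g + κ) ^ 2) * (phi' (x, Q) + phi (x, Q) ^ 2) + κ * (g + κ) / 2 -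
        4 * (g + κ) * ((g + κ) - 1) * (1 / 12 - 2 * lamSq Q) - (E + energyShiftQ g κ Q)) *
        kernelFn g (2 * g + κ) f (x, Q, y) =
      pderiv (0, 0, 1) (fluxFn g (2 * g + κ) f) (x, Q, y) := by
  obtain ⟨a, b, c⟩ := half_sum_im_pos h
  obtain ⟨a', b', c', d'⟩ := half_sum_mem_stripQ h
  have sa := sin_ne_zero_of_im_pos a
  have sb := sin_ne_zero_of_im_pos b
  have sc := sin_ne_zero_of_im_pos c
  rw [pderiv_one_kernelFn hf h, pderiv_one_one_kernelFn hf h, pderiv_two_kernelFn hf h,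
    pderiv_three_fluxFn hf h, kernelFn, energyShiftQ]
  rw [reducedOp] at hE
  have neg_mem : ∀ {z : ℂ}, (z, Q) ∈ stripQ → (-z, Q) ∈ stripQ := fun {z} hz => by
    show ‖Q‖ * Real.exp (2 * |(-z).im|) < 1
    rw [neg_im, abs_neg]
    exact hz
  have neg_sin : ∀ {z : ℂ}, Complex.sin z ≠ 0 → Complex.sin (-z) ≠ 0 := fun {z} hz => by
    rw [Complex.sin_neg]
    exact neg_ne_zero.mpr hz
  have h1 := heat_logTheta a' hQ sa
  have h2 := heat_logTheta b' hQ sb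
  have h3 := heat_logTheta c' hQ sc
  have A1 := addition_phi d' (neg_mem a') b' hQ hx (neg_sin sa) sb (by ring)
  have A2 := addition_phi c' (neg_mem a') (neg_mem b') hQ sc (neg_sin sa) (neg_sin sb) (by ring)
  rw [phi_neg, phi'_neg] at A1 A2
  rw [phi_neg ((y - x) / 2), phi'_neg ((y - x) / 2)] at A2
  simp only at hE ⊢
  set eM := cexp (logKernel g (2 * g + κ) (x, Q, y))
  -- The weights of the heat equations are the exponents of the kernel: 2g for θ₁(y) and -(2g+κ) for
  -- θ₁((y ± x)/2). The triples containing x and y carry (g+κ)(2g+κ)/2 and g(2g+κ)/2 with opposite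
  -- signs.
  linear_combination eM * hE +
    κ * eM * f (y, Q) * (2 * g * h3 - (2 * g + κ) * (h1 + h2)) -
    (g + κ) * (2 * g + κ) / 2 * eM * f (y, Q) * A1 + g * (2 * g + κ) / 2 * eM * f (y, Q) * A2

end

/-! ### Periodicity and parity of the kernel, and the transformed equation -/

lemma upperLog_add_pi (x Q : ℂ) : upperLog (x + Real.pi, Q) = upperLog (x, Q) := by
  have h1 : cexp (2 * I * (x + Real.pi)) = cexp (2 * I * x) := by
    rw [show 2 * I * (x + Real.pi) = 2 * I * x + 2 * Real.pi * I by ring]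
    exact Complex.exp_periodic _
  simp only [upperLog, h1, logTheta_add_pi]

/-- The logarithm changes by -4πig + 2πi(2g+κ) = 2πiκ. This is where the integrality of κ enters. -/
lemma exp_logKernel_add_two_pi (g x Q y : ℂ) (κ : ℤ) :
    cexp (logKernel g (2 * g + κ) (x, Q, y + 2 * Real.pi)) =
      cexp (logKernel g (2 * g + κ) (x, Q, y)) := by
  have h : logKernel g (2 * g + κ) (x, Q, y + 2 * Real.pi) =
      logKernel g (2 * g + κ) (x, Q, y) + κ * (2 * Real.pi * I) := by
    simp only [logKernel]
    rw [show (y + 2 * Real.pi + x) / 2 = (y + x) / 2 + Real.pi by ring,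
      show (y + 2 * Real.pi - x) / 2 = (y - x) / 2 + Real.pi by ring,
      show y + 2 * (Real.pi : ℂ) = y + Real.pi + Real.pi by ring]
    simp only [upperLog_add_pi]
    ring
  rw [h, Complex.exp_add, Complex.exp_int_mul_two_pi_mul_I, mul_one]

lemma logKernel_neg (g s x Q y : ℂ) : logKernel g s (-x, Q, y) = logKernel g s (x, Q, y) := by
  simp only [logKernel, sub_neg_eq_add, ← sub_eq_add_neg]
  ring

lemma logKernel_add_two_pi_left (g s x Q y : ℂ) :
    logKernel g s (x + 2 * Real.pi, Q, y) = logKernel g s (x, Q, y) := by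
  simp only [logKernel]
  rw [show (y + (x + 2 * Real.pi)) / 2 = (y + x) / 2 + Real.pi by ring, upperLog_add_pi,
    show (y - x) / 2 = (y - (x + 2 * Real.pi)) / 2 + Real.pi by ring, upperLog_add_pi]

section

variable {g : ℂ} {κ : ℤ} {f : ℂ × ℂ → ℂ}

lemma kernelFn_add_two_pi (hper : ∀ y Q, f (y + 2 * Real.pi, Q) = f (y, Q)) (x Q y : ℂ) :
    kernelFn g (2 * g + κ) f (x, Q, y + 2 * Real.pi) = kernelFn g (2 * g + κ) f (x, Q, y) := by
  simp only [kernelFn, exp_logKernel_add_two_pi, hper]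

lemma fluxFn_add_two_pi (hper : ∀ y Q, f (y + 2 * Real.pi, Q) = f (y, Q)) (x Q y : ℂ) :
    fluxFn g (2 * g + κ) f (x, Q, y + 2 * Real.pi) = fluxFn g (2 * g + κ) f (x, Q, y) := by
  have h1 : dfst f (y + 2 * Real.pi, Q) = dfst f (y, Q) := by
    have := deriv_comp_add_const (fun z => f (z, Q)) (2 * Real.pi) y
    simp only [hper] at this
    exact this.symm
  simp only [fluxFn, exp_logKernel_add_two_pi, hper, h1]
  rw [show (y + 2 * Real.pi + x) / 2 = (y + x) / 2 + Real.pi by ring,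
      show (y + 2 * Real.pi - x) / 2 = (y - x) / 2 + Real.pi by ring, phi_add_pi, phi_add_pi]

/-- The points `(x, Q)` with `|Im x| < ε` and `|Q| e^{2ε} < 1`. -/
def contourBase (ε : ℝ) : Set (ℂ × ℂ) := {p | |p.1.im| < ε ∧ ‖p.2‖ * Real.exp (2 * ε) < 1}

lemma isOpen_contourBase (ε : ℝ) : IsOpen (contourBase ε) :=
  (isOpen_lt (f := fun p : ℂ × ℂ => |p.1.im|) (by fun_prop) continuous_const).inter
    (isOpen_lt (f := fun p : ℂ × ℂ => ‖p.2‖ * Real.exp (2 * ε)) (by fun_prop) continuous_const)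

lemma mem_contourDomain {ε : ℝ} {p : ℂ × ℂ} (hp : p ∈ contourBase ε) (t : ℝ) :
    (p.1, p.2, (t : ℂ) + ε * I) ∈ contourDomain := by
  have h : ((t : ℂ) + ε * I).im = ε := by simp
  refine ⟨?_, ?_⟩
  · simp only [h]; exact hp.1
  · simp only [h]; exact hp.2

/-- The integral transform without the prefactor and the normalization. -/
def reducedTransform (g : ℂ) (κ : ℤ) (f : ℂ × ℂ → ℂ) (ε : ℝ) (p : ℂ × ℂ) : ℂ :=
  lineIntegral ε (kernelFn g (2 * g + κ) f) p

lemma analyticOnNhd_reducedTransform (hf : AnalyticOnNhd ℂ f stripQ) (ε : ℝ) :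
    AnalyticOnNhd ℂ (reducedTransform g κ f ε) (contourBase ε) :=
  analyticOnNhd_lineIntegral (isOpen_contourBase ε)
    fun _ hp t => analyticAt_kernelFn hf (mem_contourDomain hp t)

/-- The kernel identity integrated over one period: the operator passes under the integral, and the
flux vanishes by periodicity. -/
theorem reducedOp_reducedTransform {E x Q : ℂ} {ε : ℝ}
    (hf : AnalyticOnNhd ℂ f stripQ) (hper : ∀ y Q, f (y + 2 * Real.pi, Q) = f (y, Q))
    (hp : (x, Q) ∈ contourBase ε) (hQ : Q ≠ 0) (hx : Complex.sin x ≠ 0)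
    (hE : ∀ y, 0 < y.im → (y, Q) ∈ stripQ → reducedOp κ g f (y, Q) = E * f (y, Q)) :
    reducedOp κ (g + κ) (reducedTransform g κ f ε) (x, Q) =
      (E + energyShiftQ g κ Q) * reducedTransform g κ f ε (x, Q) := by
  set F := kernelFn g (2 * g + κ) f with hF
  have hU := isOpen_contourBase ε
  have hA : ∀ p ∈ contourBase ε, ∀ t : ℝ, AnalyticAt ℂ F (p.1, p.2, t + ε * I) :=
    fun p hp t => analyticAt_kernelFn hf (mem_contourDomain hp t)
  have h0 : lineIntegral ε (pderiv (0, 0, 1) (fluxFn g (2 * g + κ) f)) (x, Q) = 0 := by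
    have hG : ∀ t : ℝ, AnalyticAt ℂ (fluxFn g (2 * g + κ) f) (x, Q, t + ε * I) :=
      fun t => analyticAt_fluxFn hf (mem_contourDomain hp t)
    refine integral_horizontal_deriv_eq_zero (f := fun y => fluxFn g (2 * g + κ) f (x, Q, y))
      (f' := fun y => pderiv (0, 0, 1) (fluxFn g (2 * g + κ) f) (x, Q, y))
      (fun t => hasDerivAt_pderiv_three (hG t)) ?_ ?_
    · exact continuous_line (p := (x, Q)) fun t => analyticAt_pderiv _ (hG t)
    · rw [← fluxFn_add_two_pi hper x Q (-(Real.pi : ℂ) + ε * I)]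
      congr 3
      ring
  have hi : ∀ G : ℂ × ℂ × ℂ → ℂ, (∀ t : ℝ, AnalyticAt ℂ G (x, Q, t + ε * I)) →
      IntervalIntegrable (fun t : ℝ => G (x, Q, t + ε * I)) volume (-Real.pi) Real.pi :=
    fun G hG => (continuous_line (p := (x, Q)) hG).intervalIntegrable _ _
  have i0 := hi F (hA _ hp)
  have i1 := hi _ fun t => analyticAt_pderiv (1, 0, 0) (hA _ hp t)
  have i2 := hi _ fun t => analyticAt_pderiv (0, 1, 0) (hA _ hp t)
  have i11 := hi _ fun t => analyticAt_pderiv (1, 0, 0) (analyticAt_pderiv (1, 0, 0) (hA _ hp t))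
  have hid : ∀ t : ℝ, _ := fun t : ℝ => by
    have hd := mem_contourDomain hp t
    obtain ⟨-, -, c⟩ := half_sum_im_pos hd
    exact kernel_identity (κ := κ) hf hd hQ hx (hE _ c (half_sum_mem_stripQ hd).2.2.1)
  have e : lineIntegral ε (pderiv (0, 0, 1) (fluxFn g (2 * g + κ) f)) (x, Q) = _ :=
    intervalIntegral.integral_congr fun t _ => (hid t).symm
  rw [h0, ← hF] at e
  rw [intervalIntegral.integral_add, intervalIntegral.integral_sub, intervalIntegral.integral_sub,
    intervalIntegral.integral_const_mul, intervalIntegral.integral_const_mul,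
    intervalIntegral.integral_const_mul, intervalIntegral.integral_const_mul] at e
  · rw [reducedOp, show reducedTransform g κ f ε = lineIntegral ε F from rfl,
      dfst_dfst_lineIntegral hU hA hp, dfst_lineIntegral hU hA hp, dsnd_lineIntegral hU hA hp]
    simp only [lineIntegral]
    linear_combination -e
  all_goals first
    | exact i0.const_mul _
    | exact i1.const_mul _
    | exact i11
    | exact (i2.const_mul _).const_mul _
    | exact ((i2.const_mul _).const_mul _).sub i11
    | exact (((i2.const_mul _).const_mul _).sub i11).sub (i1.const_mul _)

/-- Cauchy's theorem in the strip |Im x| < Im y < β, where β exceeds both heights and still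
satisfies |Q| e^{2β} < 1. -/
theorem reducedTransform_congr {x Q : ℂ} {ε ε' : ℝ}
    (hf : AnalyticOnNhd ℂ f stripQ) (hper : ∀ y Q, f (y + 2 * Real.pi, Q) = f (y, Q))
    (hp : (x, Q) ∈ contourBase ε) (hp' : (x, Q) ∈ contourBase ε') :
    reducedTransform g κ f ε (x, Q) = reducedTransform g κ f ε' (x, Q) := by
  obtain ⟨β, hβ, hβ1, hβ2⟩ : ∃ β, ‖Q‖ * Real.exp (2 * β) < 1 ∧ ε < β ∧ ε' < β := by
    have h1 : ∀ᶠ β in 𝓝 (max ε ε'), ‖Q‖ * Real.exp (2 * β) < 1 := by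
      refine (isOpen_lt (f := fun β => ‖Q‖ * Real.exp (2 * β)) (by fun_prop)
        continuous_const).mem_nhds ?_
      show ‖Q‖ * Real.exp (2 * max ε ε') < 1
      rcases max_choice ε ε' with h | h <;> rw [h]
      exacts [hp.2, hp'.2]
    obtain ⟨β, h2, h3⟩ := ((h1.filter_mono (nhdsWithin_le_nhds (s := Ioi (max ε ε')))).and
      self_mem_nhdsWithin).exists
    exact ⟨β, h2, (le_max_left _ _).trans_lt h3, (le_max_right _ _).trans_lt h3⟩
  have hm : ∀ y : ℂ, |x.im| < y.im → y.im < β → (x, Q, y) ∈ contourDomain := fun y h1 h2 => by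
    refine ⟨h1, lt_of_le_of_lt ?_ hβ⟩
    show ‖Q‖ * Real.exp (2 * y.im) ≤ _
    gcongr
  refine integral_horizontal_eq (f := fun y => kernelFn g (2 * g + κ) f (x, Q, y))
    (α := |x.im|) (β := β) (fun y hy => ?_) (fun y _ _ => kernelFn_add_two_pi hper x Q y)
    ⟨hp.1, hβ1⟩ ⟨hp'.1, hβ2⟩
  exact (hasDerivAt_pderiv_three
    (analyticAt_kernelFn hf (hm y hy.1 hy.2))).differentiableAt.differentiableWithinAt

end

/-! ### Continuation of the reduced equation from the real line -/

lemma reducedOp_const_mul (κ g c : ℂ) (f : ℂ × ℂ → ℂ) (p : ℂ × ℂ) :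
    reducedOp κ g (fun p => c * f p) p = c * reducedOp κ g f p := by
  have h1 : ∀ f : ℂ × ℂ → ℂ, dfst (fun p => c * f p) = fun p => c * dfst f p := fun f => by
    funext p
    exact deriv_const_mul_field c
  have h2 : dsnd (fun p => c * f p) = fun p => c * dsnd f p := by
    funext p
    exact deriv_const_mul_field c
  simp only [reducedOp, h1, h2]
  ring

lemma analyticAt_reducedOp (κ g : ℂ) {f : ℂ × ℂ → ℂ} {y Q : ℂ} (hf : AnalyticAt ℂ f (y, Q))
    (hp : (y, Q) ∈ stripQ) (hy : Complex.sin y ≠ 0) :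
    AnalyticAt ℂ (fun y => reducedOp κ g f (y, Q)) y := by
  have hc : ∀ F : ℂ × ℂ → ℂ, AnalyticAt ℂ F (y, Q) → AnalyticAt ℂ (fun y => F (y, Q)) y :=
    fun F hF => AnalyticAt.fun_comp (f := fun y => (y, Q)) hF (analyticAt_id.prod analyticAt_const)
  have a1 := hc _ hf
  have a2 := hc _ hf.dfst
  have a3 := hc _ hf.dfst.dfst
  have a4 := hc _ hf.dsnd
  have a5 := hc _ (analyticAt_phi hp hy)
  have a6 := hc _ (analyticAt_phi' hp hy)
  simp only [reducedOp]
  generalize lamSq Q = L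
  fun_prop

/-- The identity theorem used twice, to avoid the zeros of the sine on the real line: first on the
rectangle 0 < Re y < π across the real axis, then on the upper half of the strip, which overlaps
that rectangle. The equation is needed there because the contour is not real. -/
theorem reducedOp_eq_of_real {κ g E : ℂ} {f : ℂ × ℂ → ℂ} {τ : UpperHalfPlane}
    (hf : AnalyticOnNhd ℂ f stripQ)
    (hE : ∀ x : ℝ, Real.sin x ≠ 0 →
      reducedOp κ g f (x, nome τ ^ 2) = E * f (x, nome τ ^ 2)) {y : ℂ} (hy : 0 < y.im)
    (hyQ : (y, nome τ ^ 2) ∈ stripQ) :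
    reducedOp κ g f (y, nome τ ^ 2) = E * f (y, nome τ ^ 2) := by
  set Q := nome τ ^ 2 with hQ
  set D : ℂ → ℂ := fun y => reducedOp κ g f (y, Q) - E * f (y, Q) with hD
  have hDa : ∀ y, (y, Q) ∈ stripQ → Complex.sin y ≠ 0 → AnalyticAt ℂ D y := fun y h1 h2 => by
    refine (analyticAt_reducedOp κ g (hf _ h1) h1 h2).sub (analyticAt_const.mul ?_)
    exact AnalyticAt.fun_comp (f := fun y => (y, Q)) (hf _ h1) (analyticAt_id.prod analyticAt_const)
  set c := Real.pi * (τ : ℂ).im with hc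
  have hc0 : 0 < c := mul_pos Real.pi_pos τ.im_pos
  have hmem : ∀ y : ℂ, (y, Q) ∈ stripQ ↔ |y.im| < c := fun y => mem_stripQ_nome
  set S₁ : Set ℂ := (({z | 0 < z.re} ∩ {z | z.re < Real.pi}) ∩ ({z | -c < z.im} ∩ {z | z.im < c}))
  set S₂ : Set ℂ := ({z | 0 < z.im} ∩ {z | z.im < c})
  have hS₁ : IsPreconnected S₁ := (((convex_halfSpace_re_gt 0).inter (convex_halfSpace_re_lt _)).inter
    ((convex_halfSpace_im_gt _).inter (convex_halfSpace_im_lt _))).isPreconnected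
  have hS₂ : IsPreconnected S₂ :=
    ((convex_halfSpace_im_gt 0).inter (convex_halfSpace_im_lt c)).isPreconnected
  have z1 : EqOn D 0 S₁ := by
    refine AnalyticOnNhd.eqOn_zero_of_preconnected_of_frequently_eq_zero (z₀ := ((Real.pi / 2 : ℝ) : ℂ))
      (fun z hz => hDa z ((hmem z).mpr (abs_lt.mpr hz.2))
        (sin_ne_zero_of_re (Real.sin_pos_of_pos_of_lt_pi hz.1.1 hz.1.2).ne')) hS₁ ?_ ?_
    · refine ⟨⟨?_, ?_⟩, ?_, ?_⟩ <;> simp only [mem_ofPred_eq, ofReal_re, ofReal_im] <;>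
        linarith [Real.pi_pos]
    · have hlim : Tendsto (fun t : ℝ => (t : ℂ)) (𝓝[≠] (Real.pi / 2))
          (𝓝[≠] ((Real.pi / 2 : ℝ) : ℂ)) :=
        tendsto_nhdsWithin_of_tendsto_nhds_of_eventually_within _
          (Complex.continuous_ofReal.continuousAt.tendsto.mono_left nhdsWithin_le_nhds)
          (by
            filter_upwards [self_mem_nhdsWithin] with t ht h
            exact ht (Complex.ofReal_injective h))
      refine hlim.frequently (Filter.Eventually.frequently ?_)
      have : ∀ᶠ t in 𝓝 (Real.pi / 2), Real.sin t ≠ 0 := by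
        refine Real.continuous_sin.continuousAt.eventually_ne ?_
        simp
      filter_upwards [this.filter_mono nhdsWithin_le_nhds] with t ht
      exact sub_eq_zero.mpr (hE t ht)
  have z2 : EqOn D 0 S₂ := by
    refine AnalyticOnNhd.eqOn_zero_of_preconnected_of_eventuallyEq_zero
      (z₀ := ((Real.pi / 2 : ℝ) : ℂ) + ((c / 2 : ℝ) : ℂ) * I)
      (fun z hz => hDa z ((hmem z).mpr (by rw [abs_of_pos hz.1]; exact hz.2))
        (sin_ne_zero_of_im_pos hz.1)) hS₂ ?_ ?_
    · constructor <;> simp <;> linarith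
    · have ho : IsOpen S₁ := by
        refine ((isOpen_lt ?_ ?_).inter (isOpen_lt ?_ ?_)).inter ((isOpen_lt ?_ ?_).inter
          (isOpen_lt ?_ ?_)) <;> fun_prop
      filter_upwards [ho.mem_nhds (x := ((Real.pi / 2 : ℝ) : ℂ) + ((c / 2 : ℝ) : ℂ) * I) (by
        refine ⟨⟨?_, ?_⟩, ?_, ?_⟩ <;> simp <;> linarith [Real.pi_pos])] with z hz
      exact z1 hz
  have := z2 ⟨hy, (abs_lt.mp ((hmem y).mp hyQ)).2⟩
  exact sub_eq_zero.mp this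

/-! ### Growth of the transform in the imaginary direction -/

/-- The region is not compact in x, but Q and Q e^{±2ix} stay in a closed disc of radius t < 1, and
compactness of the closed bidisc gives the bound. -/
lemma exists_bound_logTheta {t : ℝ} (ht : t < 1) :
    ∃ C, ∀ p : ℂ × ℂ, ‖p.2‖ * Real.exp (2 * |p.1.im|) ≤ t → ‖logTheta p‖ ≤ C := by
  have hK : IsCompact (closedBall (0 : ℂ) t ×ˢ closedBall (0 : ℂ) t) :=
    (isCompact_closedBall _ _).prod (isCompact_closedBall _ _)
  obtain ⟨C, hC⟩ := hK.exists_bound_of_continuousOn (f := logQPoch)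
    (analyticOnNhd_logQPoch.continuousOn.mono fun p hp =>
      ⟨(mem_closedBall_zero_iff.mp hp.1).trans_lt ht, (mem_closedBall_zero_iff.mp hp.2).trans_lt ht⟩)
  refine ⟨C + C + C, fun p hp => ?_⟩
  have h : ∀ y : ℝ, y ≤ 2 * |p.1.im| → ‖p.2‖ * Real.exp y ≤ t := fun y hy =>
    le_trans (mul_le_mul_of_nonneg_left (Real.exp_le_exp.mpr hy) (norm_nonneg _)) hp
  have h0 : ‖p.2‖ ≤ t := by simpa using h 0 (by positivity)
  have h1 := neg_abs_le p.1.im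
  have h2 := le_abs_self p.1.im
  have hb : ∀ w : ℂ, ‖w‖ ≤ t → ‖logQPoch (w, p.2)‖ ≤ C := fun w hw =>
    hC (w, p.2) ⟨mem_closedBall_zero_iff.mpr hw, mem_closedBall_zero_iff.mpr h0⟩
  refine (norm_add₃_le).trans (add_le_add (add_le_add (hb _ h0) (hb _ ?_)) (hb _ ?_)) <;>
    rw [norm_mul, Complex.norm_exp] <;> refine h _ ?_ <;> simp <;> linarith

/-- Keeping Im x ≥ δ bounds the argument e^{2ix} away from the singularity at 1. -/
lemma exists_bound_upperLog {t δ : ℝ} (ht : t < 1) (hδ : 0 < δ) :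
    ∃ C, 0 ≤ C ∧ ∀ p : ℂ × ℂ, ‖p.2‖ * Real.exp (2 * |p.1.im|) ≤ t → δ ≤ p.1.im →
      ‖upperLog p‖ ≤ C := by
  obtain ⟨C, hC⟩ := exists_bound_logTheta ht
  have hr : Real.exp (-(2 * δ)) < 1 := Real.exp_lt_one_iff.mpr (by linarith)
  refine ⟨|Real.exp (-(2 * δ)) * (1 - Real.exp (-(2 * δ)))⁻¹ + C|, abs_nonneg _,
    fun p hp h => le_trans ?_ (le_abs_self _)⟩
  refine (norm_add_le _ _).trans (add_le_add ?_ (hC p hp))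
  have h1 : ‖cexp (2 * I * p.1)‖ ≤ Real.exp (-(2 * δ)) := by
    rw [Complex.norm_exp]
    refine Real.exp_le_exp.mpr ?_
    simpa using h
  refine (norm_log_one_sub_le hr h1).trans ?_
  have : 0 ≤ (1 - Real.exp (-(2 * δ)))⁻¹ := inv_nonneg.mpr (by linarith)
  gcongr

lemma CosSeriesBound.exists_bound {n : ℕ} {p : ℕ → Polynomial ℂ} (h : CosSeriesBound n p) {t : ℝ}
    (ht0 : 0 ≤ t) (ht : t < 1) :
    ∃ C, 0 ≤ C ∧ ∀ x : ℂ × ℂ, ‖x.2‖ * Real.exp (2 * |x.1.im|) ≤ t →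
      ‖cosSeries p x‖ ≤ C * Real.exp (n * |x.1.im|) := by
  obtain ⟨σ, hσ1, hσ2⟩ := exists_between ht
  have hσ0 : 0 < σ := ht0.trans_lt hσ1
  obtain ⟨M, hM⟩ := h σ hσ0 hσ2
  have hg := hasSum_geometric_of_lt_one (r := t / σ) (by positivity) ((div_lt_one hσ0).mpr hσ1)
  refine ⟨|M| * (1 - t / σ)⁻¹, ?_, fun x hx => ?_⟩
  · have : 0 ≤ (1 - t / σ)⁻¹ := inv_nonneg.mpr (sub_nonneg.mpr ((div_lt_one hσ0).mpr hσ1).le)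
    positivity
  have h2 := hg.mul_left (|M| * Real.exp (n * |x.1.im|))
  rw [mul_right_comm] at h2
  refine tsum_of_norm_bounded h2 fun ℓ => ?_
  rw [norm_mul, norm_pow]
  have hb : ‖(p ℓ).eval (Complex.cos x.1)‖ * σ ^ ℓ ≤
      |M| * Real.exp (n * |x.1.im|) * Real.exp (2 * |x.1.im|) ^ ℓ := by
    refine (hM ℓ x.1).trans ?_
    have := le_abs_self M
    gcongr
  have hc : (‖x.2‖ * Real.exp (2 * |x.1.im|)) ^ ℓ ≤ t ^ ℓ := by gcongr
  rw [div_pow, ← mul_div_assoc, le_div_iff₀ (by positivity)]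
  calc ‖(p ℓ).eval (Complex.cos x.1)‖ * ‖x.2‖ ^ ℓ * σ ^ ℓ
      = ‖(p ℓ).eval (Complex.cos x.1)‖ * σ ^ ℓ * ‖x.2‖ ^ ℓ := by ring
    _ ≤ |M| * Real.exp (n * |x.1.im|) * Real.exp (2 * |x.1.im|) ^ ℓ * ‖x.2‖ ^ ℓ := by gcongr
    _ = |M| * Real.exp (n * |x.1.im|) * (‖x.2‖ * Real.exp (2 * |x.1.im|)) ^ ℓ := by
      rw [mul_pow]; ring
    _ ≤ _ := by gcongr

/-- Isolates κiy, the only term that is unbounded as the contour moves up; the factors e^{-2igy} and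
e^{i(2g+κ)y} combine to it. -/
lemma logKernel_eq (g : ℂ) (κ : ℤ) (x Q y : ℂ) :
    logKernel g (2 * g + κ) (x, Q, y) = κ * (I * y) + (g * (Real.pi * I - (Real.log 4 : ℂ) +
      2 * upperLog (y, Q)) + (2 * g + κ) * ((Real.log 4 : ℂ) - upperLog ((y + x) / 2, Q) -
        upperLog ((y - x) / 2, Q))) := by
  simp only [logKernel]
  ring

/-- At height |Im x| + δ both (y ± x)/2 have imaginary part at least δ/2, and |Q| e^{2 Im y} ≤ σ
e^{2δ} < 1, so all the logarithms are bounded. What remains is e^{-κ|Im x|} from the kernel and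
e^{n|Im x|} from the series. -/
theorem exists_bound_reducedTransform {g : ℂ} {κ : ℤ} {n m : ℕ} {p : ℕ → Polynomial ℂ}
    (h : CosSeriesBound n p) (hm : (m : ℤ) = n - κ) {σ δ : ℝ} (hσ : 0 < σ) (hδ : 0 < δ)
    (hσδ : σ * Real.exp (2 * δ) < 1) :
    ∃ M, ∀ x Q : ℂ, ‖Q‖ * Real.exp (2 * |x.im|) ≤ σ →
      ‖reducedTransform g κ (cosSeries p) (|x.im| + δ) (x, Q)‖ ≤ M * Real.exp (m * |x.im|) := by
  have ht0 : 0 ≤ σ * Real.exp (2 * δ) := by positivity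
  obtain ⟨C, hC0, hC⟩ := exists_bound_upperLog hσδ (half_pos hδ)
  obtain ⟨D, hD0, hD⟩ := h.exists_bound ht0 hσδ
  set B : ℝ := ‖g‖ * (‖(Real.pi : ℂ) * I - (Real.log 4 : ℂ)‖ + 2 * C) +
    ‖2 * g + κ‖ * (‖(Real.log 4 : ℂ)‖ + C + C) with hB
  refine ⟨Real.exp (-(κ * δ)) * Real.exp B * (D * Real.exp (n * δ)) * (2 * Real.pi), fun x Q hQ => ?_⟩
  have hbound : ∀ t : ℝ, ‖kernelFn g (2 * g + κ) (cosSeries p) (x, Q, t + (|x.im| + δ : ℝ) * I)‖ ≤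
      Real.exp (-(κ * δ)) * Real.exp B * (D * Real.exp (n * δ)) * Real.exp (m * |x.im|) := by
    intro t
    set y : ℂ := t + (|x.im| + δ : ℝ) * I with hy
    have hyim : y.im = |x.im| + δ := by simp [hy]
    have hx1 := neg_abs_le x.im
    have hx2 := le_abs_self x.im
    have hx3 := abs_nonneg x.im
    have him : ∀ z : ℂ, |z.im| ≤ y.im → ‖Q‖ * Real.exp (2 * |z.im|) ≤ σ * Real.exp (2 * δ) :=
      fun z hz => by
        calc ‖Q‖ * Real.exp (2 * |z.im|) ≤ ‖Q‖ * Real.exp (2 * |x.im| + 2 * δ) := by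
              gcongr; linarith
          _ = ‖Q‖ * Real.exp (2 * |x.im|) * Real.exp (2 * δ) := by rw [Real.exp_add]; ring
          _ ≤ _ := by gcongr
    have i1 : ((y + x) / 2).im = (y.im + x.im) / 2 := by simp
    have i2 : ((y - x) / 2).im = (y.im - x.im) / 2 := by simp
    have u1 := hC (y, Q) (him y (abs_of_pos (by linarith)).le) (by simp only; linarith)
    have u2 := hC ((y + x) / 2, Q) (him _ (by rw [i1, abs_of_pos] <;> linarith))
      (by simp only; rw [i1]; linarith)
    have u3 := hC ((y - x) / 2, Q) (him _ (by rw [i2, abs_of_pos] <;> linarith))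
      (by simp only; rw [i2]; linarith)
    have u4 := hD (y, Q) (him y (abs_of_pos (by linarith)).le)
    rw [kernelFn, norm_mul, logKernel_eq, Complex.exp_add, norm_mul]
    have e1 : ‖cexp (κ * (I * y))‖ = Real.exp (-(κ * δ)) * Real.exp (-(κ * |x.im|)) := by
      rw [Complex.norm_exp, ← Real.exp_add]
      congr 1
      rw [← Complex.ofReal_intCast, Complex.re_ofReal_mul, Complex.I_mul_re, hyim]
      ring
    have e2 : ‖cexp (g * (Real.pi * I - (Real.log 4 : ℂ) + 2 * upperLog (y, Q)) +
        (2 * g + κ) * ((Real.log 4 : ℂ) - upperLog ((y + x) / 2, Q) -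
        upperLog ((y - x) / 2, Q)))‖ ≤ Real.exp B := by
      refine (Complex.norm_exp_le_exp_norm _).trans (Real.exp_le_exp.mpr ?_)
      refine (norm_add_le _ _).trans (add_le_add ?_ ?_)
      · rw [norm_mul]
        refine mul_le_mul_of_nonneg_left ((norm_add_le _ _).trans ?_) (norm_nonneg _)
        refine add_le_add le_rfl ?_
        rw [norm_mul, Complex.norm_ofNat]
        gcongr
      · rw [norm_mul]
        refine mul_le_mul_of_nonneg_left ((norm_sub_le _ _).trans (add_le_add
          ((norm_sub_le _ _).trans (add_le_add le_rfl u2)) u3)) (norm_nonneg _)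
    have e3 : |y.im| = |x.im| + δ := by rw [abs_of_pos] <;> linarith
    simp only [e3] at u4
    rw [e1]
    have hmn : (m : ℝ) = n - κ := by exact_mod_cast hm
    clear_value B
    calc _ ≤ Real.exp (-(κ * δ)) * Real.exp (-(κ * |x.im|)) * Real.exp B *
          (D * Real.exp (n * (|x.im| + δ))) := by gcongr
      _ = _ := by
        rw [hmn, mul_add, Real.exp_add, show ((n : ℝ) - κ) * |x.im| = n * |x.im| + -(κ * |x.im|) by
          ring, Real.exp_add]
        ring
  have h3 := intervalIntegral.norm_integral_le_of_norm_le_const (a := -Real.pi) (b := Real.pi)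
    (fun t _ => hbound t)
  refine h3.trans (le_of_eq ?_)
  rw [show Real.pi - -Real.pi = 2 * Real.pi by ring, abs_of_pos Real.two_pi_pos]
  ring

/-! ### The expansion of the transform in powers of `Q` -/

lemma cosSeries_add_two_pi (p : ℕ → Polynomial ℂ) (y Q : ℂ) :
    cosSeries p (y + 2 * Real.pi, Q) = cosSeries p (y, Q) := by
  simp only [cosSeries, Complex.cos_add_two_pi]

lemma iterate_dsnd (f : ℂ × ℂ → ℂ) (ℓ : ℕ) (x Q : ℂ) :
    dsnd^[ℓ] f (x, Q) = iteratedDeriv ℓ (fun Q => f (x, Q)) Q := by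
  rw [iteratedDeriv_eq_iterate]
  induction ℓ generalizing Q with
  | zero => rfl
  | succ ℓ ih =>
    rw [Function.iterate_succ_apply', Function.iterate_succ_apply', dsnd]
    congr 1
    funext z
    exact ih z

lemma analyticAt_iterate_dsnd {f : ℂ × ℂ → ℂ} {p : ℂ × ℂ} (hf : AnalyticAt ℂ f p) (ℓ : ℕ) :
    AnalyticAt ℂ (dsnd^[ℓ] f) p := by
  induction ℓ with
  | zero => exact hf
  | succ ℓ ih =>
    rw [Function.iterate_succ_apply']
    exact ih.dsnd

section

variable {g : ℂ} {κ : ℤ} {f : ℂ × ℂ → ℂ}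

/-- The coefficient of `Q^ℓ` in the expansion of the transform. -/
def transformCoeff (g : ℂ) (κ : ℤ) (f : ℂ × ℂ → ℂ) (ℓ : ℕ) (x : ℂ) : ℂ :=
  (ℓ.factorial : ℂ)⁻¹ * dsnd^[ℓ] (reducedTransform g κ f (|x.im| + 1)) (x, 0)

lemma mem_contourBase_iff_of_lt {ε : ℝ} {x Q : ℂ} (hx : |x.im| < ε) :
    (x, Q) ∈ contourBase ε ↔ ‖Q‖ < Real.exp (-(2 * ε)) := by
  rw [Real.exp_neg, ← one_div, lt_div_iff₀ (Real.exp_pos _)]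
  exact ⟨fun h => h.2, fun h => ⟨hx, h⟩⟩

/-- Independence of the height allows one fixed contour for all points near x, which gives
differentiability in x. -/
lemma transformCoeff_eq (hf : AnalyticOnNhd ℂ f stripQ)
    (hper : ∀ y Q, f (y + 2 * Real.pi, Q) = f (y, Q)) {x : ℂ} {ε : ℝ} (hx : |x.im| < ε) (ℓ : ℕ) :
    transformCoeff g κ f ℓ x =
      (ℓ.factorial : ℂ)⁻¹ * dsnd^[ℓ] (reducedTransform g κ f ε) (x, 0) := by
  have h1 : |x.im| < |x.im| + 1 := by linarith
  rw [transformCoeff, iterate_dsnd, iterate_dsnd]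
  congr 1
  refine Filter.EventuallyEq.iteratedDeriv_eq ℓ ?_
  have hb : ∀ ε : ℝ, |x.im| < ε → ∀ᶠ Q in 𝓝 (0 : ℂ), (x, Q) ∈ contourBase ε := fun ε h =>
    eventually_slice_snd ((isOpen_contourBase ε).mem_nhds
      ((mem_contourBase_iff_of_lt h).mpr (by simpa using Real.exp_pos _)))
  filter_upwards [hb _ h1, hb _ hx] with Q a b
  exact reducedTransform_congr hf hper a b

lemma differentiable_transformCoeff (hf : AnalyticOnNhd ℂ f stripQ)
    (hper : ∀ y Q, f (y + 2 * Real.pi, Q) = f (y, Q)) (ℓ : ℕ) :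
    Differentiable ℂ (transformCoeff g κ f ℓ) := by
  intro x
  have hx : |x.im| < |x.im| + 1 := by linarith
  have h0 : (x, (0 : ℂ)) ∈ contourBase (|x.im| + 1) :=
    (mem_contourBase_iff_of_lt hx).mpr (by simpa using Real.exp_pos _)
  have hA := analyticAt_iterate_dsnd
    (analyticOnNhd_reducedTransform (g := g) (κ := κ) hf (|x.im| + 1) _ h0) ℓ
  have hd := ((hasDerivAt_dfst hA).const_mul (ℓ.factorial : ℂ)⁻¹).differentiableAt
  refine hd.congr_of_eventuallyEq ?_
  filter_upwards [(isOpen_lt (f := fun u : ℂ => |u.im|) (by fun_prop)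
    continuous_const).mem_nhds hx] with u hu
  exact transformCoeff_eq hf hper hu ℓ

lemma hasSum_transformCoeff (hf : AnalyticOnNhd ℂ f stripQ)
    (hper : ∀ y Q, f (y + 2 * Real.pi, Q) = f (y, Q)) {x Q : ℂ} {ε : ℝ}
    (hp : (x, Q) ∈ contourBase ε) :
    HasSum (fun ℓ => transformCoeff g κ f ℓ x * Q ^ ℓ) (reducedTransform g κ f ε (x, Q)) := by
  have hx : |x.im| < ε := hp.1
  have hd : DifferentiableOn ℂ (fun Q => reducedTransform g κ f ε (x, Q))
      (ball 0 (Real.exp (-(2 * ε)))) := fun z hz =>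
    (hasDerivAt_dsnd (analyticOnNhd_reducedTransform hf ε _ ((mem_contourBase_iff_of_lt hx).mpr
      (mem_ball_zero_iff.mp hz)))).differentiableAt.differentiableWithinAt
  have h := Complex.hasSum_taylorSeries_on_ball hd
    (mem_ball_zero_iff.mpr ((mem_contourBase_iff_of_lt hx).mp hp))
  refine h.congr_fun fun ℓ => ?_
  rw [transformCoeff_eq hf hper hx, iterate_dsnd]
  simp only [sub_zero, smul_eq_mul]
  ring

end

/-- Cauchy's estimate in Q trades the growth of the transform for growth e^{(m+2ℓ)|Im x|} of its
ℓ-th coefficient. Being entire, even and 2π-periodic, the coefficient is a polynomial in cos x, and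
the same estimate is the bound required of the new series. -/
theorem exists_cosSeries_reducedTransform {g : ℂ} {κ : ℤ} {n m : ℕ} {p : ℕ → Polynomial ℂ}
    (h : CosSeriesBound n p) (hm : (m : ℤ) = n - κ) :
    ∃ p' : ℕ → Polynomial ℂ, (∀ ℓ, (p' ℓ).natDegree ≤ m + 2 * ℓ) ∧ CosSeriesBound m p' ∧
      ∀ ε : ℝ, ∀ x ∈ contourBase ε, reducedTransform g κ (cosSeries p) ε x = cosSeries p' x := by
  have hf := h.analyticOnNhd_cosSeries
  have hper := cosSeries_add_two_pi p
  have hbd : ∀ σ : ℝ, 0 < σ → σ < 1 → ∃ M : ℝ, ∀ ℓ (y : ℂ),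
      ‖transformCoeff g κ (cosSeries p) ℓ y‖ * σ ^ ℓ ≤
        M * Real.exp (m * |y.im|) * Real.exp (2 * |y.im|) ^ ℓ := by
    intro σ hσ0 hσ1
    obtain ⟨δ, hδ, hσδ⟩ : ∃ δ : ℝ, 0 < δ ∧ σ * Real.exp (2 * δ) < 1 := by
      have h1 : ∀ᶠ δ in 𝓝 (0 : ℝ), σ * Real.exp (2 * δ) < 1 := by
        refine (isOpen_lt (f := fun δ : ℝ => σ * Real.exp (2 * δ)) (by fun_prop)
          continuous_const).mem_nhds ?_
        simpa using hσ1
      obtain ⟨δ, h2, h3⟩ := ((h1.filter_mono (nhdsWithin_le_nhds (s := Ioi 0))).and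
        self_mem_nhdsWithin).exists
      exact ⟨δ, h3, h2⟩
    obtain ⟨M, hM⟩ := exists_bound_reducedTransform (g := g) h hm hσ0 hδ hσδ
    refine ⟨M, fun ℓ y => ?_⟩
    have hy : |y.im| < |y.im| + δ := by linarith
    have hE := Real.exp_pos (2 * |y.im|)
    -- The circle |Q| = σ e^{-2|Im y|} is the largest on which `hM` applies. The condition σ e^{2δ}
    -- < 1 places it inside the disc of convergence for the contour at height |Im y| + δ.
    have h1 := norm_coeff_mul_pow_le (c := fun ℓ => transformCoeff g κ (cosSeries p) ℓ y)
      (f := fun Q => reducedTransform g κ (cosSeries p) (|y.im| + δ) (y, Q))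
      (r := σ / Real.exp (2 * |y.im|)) (R := Real.exp (-(2 * (|y.im| + δ))))
      (M := M * Real.exp (m * |y.im|)) (by positivity) (by
        rw [div_lt_iff₀ hE, mul_add, neg_add, Real.exp_add, Real.exp_neg, Real.exp_neg]
        rw [← lt_div_iff₀ (Real.exp_pos _)] at hσδ
        refine hσδ.trans_eq ?_
        field_simp) (fun Q hQ => hasSum_transformCoeff hf hper
          ((mem_contourBase_iff_of_lt hy).mpr hQ)) (fun Q hQ => hM y Q (by
            rw [hQ, div_mul_cancel₀ _ hE.ne'])) ℓ
    rw [div_pow, ← mul_div_assoc, div_le_iff₀ (by positivity)] at h1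
    exact h1
  have hex : ∀ ℓ, ∃ P : Polynomial ℂ, P.natDegree ≤ m + 2 * ℓ ∧
      ∀ x, P.eval (Complex.cos x) = transformCoeff g κ (cosSeries p) ℓ x := by
    intro ℓ
    -- The constant may depend on ℓ here, so a single value of σ suffices.
    obtain ⟨M, hM⟩ := hbd (1 / 2) (by norm_num) (by norm_num)
    refine exists_polynomial_cos (C := M * 2 ^ ℓ) (differentiable_transformCoeff hf hper ℓ)
      (fun x => ?_) (fun x => ?_) fun x => ?_
    · simp only [transformCoeff, iterate_dsnd, reducedTransform, lineIntegral, kernelFn,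
        logKernel_add_two_pi_left]
      simp
    · simp only [transformCoeff, iterate_dsnd, reducedTransform, lineIntegral, kernelFn,
        logKernel_neg, neg_im, abs_neg]
    · have h1 := hM ℓ x
      rw [div_pow, one_pow, mul_one_div, div_le_iff₀ (by positivity)] at h1
      refine h1.trans (le_of_eq ?_)
      push_cast
      rw [add_mul, Real.exp_add, ← Real.exp_nat_mul]
      ring_nf
  choose p' hdeg hev using hex
  refine ⟨p', hdeg, fun σ h0 h1 => ?_, fun ε x hx => ?_⟩
  · obtain ⟨M, hM⟩ := hbd σ h0 h1
    exact ⟨M, fun ℓ y => by rw [hev]; exact hM ℓ y⟩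
  · rw [cosSeries]
    simp only [hev]
    exact (hasSum_transformCoeff hf hper hx).tsum_eq.symm

/-! ### The Gegenbauer equation -/

section Gegenbauer

open Polynomial

/-- The operator `(1 - z²) P'' - (2g + 1) z P' + n (n + 2g) P`. -/
def gegOp (g : ℂ) (n : ℕ) (P : ℂ[X]) : ℂ[X] :=
  (1 - X ^ 2) * derivative (derivative P) - C (2 * g + 1) * (X * derivative P) +
    C (n * (n + 2 * g)) * P

lemma gegOp_sub (g : ℂ) (n : ℕ) (P R : ℂ[X]) : gegOp g n (P - R) = gegOp g n P - gegOp g n R := by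
  simp only [gegOp, derivative_sub]
  ring

lemma gegOp_sum (g : ℂ) (n : ℕ) {ι : Type*} (s : Finset ι) (P : ι → ℂ[X]) :
    gegOp g n (∑ i ∈ s, P i) = ∑ i ∈ s, gegOp g n (P i) := by
  simp only [gegOp, derivative_sum, Finset.mul_sum, Finset.sum_add_distrib, Finset.sum_sub_distrib]

lemma gegOp_C_mul (g : ℂ) (n : ℕ) (a : ℂ) (P : ℂ[X]) :
    gegOp g n (C a * P) = C a * gegOp g n P := by
  simp only [gegOp, derivative_C_mul]
  ring

/-- On powers of 2X the operator has two terms, which makes the recursion visible. The truncated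
exponent j - 2 is harmless, since its coefficient vanishes for j = 0 and j = 1. -/
lemma gegOp_two_mul_X_pow (g : ℂ) (n j : ℕ) : gegOp g n ((2 * X) ^ j) =
    C (4 * ((j : ℂ) * (j - 1))) * (2 * X) ^ (j - 2) +
      C (((n : ℂ) - j) * (n + j + 2 * g)) * (2 * X) ^ j := by
  have h2 : derivative (2 * X : ℂ[X]) = 2 := by
    rw [show (2 : ℂ[X]) = C 2 from rfl, derivative_C_mul_X]
  rcases j with _ | _ | j
  · simp [gegOp]
  · simp only [gegOp, zero_add, pow_one, h2, derivative_ofNat, Nat.cast_one, sub_self, mul_zero]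
    simp only [map_mul, map_add, map_sub, map_one, map_zero, map_ofNat]
    ring
  · have h3 : derivative ((2 * X : ℂ[X]) ^ (j + 2)) = C (2 * ((j : ℂ) + 2)) * (2 * X) ^ (j + 1) := by
      rw [derivative_pow, h2, C_mul]
      push_cast
      simp only [map_ofNat]
      ring
    have h4 : derivative (C (2 * ((j : ℂ) + 2)) * (2 * X) ^ (j + 1)) =
        C (2 * ((j : ℂ) + 2)) * (C (2 * ((j : ℂ) + 1)) * (2 * X) ^ j) := by
      rw [derivative_C_mul, derivative_pow, h2, C_mul, C_mul]
      push_cast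
      simp only [map_ofNat, map_add, map_one]
      ring
    rw [gegOp, h3, h4, show j + 1 + 1 - 2 = j by omega]
    push_cast
    simp only [C_mul, C_add, C_sub, C_1, map_ofNat]
    ring

lemma poch_succ (a : ℝ) (m : ℕ) : poch a (m + 1) = poch a m * (a + m) := by
  simp [poch, ascPochhammer_succ_right, Polynomial.eval_mul]

/-- For g ≠ 0 the sum telescopes: the lowered part of each term cancels the diagonal part of the
next. For g = 0 it is the Chebyshev equation. -/
theorem gegOp_gegenbauer (g : ℝ) (n : ℕ) : gegOp g n (gegenbauer g n) = 0 := by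
  rw [gegenbauer]
  split_ifs with hg
  · have h := Chebyshev.one_sub_X_sq_mul_derivative_derivative_T_eq_poly_in_T (R := ℂ) n
    simp only [Function.iterate_succ, Function.iterate_zero, Function.comp, id] at h
    rw [gegOp, h, hg]
    simp
    ring
  · rw [gegOp_sum]
    simp only [gegOp_C_mul, gegOp_two_mul_X_pow, mul_add, Finset.sum_add_distrib]
    -- The two unpaired ends vanish: the last lowered part because its degree is 0 or 1, and the
    -- first diagonal part because its degree is n.
    rw [Finset.sum_range_succ, Finset.sum_range_succ' _ (n / 2)]
    have hlast : ((n - 2 * (n / 2) : ℕ) : ℂ) * ((n - 2 * (n / 2) : ℕ) - 1) = 0 := by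
      rcases Nat.mod_two_eq_zero_or_one n with h | h
      · rw [show n - 2 * (n / 2) = 0 by omega]; simp
      · rw [show n - 2 * (n / 2) = 1 by omega]; simp
    rw [hlast]
    simp only [mul_zero, Nat.sub_zero, sub_self, zero_mul, map_zero, add_zero]
    rw [← Finset.sum_add_distrib]
    refine Finset.sum_eq_zero fun k hk => ?_
    have hk2 : 2 * (k + 1) ≤ n := by
      have := Finset.mem_range.mp hk
      omega
    obtain ⟨j, rfl⟩ := Nat.exists_eq_add_of_le hk2
    rw [show 2 * (k + 1) + j - 2 * (k + 1) = j by omega, show 2 * (k + 1) + j - 2 * k - 2 = j by omega,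
      show 2 * (k + 1) + j - 2 * k = j + 2 by omega, show 2 * (k + 1) + j - k = k + 1 + j + 1 by omega,
      show 2 * (k + 1) + j - (k + 1) = k + 1 + j by omega, poch_succ]
    have hcomb : ∀ (a b c d : ℂ) (Y : ℂ[X]), a * b + c * d = 0 →
        C a * (C b * Y) + C c * (C d * Y) = 0 := fun a b c d Y h => by
      rw [← mul_assoc, ← mul_assoc, ← C_mul, ← C_mul, ← add_mul, ← C_add, h, C_0, zero_mul]
    refine hcomb _ _ _ _ _ ?_
    have f1 : ((k.factorial : ℕ) : ℂ) ≠ 0 := by exact_mod_cast k.factorial_ne_zero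
    have f2 : ((j.factorial : ℕ) : ℂ) ≠ 0 := by exact_mod_cast j.factorial_ne_zero
    have f3 : ((j : ℂ) + 1) ≠ 0 := by exact_mod_cast j.succ_ne_zero
    have f4 : ((j : ℂ) + 1 + 1) ≠ 0 := by exact_mod_cast (j + 1).succ_ne_zero
    have f5 : ((k : ℂ) + 1) ≠ 0 := by exact_mod_cast k.succ_ne_zero
    simp only [Nat.factorial_succ, pow_succ]
    push_cast
    field_simp
    ring

lemma natDegree_gegenbauer_le (g : ℝ) (n : ℕ) : (gegenbauer g n).natDegree ≤ n := by
  rw [gegenbauer]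
  split_ifs with hg
  · rw [Chebyshev.natDegree_T]; simp
  · refine natDegree_sum_le_of_forall_le _ _ fun k _ => ?_
    refine (natDegree_C_mul_le _ _).trans ((natDegree_pow_le).trans ?_)
    have : (2 * X : ℂ[X]).natDegree ≤ 1 := by
      rw [show (2 : ℂ[X]) = C 2 from rfl]
      exact natDegree_C_mul_le _ _ |>.trans natDegree_X_le
    calc (n - 2 * k) * (2 * X : ℂ[X]).natDegree ≤ (n - 2 * k) * 1 := by gcongr
      _ ≤ n := by omega

lemma coeff_gegenbauer (g : ℝ) (n : ℕ) :
    (gegenbauer g n).coeff n = (gegenbauerTop g n : ℂ) * 2 ^ n := by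
  rw [gegenbauer, gegenbauerTop]
  split_ifs with hg hn
  · subst hn; simp
  · have h1 := Chebyshev.leadingCoeff_T (R := ℂ) n
    rw [leadingCoeff, Chebyshev.natDegree_T] at h1
    simp only [Int.natAbs_natCast] at h1
    rw [h1]
    obtain ⟨k, rfl⟩ := Nat.exists_eq_succ_of_ne_zero hn
    simp only [Nat.succ_eq_add_one, add_tsub_cancel_right, pow_succ]
    push_cast
    ring
  · rw [finsetSum_coeff, Finset.sum_eq_single 0]
    · rw [show (2 : ℂ[X]) = C 2 from rfl, mul_pow, ← C_pow, coeff_C_mul, coeff_C_mul, coeff_X_pow]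
      simp
    · intro k hk hk0
      rw [show (2 : ℂ[X]) = C 2 from rfl, mul_pow, ← C_pow, coeff_C_mul, coeff_C_mul, coeff_X_pow,
        if_neg, mul_zero, mul_zero]
      have := Finset.mem_range.mp hk
      omega
    · intro h; simp at h

lemma coeff_gegOp (g : ℂ) (n : ℕ) (P : ℂ[X]) (k : ℕ) : (gegOp g n P).coeff k =
    (k + 2) * (k + 1) * P.coeff (k + 2) + (n - k) * (n + k + 2 * g) * P.coeff k := by
  have e : gegOp g n P = derivative (derivative P) - derivative (derivative P) * X ^ 2 -
      C (2 * g + 1) * (derivative P * X) + C (n * (n + 2 * g)) * P := by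
    rw [gegOp]; ring
  rw [e]
  rcases k with _ | _ | k
  · simp [coeff_derivative, mul_coeff_zero]
    ring
  · have h1 : (derivative (derivative P) * X ^ 2).coeff (0 + 1) = 0 := by simp [coeff_mul_X_pow']
    rw [coeff_add, coeff_sub, coeff_sub, h1, coeff_C_mul, coeff_C_mul, coeff_mul_X]
    simp only [coeff_derivative]
    push_cast
    ring
  · simp only [coeff_add, coeff_sub, coeff_C_mul, coeff_mul_X_pow, coeff_mul_X, coeff_derivative]
    push_cast
    ring

/-- The equation is a descending recursion for the coefficients with factor (n-k)(n+k+2g), which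
nonresonance keeps nonzero. Only the top coefficient is free; the one of degree n-1 is forced to
vanish. -/
theorem eq_of_gegOp_eq_zero {g : ℂ} {n : ℕ} {P R : ℂ[X]} (hP : P.natDegree ≤ n)
    (hR : R.natDegree ≤ n) (h1 : gegOp g n P = 0) (h2 : gegOp g n R = 0)
    (hnr : ∀ k < n, (n : ℂ) + k + 2 * g ≠ 0) (htop : P.coeff n = R.coeff n) : P = R := by
  rw [← sub_eq_zero]
  have h3 : gegOp g n (P - R) = 0 := by rw [gegOp_sub, h1, h2, sub_zero]
  -- Strong induction on the distance j below the top; the recursion relates degree k to degree k +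
  -- 2.
  have hz : ∀ j k, n ≤ k + j → (P - R).coeff k = 0 := by
    intro j
    induction j using Nat.strong_induction_on with
    | _ j ih =>
      intro k hk
      rcases lt_trichotomy k n with h | h | h
      · have h4 := coeff_gegOp g n (P - R) k
        rw [h3, coeff_zero, ih (j - 1) (by omega) (k + 2) (by omega), mul_zero, zero_add] at h4
        have h5 : (n : ℂ) - k ≠ 0 := by
          rw [sub_ne_zero]
          exact_mod_cast h.ne'
        exact (mul_eq_zero.mp h4.symm).resolve_left (mul_ne_zero h5 (hnr k h))
      · rw [h, coeff_sub, htop, sub_self]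
      · exact coeff_eq_zero_of_natDegree_lt
          (((natDegree_sub_le _ _).trans (max_le hP hR)).trans_lt h)
  ext k
  exact hz n k (by omega)

end Gegenbauer

/-! ### The leading coefficient of the transform at `Q = 0` -/

/-- `ζ^N P(cos y)` with `e^{iy} = ζ w`, as a polynomial in `ζ`. -/
def scaledEval (P : Polynomial ℂ) (N : ℕ) (w ζ : ℂ) : ℂ :=
  ∑ k ∈ Finset.range (N + 1), P.coeff k * ζ ^ (N - k) * ((w⁻¹ + ζ ^ 2 * w) / 2) ^ k

lemma scaledEval_eq {P : Polynomial ℂ} {N : ℕ} (hP : P.natDegree ≤ N) {ζ y w : ℂ} (hζ : ζ ≠ 0)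
    (hy : cexp (I * y) = ζ * w) : scaledEval P N w ζ = ζ ^ N * P.eval (Complex.cos y) := by
  have hc : Complex.cos y = (ζ * w + (ζ * w)⁻¹) / 2 := by
    rw [← hy, ← Complex.exp_neg, Complex.cos]
    ring_nf
  rw [scaledEval, Polynomial.eval_eq_sum_range' (Nat.lt_succ_of_le hP), Finset.mul_sum]
  refine Finset.sum_congr rfl fun k hk => ?_
  have hk' : k ≤ N := Nat.lt_succ_iff.mp (Finset.mem_range.mp hk)
  have e : (w⁻¹ + ζ ^ 2 * w) / 2 = ζ * Complex.cos y := by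
    rw [hc, mul_inv]
    field_simp
    ring
  rw [e, mul_pow, ← Nat.sub_add_cancel hk', pow_add, Nat.sub_add_cancel hk']
  ring

lemma scaledEval_zero (P : Polynomial ℂ) (N : ℕ) (w : ℂ) :
    scaledEval P N w 0 = P.coeff N * (w⁻¹ / 2) ^ N := by
  rw [scaledEval, Finset.sum_eq_single N]
  · simp
  · intro k hk hkN
    have : N - k ≠ 0 := by
      have := Finset.mem_range.mp hk
      omega
    rw [zero_pow this]
    ring
  · intro h
    simp at h

lemma cosSeries_zero (p : ℕ → Polynomial ℂ) (y : ℂ) :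
    cosSeries p (y, 0) = (p 0).eval (Complex.cos y) := by
  rw [cosSeries, tsum_eq_single 0]
  · simp
  · intro ℓ hℓ
    simp [hℓ]

lemma upperLog_zero (x : ℂ) : upperLog (x, 0) = Complex.log (1 - cexp (2 * I * x)) := by
  simp [upperLog, logTheta, logQPoch]

lemma iteratedDeriv_one_sub_cpow (s : ℝ) (m : ℕ) {w : ℂ} (hw : ‖w‖ < 1) :
    iteratedDeriv m (fun w => cexp (-s * Complex.log (1 - w))) w =
      poch s m * cexp (-(s + m) * Complex.log (1 - w)) := by
  induction m generalizing w with
  | zero => simp [poch]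
  | succ m ih =>
    rw [iteratedDeriv_succ]
    have hev : iteratedDeriv m (fun w => cexp (-s * Complex.log (1 - w))) =ᶠ[𝓝 w]
        fun w => poch s m * cexp (-(s + m) * Complex.log (1 - w)) := by
      filter_upwards [isOpen_ball.mem_nhds (mem_ball_zero_iff.mpr hw)] with z hz
      exact ih (mem_ball_zero_iff.mp hz)
    rw [hev.deriv_eq]
    have hne : 1 - w ≠ 0 := one_sub_ne_zero_of_norm_lt hw
    have h1 : HasDerivAt (fun w : ℂ => 1 - w) (-1) w := by
      simpa using (hasDerivAt_id w).const_sub 1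
    have h2 := (((h1.clog (one_sub_mem_slitPlane hw)).const_mul (-((s : ℂ) + m))).cexp).const_mul
      (poch s m : ℂ)
    rw [h2.deriv, poch_succ]
    have e : cexp (-((s : ℂ) + (m + 1 : ℕ)) * Complex.log (1 - w)) =
        cexp (-(s + m) * Complex.log (1 - w)) / (1 - w) := by
      rw [show -((s : ℂ) + (m + 1 : ℕ)) * Complex.log (1 - w) =
        -(s + m) * Complex.log (1 - w) - Complex.log (1 - w) by push_cast; ring, Complex.exp_sub,
        Complex.exp_log hne]
    rw [e]
    push_cast
    field_simp

/-- Cauchy's formula for the m-th Taylor coefficient of (1-w)^{-s} on the circle |w| = e^{-1},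
parametrized by w = e^{i(t+i)}. -/
lemma integral_zpow_mul_one_sub_cpow (s : ℝ) (m : ℕ) :
    ∫ t in (-Real.pi)..Real.pi, (cexp (I * (t + I)) ^ m)⁻¹ *
      cexp (-s * Complex.log (1 - cexp (I * (t + I)))) =
      2 * Real.pi * (poch s m / m.factorial) := by
  set F : ℂ → ℂ := fun w => cexp (-s * Complex.log (1 - w)) with hF
  set R : ℝ := Real.exp (-1) with hR
  have hR0 : 0 < R := Real.exp_pos _
  have hR1 : R < 1 := Real.exp_lt_one_iff.mpr (by norm_num)
  have hw : ∀ t : ℝ, cexp (I * (t + I)) = circleMap 0 R t := fun t => by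
    rw [circleMap, zero_add, hR, Complex.ofReal_exp, ← Complex.exp_add]
    congr 1
    push_cast
    linear_combination I_sq
  have hd : DiffContOnCl ℂ F (ball 0 R) := by
    refine DifferentiableOn.diffContOnCl fun w hw => ?_
    rw [closure_ball _ hR0.ne', mem_closedBall_zero_iff] at hw
    have h1 : DifferentiableAt ℂ (fun w : ℂ => 1 - w) w := by fun_prop
    exact ((h1.clog (one_sub_mem_slitPlane (hw.trans_lt hR1))).const_mul
      _).cexp.differentiableWithinAt
  have h := hd.circleIntegral_one_div_sub_center_pow_smul hR0 m
  rw [iteratedDeriv_one_sub_cpow s m (by simp)] at h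
  simp only [sub_zero, Complex.log_one, mul_zero, Complex.exp_zero, mul_one, smul_eq_mul] at h
  have hper : Function.Periodic (fun t : ℝ => (cexp (I * (t + I)) ^ m)⁻¹ *
      F (cexp (I * (t + I)))) (2 * Real.pi) := fun t => by
    simp only [hw, periodic_circleMap 0 R t]
  have h2 := hper.intervalIntegral_add_eq (-Real.pi) 0
  rw [show -Real.pi + 2 * Real.pi = Real.pi by ring, zero_add] at h2
  refine h2.trans ?_
  have h3 : ∮ z in C(0, R), 1 / z ^ (m + 1) * F z = I * ∫ t in (0 : ℝ)..2 * Real.pi,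
      (cexp (I * (t + I)) ^ m)⁻¹ * F (cexp (I * (t + I))) := by
    rw [circleIntegral, ← intervalIntegral.integral_const_mul]
    refine intervalIntegral.integral_congr fun t _ => ?_
    have hne : circleMap 0 R t ≠ 0 := circleMap_ne_center hR0.ne'
    simp only [deriv_circleMap, hw, smul_eq_mul, pow_succ]
    field_simp
  rw [h3] at h
  refine mul_left_cancel₀ I_ne_zero (h.trans ?_)
  ring

/-- The variables separate x from the contour: as ζ → 0, that is Im x → ∞, only the power (ζw)^κ, a
constant and (1-w)^{-s} survive. -/
lemma exp_logKernel_zero (g s : ℂ) (κ : ℤ) (hs : s = 2 * g + κ) {x y w ζ : ℂ}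
    (hx : cexp (I * x) = ζ) (hy : cexp (I * y) = ζ * w) :
    cexp (logKernel g s (x, 0, y)) = (ζ * w) ^ κ * cexp (g * (Real.pi * I - (Real.log 4 : ℂ)) +
      s * (Real.log 4 : ℂ)) * cexp (2 * g * Complex.log (1 - ζ ^ 2 * w ^ 2) -
        s * Complex.log (1 - ζ ^ 2 * w)) * cexp (-s * Complex.log (1 - w)) := by
  have e1 : cexp (2 * I * y) = ζ ^ 2 * w ^ 2 := by
    rw [← mul_pow, ← hy, ← Complex.exp_nat_mul]
    congr 1; push_cast; ring
  have e2 : cexp (2 * I * ((y + x) / 2)) = ζ ^ 2 * w := by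
    rw [show 2 * I * ((y + x) / 2) = I * x + I * y by ring, Complex.exp_add, hx, hy]
    ring
  have hζ : ζ ≠ 0 := hx ▸ Complex.exp_ne_zero _
  have e3 : cexp (2 * I * ((y - x) / 2)) = w := by
    rw [show 2 * I * ((y - x) / 2) = I * y - I * x by ring, Complex.exp_sub, hx, hy]
    field_simp
  rw [← hy, ← Complex.exp_int_mul, ← Complex.exp_add, ← Complex.exp_add, ← Complex.exp_add]
  simp only [logKernel, upperLog_zero, e1, e2, e3]
  congr 1
  rw [hs]
  ring

/-- Along x = iX with ζ = e^{-X}, both sides multiplied by ζ^m extend continuously to ζ = 0. There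
the left side retains its top coefficient, and the right side becomes a Taylor coefficient of
(1-w)^{-(2g+κ)}. -/
theorem coeff_transform_zero {g : ℝ} {κ : ℤ} {n m : ℕ} {p p' : ℕ → Polynomial ℂ}
    (hm : (m : ℤ) = n - κ) (hp : (p 0).natDegree ≤ n) (hp' : (p' 0).natDegree ≤ m)
    (h : ∀ ε : ℝ, ∀ x ∈ contourBase ε,
      reducedTransform g κ (cosSeries p) ε x = cosSeries p' x) :
    (p' 0).coeff m / 2 ^ m = cexp (g * (Real.pi * I - (Real.log 4 : ℂ)) +
      (2 * g + κ) * (Real.log 4 : ℂ)) * ((p 0).coeff n / 2 ^ n) *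
      (2 * Real.pi * (poch (2 * g + κ) m / m.factorial)) := by
  set s : ℂ := 2 * (g : ℂ) + κ with hs
  set c : ℂ := cexp (g * (Real.pi * I - (Real.log 4 : ℂ)) + s * (Real.log 4 : ℂ)) with hc
  set w : ℝ → ℂ := fun t => cexp (I * (t + I)) with hw
  have hwn : ∀ t, ‖w t‖ < 1 := fun t => by
    rw [hw, Complex.norm_exp]
    exact Real.exp_lt_one_iff.mpr (by simp)
  have hw0 : ∀ t, w t ≠ 0 := fun t => Complex.exp_ne_zero _
  have hwc : Continuous w := by fun_prop
  set G : ℝ → ℝ → ℂ := fun ζ t => w t ^ κ * c * cexp (2 * g * Complex.log (1 - (ζ : ℂ) ^ 2 * w t ^ 2) -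
        s * Complex.log (1 - (ζ : ℂ) ^ 2 * w t)) * cexp (-s * Complex.log (1 - w t)) *
        scaledEval (p 0) n (w t) ζ with hG
  have hkey : ∀ ζ : ℝ, 0 < ζ → ζ < 1 →
      scaledEval (p' 0) m 1 ζ = ∫ t in (-Real.pi)..Real.pi, G ζ t := by
    intro ζ h0 h1
    set X : ℝ := -Real.log ζ with hX
    have hX0 : 0 < X := neg_pos.mpr (Real.log_neg h0 h1)
    have hζ : (ζ : ℂ) ≠ 0 := by exact_mod_cast h0.ne'
    have hx : cexp (I * (X * I)) = ζ := by
      rw [show I * (X * I) = ((Real.log ζ : ℝ) : ℂ) by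
        rw [hX]; push_cast; linear_combination -(Real.log ζ : ℂ) * I_sq, ← Complex.ofReal_exp,
        Real.exp_log h0]
    -- At height X + 1 one has e^{iy} = ζ w(t) with w(t) independent of ζ, so the limit ζ → 0 can be
    -- taken under the integral.
    have hmem : ((X : ℂ) * I, (0 : ℂ)) ∈ contourBase (X + 1) := by
      refine ⟨?_, ?_⟩
      · simp [abs_of_pos hX0]
      · simp
    have h2 := h (X + 1) _ hmem
    rw [cosSeries_zero] at h2
    rw [scaledEval_eq hp' hζ (y := X * I) (by rw [hx, mul_one]), ← h2, reducedTransform, lineIntegral,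
      ← intervalIntegral.integral_const_mul]
    refine intervalIntegral.integral_congr fun t _ => ?_
    have hy : cexp (I * (t + ((X + 1 : ℝ) : ℂ) * I)) = ζ * w t := by
      rw [← hx, hw, ← Complex.exp_add]
      congr 1
      push_cast
      ring
    simp only [kernelFn, hG]
    rw [exp_logKernel_zero g _ κ rfl hx hy, cosSeries_zero, scaledEval_eq hp hζ hy, mul_zpow]
    have hn : (ζ : ℂ) ^ n = (ζ : ℂ) ^ m * (ζ : ℂ) ^ κ := by
      rw [← zpow_natCast, ← zpow_natCast, ← zpow_add₀ hζ, hm]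
      congr 1
      ring
    rw [hn]
    ring
  have hcL : ContinuousAt (fun ζ : ℝ => scaledEval (p' 0) m 1 ζ) 0 := by
    simp only [scaledEval]
    fun_prop
  have hcR : ContinuousAt (fun ζ : ℝ => ∫ t in (-Real.pi)..Real.pi, G ζ t) 0 := by
    refine (continuousOn_intervalIntegral (U := Ioo (-1 : ℝ) 1) ?_).continuousAt
      (Ioo_mem_nhds (by norm_num) (by norm_num))
    rintro ⟨ζ, t⟩ ⟨hζ, -⟩
    refine ContinuousAt.continuousWithinAt ?_
    have hζ1 : ‖(ζ : ℂ)‖ < 1 := by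
      rw [Complex.norm_real, Real.norm_eq_abs]
      exact abs_lt.mpr hζ
    have a1 : ‖(ζ : ℂ) ^ 2 * w t‖ < 1 := by
      rw [norm_mul, norm_pow]
      have := hwn t
      have h3 := norm_nonneg (w t)
      have h4 := norm_nonneg (ζ : ℂ)
      nlinarith [mul_nonneg h4 h4]
    have a2 : ‖(ζ : ℂ) ^ 2 * w t ^ 2‖ < 1 := by
      rw [pow_two (w t), ← mul_assoc, norm_mul]
      have := hwn t
      have h3 := norm_nonneg (w t)
      nlinarith [norm_nonneg ((ζ : ℂ) ^ 2 * w t)]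
    have c0 : ContinuousAt (fun q : ℝ × ℝ => w q.2) (ζ, t) := (hwc.comp continuous_snd).continuousAt
    have c1 : ContinuousAt (fun q : ℝ × ℝ => w q.2 ^ κ) (ζ, t) := c0.zpow₀ κ (Or.inl (hw0 t))
    have ci : ContinuousAt (fun q : ℝ × ℝ => (w q.2)⁻¹) (ζ, t) := c0.inv₀ (hw0 t)
    have cz : ContinuousAt (fun q : ℝ × ℝ => (q.1 : ℂ)) (ζ, t) := by fun_prop
    have c2 : ContinuousAt (fun q : ℝ × ℝ => Complex.log (1 - (q.1 : ℂ) ^ 2 * w q.2 ^ 2)) (ζ, t) :=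
      ContinuousAt.clog (by fun_prop) (one_sub_mem_slitPlane a2)
    have c3 : ContinuousAt (fun q : ℝ × ℝ => Complex.log (1 - (q.1 : ℂ) ^ 2 * w q.2)) (ζ, t) :=
      ContinuousAt.clog (by fun_prop) (one_sub_mem_slitPlane a1)
    have c4 : ContinuousAt (fun q : ℝ × ℝ => Complex.log (1 - w q.2)) (ζ, t) :=
      ContinuousAt.clog (by fun_prop) (one_sub_mem_slitPlane (hwn t))
    simp only [hG, scaledEval]
    fun_prop
  have h0 : scaledEval (p' 0) m 1 ((0 : ℝ) : ℂ) = ∫ t in (-Real.pi)..Real.pi, G 0 t := by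
    refine tendsto_nhds_unique (hcL.tendsto.mono_left (nhdsWithin_le_nhds (s := Ioi 0)))
      ((hcR.tendsto.mono_left (nhdsWithin_le_nhds (s := Ioi 0))).congr' ?_)
    filter_upwards [Ioo_mem_nhdsGT one_pos] with ζ hζ
    exact (hkey ζ hζ.1 hζ.2).symm
  have hG0 : ∀ t, G 0 t = c * ((p 0).coeff n / 2 ^ n) *
      ((w t ^ m)⁻¹ * cexp (-((2 * g + κ : ℝ) : ℂ) * Complex.log (1 - w t))) := by
    intro t
    have hn : w t ^ κ * ((w t)⁻¹) ^ n = (w t ^ m)⁻¹ := by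
      rw [← zpow_natCast, ← zpow_natCast, hm, inv_zpow', ← zpow_add₀ (hw0 t), ← zpow_neg]
      congr 1
      ring
    simp only [hG, ofReal_zero, scaledEval_zero]
    rw [← hn, hs, div_pow]
    push_cast
    simp
    ring
  rw [ofReal_zero, scaledEval_zero] at h0
  simp only [hG0] at h0
  rw [intervalIntegral.integral_const_mul, integral_zpow_mul_one_sub_cpow] at h0
  rw [← h0]
  simp [div_eq_mul_inv]

/-! ### The limit `Q → 0` of the equation -/

lemma lamSq_zero : lamSq 0 = 0 := by simp [lamSq]

lemma continuousAt_lamSq_zero : ContinuousAt lamSq 0 := by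
  have h : ContinuousOn lamSq (ball 0 (1 / 2)) := by
    refine continuousOn_tsum (u := fun m : ℕ => (1 / 2 : ℝ) ^ m * 4) (fun m Q hQ => ?_)
      (summable_geometric_two.mul_right 4) fun m Q hQ => ?_
    · have h1 : ‖Q ^ (m + 1)‖ < 1 := by
        rw [norm_pow]
        exact pow_lt_one₀ (norm_nonneg _) ((mem_ball_zero_iff.mp hQ).trans (by norm_num))
          (Nat.succ_ne_zero m)
      refine ContinuousAt.continuousWithinAt ?_
      refine ContinuousAt.div (by fun_prop) (by fun_prop) ?_
      exact pow_ne_zero 2 (one_sub_ne_zero_of_norm_lt h1)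
    · have hQ' : ‖Q‖ ≤ 1 / 2 := (mem_ball_zero_iff.mp hQ).le
      have h1 : ‖Q ^ (m + 1)‖ ≤ 1 / 2 := by
        rw [norm_pow, pow_succ]
        have : ‖Q‖ ^ m ≤ 1 := pow_le_one₀ (norm_nonneg _) (by linarith)
        nlinarith [norm_nonneg Q]
      have h2 : 1 / 2 ≤ ‖1 - Q ^ (m + 1)‖ := by
        have := norm_sub_norm_le (1 : ℂ) (Q ^ (m + 1))
        rw [norm_one] at this
        linarith
      have h3 : ‖Q ^ (m + 1)‖ ≤ (1 / 2) ^ m := by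
        rw [norm_pow, pow_succ]
        have h4 : ‖Q‖ ^ m ≤ (1 / 2) ^ m := by gcongr
        have h5 : 0 ≤ ‖Q‖ ^ m := by positivity
        nlinarith [norm_nonneg Q]
      rw [norm_div, norm_pow (1 - _), div_le_iff₀ (pow_pos (by linarith) 2)]
      have h6 : (1 : ℝ) ≤ 4 * ‖1 - Q ^ (m + 1)‖ ^ 2 := by nlinarith
      calc _ ≤ (1 / 2 : ℝ) ^ m * 1 := by rw [mul_one]; exact h3
        _ ≤ (1 / 2 : ℝ) ^ m * (4 * ‖1 - Q ^ (m + 1)‖ ^ 2) := by gcongr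
        _ = _ := by ring
  exact h.continuousAt (ball_mem_nhds 0 (by norm_num))

lemma mem_stripQ_zero (x : ℂ) : (x, (0 : ℂ)) ∈ stripQ := by
  show ‖(0 : ℂ)‖ * _ < 1
  simp

lemma logTheta_zero (x : ℂ) : logTheta (x, 0) = 0 := by simp [logTheta, logQPoch]

lemma rho_zero (x : ℂ) : rho (x, 0) = 0 := by
  simp [rho, dfst, logTheta_zero]

lemma rho'_zero (x : ℂ) : rho' (x, 0) = 0 := by
  simp [rho', dfst, rho_zero]

lemma continuousAt_reducedOp_zero (κ g : ℂ) {f : ℂ × ℂ → ℂ} {x : ℂ} (hf : AnalyticAt ℂ f (x, 0))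
    (hx : Complex.sin x ≠ 0) : ContinuousAt (fun Q => reducedOp κ g f (x, Q)) 0 := by
  have hc : ∀ F : ℂ × ℂ → ℂ, AnalyticAt ℂ F (x, 0) → ContinuousAt (fun Q => F (x, Q)) 0 :=
    fun F hF => ContinuousAt.comp (f := fun Q => (x, Q)) hF.continuousAt
      (Continuous.prodMk_right x).continuousAt
  have a1 := hc _ hf
  have a2 := hc _ hf.dfst
  have a3 := hc _ hf.dfst.dfst
  have a4 := hc _ hf.dsnd
  have a5 := hc _ (analyticAt_phi (mem_stripQ_zero x) hx)
  have a6 := hc _ (analyticAt_phi' (mem_stripQ_zero x) hx)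
  have a7 := continuousAt_lamSq_zero
  simp only [reducedOp]
  fun_prop

/-- At Q = 0 one has φ = cot x and φ' + φ² = -1, so the terms κg/2 cancel. N is a free parameter:
the term N(N+2g) added by `gegOp` is restored in (N+g)². -/
lemma reducedOp_zero (κ g : ℂ) (N : ℕ) {f : ℂ × ℂ → ℂ} {P : Polynomial ℂ}
    (hf : ∀ x, f (x, 0) = P.eval (Complex.cos x)) {x : ℂ} (hx : Complex.sin x ≠ 0) :
    reducedOp κ g f (x, 0) = -(gegOp g N P).eval (Complex.cos x) +
      ((N + g) ^ 2 - g * (g - 1) / 3) * P.eval (Complex.cos x) := by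
  have hd : ∀ (R : Polynomial ℂ) (x : ℂ), HasDerivAt (fun x => R.eval (Complex.cos x))
      (R.derivative.eval (Complex.cos x) * -Complex.sin x) x := fun R x =>
    HasDerivAt.comp (h₂ := fun z => R.eval z) x (R.hasDerivAt _) (Complex.hasDerivAt_cos x)
  have h1 : ∀ x, dfst f (x, 0) = P.derivative.eval (Complex.cos x) * -Complex.sin x := fun x => by
    simp only [dfst, hf]
    exact (hd P x).deriv
  have h2 : dfst (dfst f) (x, 0) = P.derivative.derivative.eval (Complex.cos x) * Complex.sin x ^ 2 -
      P.derivative.eval (Complex.cos x) * Complex.cos x := by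
    rw [dfst]
    simp only [h1]
    refine ((hd P.derivative x).mul (Complex.hasDerivAt_sin x).neg).deriv.trans ?_
    simp only [Pi.neg_apply]
    ring
  rw [reducedOp, h1, h2, hf]
  simp only [phi, phi', rho_zero, rho'_zero, lamSq_zero, gegOp, Polynomial.eval_add,
    Polynomial.eval_sub, Polynomial.eval_mul, Polynomial.eval_C, Polynomial.eval_X,
    Polynomial.eval_pow, Polynomial.eval_one]
  have hs := Complex.sin_sq_add_cos_sq x
  have e : (-1 / Complex.sin x ^ 2 + 0 + (Complex.cos x / Complex.sin x + 0) ^ 2) = -1 := by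
    field_simp
    linear_combination hs
  rw [e]
  field_simp
  linear_combination (-72 * P.derivative.derivative.eval (Complex.cos x)) * hs

lemma eq_zero_of_eval_cos {P : Polynomial ℂ}
    (h : ∀ x ∈ Ioo 0 Real.pi, P.eval (Complex.cos (x : ℝ)) = 0) : P = 0 := by
  refine Polynomial.eq_zero_of_infinite_isRoot P ?_
  have hinj : InjOn (fun x : ℝ => Complex.cos x) (Ioo 0 Real.pi) := by
    intro a ha b hb hab
    simp only [← Complex.ofReal_cos] at hab
    exact Real.injOn_cos ⟨ha.1.le, ha.2.le⟩ ⟨hb.1.le, hb.2.le⟩ (Complex.ofReal_injective hab)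
  refine ((Ioo_infinite Real.pi_pos).image hinj).mono ?_
  rintro _ ⟨x, hx, rfl⟩
  exact h x hx

lemma continuousAt_energyShiftQ_zero (g κ : ℂ) : ContinuousAt (energyShiftQ g κ) 0 := by
  have := continuousAt_lamSq_zero
  unfold energyShiftQ
  fun_prop

/-- Nothing is assumed about E as Q → 0. It is eliminated by evaluating the equation for f at a
point where the limit polynomial does not vanish. The limiting eigenvalues agree because m + (g+κ) =
n + g. -/
theorem gegOp_eq_zero_of_reducedOp {κ g : ℂ} {n m : ℕ} {P R : Polynomial ℂ} {f h : ℂ × ℂ → ℂ}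
    (hmn : (m : ℂ) = n - κ) (hf : AnalyticOnNhd ℂ f stripQ) (hh : AnalyticOnNhd ℂ h stripQ)
    (hP : ∀ x, f (x, 0) = P.eval (Complex.cos x)) (hR : ∀ x, h (x, 0) = R.eval (Complex.cos x))
    (hP0 : P ≠ 0) (hPg : gegOp g n P = 0)
    (hE : ∀ Q : ℝ, 0 < Q → Q < 1 → ∃ E : ℂ, ∀ x : ℝ, Real.sin x ≠ 0 →
      reducedOp κ g f (x, Q) = E * f (x, Q) ∧
      reducedOp κ (g + κ) h (x, Q) = (E + energyShiftQ g κ Q) * h (x, Q)) :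
    gegOp (g + κ) m R = 0 := by
  obtain ⟨x₀, hx₀, hPx⟩ : ∃ x₀ ∈ Ioo 0 Real.pi, P.eval (Complex.cos (x₀ : ℝ)) ≠ 0 := by
    by_contra! hcon
    exact hP0 (eq_zero_of_eval_cos hcon)
  have hsin : ∀ x ∈ Ioo 0 Real.pi, Real.sin x ≠ 0 := fun x hx =>
    (Real.sin_pos_of_pos_of_lt_pi hx.1 hx.2).ne'
  have hsinC : ∀ x ∈ Ioo 0 Real.pi, Complex.sin (x : ℂ) ≠ 0 := fun x hx => by
    exact_mod_cast hsin x hx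
  refine eq_zero_of_eval_cos fun x hx => ?_
  have hc : ∀ (F : ℂ × ℂ → ℂ) (x : ℂ), AnalyticOnNhd ℂ F stripQ →
      ContinuousAt (fun Q => F (x, Q)) 0 := fun F x hF =>
    ContinuousAt.comp (f := fun Q => (x, Q)) (hF _ (mem_stripQ_zero x)).continuousAt
      (Continuous.prodMk_right x).continuousAt
  have c1 := (continuousAt_reducedOp_zero κ (g + κ) (hh _ (mem_stripQ_zero x)) (hsinC x hx)).mul
    (hc f x₀ hf)
  have c2 := ((continuousAt_reducedOp_zero κ g (hf _ (mem_stripQ_zero x₀)) (hsinC x₀ hx₀)).add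
    ((continuousAt_energyShiftQ_zero g κ).mul (hc f x₀ hf))).mul (hc h x hh)
  have hlim : Tendsto (fun r : ℝ => (r : ℂ)) (𝓝[>] 0) (𝓝 0) := by
    have := Complex.continuous_ofReal.tendsto 0
    rw [ofReal_zero] at this
    exact this.mono_left nhdsWithin_le_nhds
  -- Both functions of Q are continuous at 0 and agree for small Q > 0, where each equals (E +
  -- shift) · f(x₀, Q) · h(x, Q).
  have heq := tendsto_nhds_unique (c1.tendsto.comp hlim) ((c2.tendsto.comp hlim).congr' (by
    filter_upwards [Ioo_mem_nhdsGT one_pos] with r hr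
    obtain ⟨E, hEr⟩ := hE r hr.1 hr.2
    simp only [Function.comp, Pi.mul_apply, Pi.add_apply]
    rw [(hEr x (hsin x hx)).2, (hEr x₀ (hsin x₀ hx₀)).1]
    ring))
  simp only [Pi.mul_apply, Pi.add_apply] at heq
  rw [reducedOp_zero κ (g + κ) m hR (hsinC x hx), reducedOp_zero κ g n hP (hsinC x₀ hx₀), hPg, hP, hR,
    energyShiftQ, lamSq_zero, Polynomial.eval_zero, hmn] at heq
  refine (mul_eq_zero.mp (?_ : _ * P.eval (Complex.cos (x₀ : ℝ)) = 0)).resolve_right hPx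
  linear_combination -heq

lemma reducedOp_congr {κ g : ℂ} {f h : ℂ × ℂ → ℂ} {p : ℂ × ℂ} (hfh : f =ᶠ[𝓝 p] h) :
    reducedOp κ g f p = reducedOp κ g h p := by
  have h1 : ∀ {f h : ℂ × ℂ → ℂ} {p : ℂ × ℂ}, f =ᶠ[𝓝 p] h → dfst f p = dfst h p := fun {f h p} e =>
    Filter.EventuallyEq.deriv_eq (eventually_slice_fst (x := p.1) (Q := p.2) e)
  have h2 : dsnd f p = dsnd h p :=
    Filter.EventuallyEq.deriv_eq (eventually_slice_snd (x := p.1) (Q := p.2) hfh)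
  have h3 : dfst f =ᶠ[𝓝 p] dfst h := hfh.eventually_nhds.mono fun q hq => h1 hq
  rw [reducedOp, reducedOp, h2, h1 hfh, h1 h3, hfh.self_of_nhds]

lemma exists_nome_sq_eq {r : ℝ} (h0 : 0 < r) (h1 : r < 1) : ∃ τ : UpperHalfPlane, nome τ ^ 2 = r := by
  have hl : 0 < -Real.log r / (2 * Real.pi) :=
    div_pos (neg_pos.mpr (Real.log_neg h0 h1)) Real.two_pi_pos
  refine ⟨⟨(-Real.log r / (2 * Real.pi) : ℝ) * I, by
    rw [Complex.im_ofReal_mul, I_im, mul_one]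
    exact hl⟩, ?_⟩
  rw [nome, ← Complex.exp_nat_mul]
  have hpi : (Real.pi : ℂ) ≠ 0 := by exact_mod_cast Real.pi_ne_zero
  have e : ((2 : ℕ) : ℂ) * ((Real.pi : ℂ) * I * (((-Real.log r / (2 * Real.pi) : ℝ) : ℂ) * I)) =
      ((Real.log r : ℝ) : ℂ) := by
    push_cast
    field_simp
    linear_combination -(Real.log r : ℂ) * I_sq
  refine (congrArg cexp e).trans ?_
  rw [← Complex.ofReal_exp, Real.exp_log h0]

/-! ### The transform in terms of the reduced functions -/

lemma logTheta1SqUpper_eq {y τ : ℂ} (hτ : 0 < τ.im) : logTheta1SqUpper y τ =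
    Real.pi * I - 2 * I * y - (Real.log 4 : ℂ) + 2 * upperLog (y, nome τ ^ 2) := by
  rw [logTheta1SqUpper, logThetaReg_eq hτ, upperLog]
  ring

lemma logTheta1Prod_eq {x y τ : ℂ} (hτ : 0 < τ.im) : logTheta1Prod x y τ =
    -(Real.log 4 : ℂ) - I * y + upperLog ((y + x) / 2, nome τ ^ 2) +
      upperLog ((y - x) / 2, nome τ ^ 2) := by
  rw [logTheta1Prod, logThetaReg_eq hτ, logThetaReg_eq hτ, upperLog, upperLog,
    show (x - y) / 2 = -((y - x) / 2) by ring, logTheta_neg, add_comm x y]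
  simp only [show 2 * I * ((y + x) / 2) = I * (y + x) by ring,
    show 2 * I * ((y - x) / 2) = I * (y - x) by ring]
  ring

/-- One half-power of θ₁(y)² comes from the kernel and one from ψ; they merge into the exponent g of
`logKernel`. -/
lemma integrand_eq {g : ℝ} {κ : ℤ} {P : ℂ → ℂ → ℂ} {f : ℂ × ℂ → ℂ} {x τ : ℂ} {ε : ℝ}
    (hPf : ∀ y τ : ℂ, |y.im| < Real.pi * τ.im → P (Complex.cos y) (nome τ) = f (y, nome τ ^ 2))
    (hτ : 0 < τ.im) (hε : 0 < ε) (hετ : ε < Real.pi * τ.im) (t : ℝ) :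
    integrand g κ ε (lameFnUpper g P) x τ t =
      theta1SqPow (((g + κ) / 2 : ℝ) : ℂ) x τ / (2 * Real.pi) *
        kernelFn g (2 * g + κ) f (x, nome τ ^ 2, t + ε * I) := by
  have hy : |((t : ℂ) + ε * I).im| < Real.pi * τ.im := by
    simpa [abs_of_pos hε] using hετ
  rw [integrand, kernel, lameFnUpper, hPf _ _ hy, logTheta1SqUpper_eq hτ, logTheta1Prod_eq hτ,
    kernelFn, logKernel, Complex.exp_sub]
  have e : ∀ L : ℂ, cexp (g * L) = cexp (((g / 2 : ℝ) : ℂ) * L) * cexp (((g / 2 : ℝ) : ℂ) * L) :=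
    fun L => by
      rw [← Complex.exp_add]
      congr 1
      push_cast
      ring
  rw [e]
  push_cast
  ring

lemma transform_eq {g : ℝ} {κ : ℤ} {n : ℕ} {P : ℂ → ℂ → ℂ} {f : ℂ × ℂ → ℂ} {x τ : ℂ} {ε : ℝ}
    (hPf : ∀ y τ : ℂ, |y.im| < Real.pi * τ.im → P (Complex.cos y) (nome τ) = f (y, nome τ ^ 2))
    (hτ : 0 < τ.im) (hε : 0 < ε) (hετ : ε < Real.pi * τ.im) :
    transform g κ n ε (lameFnUpper g P) x τ = theta1SqPow (((g + κ) / 2 : ℝ) : ℂ) x τ *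
      (normConst g κ n / (2 * Real.pi) * reducedTransform g κ f ε (x, nome τ ^ 2)) := by
  rw [transform, intervalIntegral.integral_congr fun t _ => integrand_eq hPf hτ hε hετ t,
    intervalIntegral.integral_const_mul, reducedTransform, lineIntegral]
  ring

lemma mem_contourBase_nome {x τ : ℂ} {ε : ℝ} :
    (x, nome τ ^ 2) ∈ contourBase ε ↔ |x.im| < ε ∧ ε < Real.pi * τ.im := by
  refine and_congr Iff.rfl ?_
  simp only
  rw [norm_pow, norm_nome, ← Real.exp_nat_mul, ← Real.exp_add, Real.exp_lt_one_iff]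
  push_cast
  constructor <;> intro h <;> linarith

lemma energyShift_eq (g : ℝ) (κ : ℤ) (τ : ℂ) :
    energyShift g κ τ = energyShiftQ g κ (nome τ ^ 2) := by
  rw [energyShift, energyShiftQ, etaOverPi_eq]
  ring

lemma gegenbauerTop_ne_zero {g : ℝ} (hg : 0 ≤ g) (n : ℕ) : gegenbauerTop g n ≠ 0 := by
  rw [gegenbauerTop]
  split_ifs with h1 h2
  · norm_num
  · norm_num
  · have h3 : 0 < g := lt_of_le_of_ne hg (Ne.symm h1)
    exact (div_pos (ascPochhammer_pos n g h3) (by positivity)).ne'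

lemma poch_eq_zero {a : ℝ} {m j : ℕ} (hj : j < m) (ha : a = -(j : ℝ)) : poch a m = 0 := by
  induction m with
  | zero => omega
  | succ m ih =>
    rw [poch_succ]
    rcases Nat.lt_succ_iff_lt_or_eq.mp hj with h | h
    · rw [ih h, zero_mul]
    · rw [ha, h]; ring

/-- A resonance would mean 2g + κ = -(n+k). If n + k < m, this makes a factor of (2g+κ)_m vanish.
Otherwise the expression equals n + (n+k-m) + 2g, a sum of nonnegative terms that could vanish only
for k = m. -/
lemma add_ne_zero_of_poch_ne_zero {g : ℝ} (hg : 0 ≤ g) {κ : ℤ} {n m : ℕ} (hm : (m : ℤ) = n - κ)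
    (hN : poch (2 * g + κ) m ≠ 0) {k : ℕ} (hk : k < m) : (m : ℝ) + k + 2 * (g + κ) ≠ 0 := by
  intro h
  have hm' : (m : ℝ) = n - κ := by exact_mod_cast hm
  have h1 : m ≤ n + k := by
    by_contra! hlt
    refine hN (poch_eq_zero hlt ?_)
    push_cast
    linarith
  have h2 : (m : ℝ) ≤ n + k := by exact_mod_cast h1
  have h3 : (k : ℝ) < m := by exact_mod_cast hk
  have h4 : (0 : ℝ) ≤ n := Nat.cast_nonneg n
  linarith

lemma normConst_mul (g : ℝ) (hg : 0 ≤ g) (κ : ℤ) (n m : ℕ) (hm : (m : ℤ) = n - κ)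
    (hN : poch (2 * g + κ) m ≠ 0) :
    normConst g κ n * (cexp (g * (Real.pi * I - (Real.log 4 : ℂ)) + (2 * g + κ) * (Real.log 4 : ℂ)) *
      gegenbauerTop g n * (poch (2 * g + κ) m / m.factorial)) = gegenbauerTop (g + κ) m := by
  have hm' : (n - κ : ℤ).toNat = m := by rw [← hm]; simp
  have h1 : (((2 : ℝ) ^ (-(2 * (g + κ))) : ℝ) : ℂ) = cexp (-((g + κ) * (Real.log 4 : ℂ))) := by
    rw [Real.rpow_def_of_pos two_pos, show (4 : ℝ) = 2 ^ 2 by norm_num, Real.log_pow,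
      Complex.ofReal_exp]
    congr 1
    push_cast
    ring
  have h2 : (poch (2 * g + κ) m : ℂ) ≠ 0 := by exact_mod_cast hN
  have h3 : (gegenbauerTop g n : ℂ) ≠ 0 := by exact_mod_cast gegenbauerTop_ne_zero hg n
  have h4 : (m.factorial : ℂ) ≠ 0 := by exact_mod_cast m.factorial_ne_zero
  have h5 : cexp (-((Real.pi : ℂ) * I * (g : ℂ))) * cexp (-((g + κ) * (Real.log 4 : ℂ))) *
      cexp (g * (Real.pi * I - (Real.log 4 : ℂ)) + (2 * g + κ) * (Real.log 4 : ℂ)) = 1 := by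
    rw [← Complex.exp_add, ← Complex.exp_add, ← Complex.exp_zero]
    congr 1
    ring
  rw [normConst, hm', Complex.ofReal_div, Complex.ofReal_mul, h1]
  push_cast
  generalize (poch (2 * g + κ) m : ℂ) = a at h2 ⊢
  generalize cexp (g * (Real.pi * I - (Real.log 4 : ℂ)) + (2 * g + κ) * (Real.log 4 : ℂ)) = b at h5 ⊢
  field_simp
  linear_combination (gegenbauerTop (g + κ) m : ℂ) * h5

lemma analyticAt_nome_sq (p : ℂ × ℂ) : AnalyticAt ℂ (fun p : ℂ × ℂ => (p.1, nome p.2 ^ 2)) p := by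
  refine analyticAt_fst.prod (AnalyticAt.pow ?_ 2)
  exact (analyticAt_const.mul analyticAt_snd).cexp

lemma isOpen_strip (ε : ℝ) :
    IsOpen {p : ℂ × ℂ | |p.1.im| < ε ∧ ε < Real.pi * p.2.im} :=
  (isOpen_lt (f := fun p : ℂ × ℂ => |p.1.im|) (by fun_prop) continuous_const).inter
    (isOpen_lt (g := fun p : ℂ × ℂ => Real.pi * p.2.im) continuous_const (by fun_prop))

/-- For a natural exponent the power is an ordinary power of sin², with no branch to choose, so the
zeros of the sine cause no trouble. -/
lemma analyticAt_theta1SqPow {s : ℂ} {x τ : ℂ} (hτ : 0 < τ.im) (hx : |x.im| < Real.pi * τ.im)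
    (h : Real.sin x.re ≠ 0 ∨ ∃ m : ℕ, s = m) :
    AnalyticAt ℂ (fun p : ℂ × ℂ => theta1SqPow s p.1 p.2) (x, τ) := by
  have hp : (x, nome τ ^ 2) ∈ stripQ := mem_stripQ_nome.mpr hx
  have h1 : AnalyticAt ℂ (thetaPow s) (x, nome τ ^ 2) := by
    rcases h with h | ⟨m, rfl⟩
    · exact analyticAt_thetaPow s hp h
    · refine AnalyticAt.mul ?_ (analyticAt_const.mul (analyticAt_logTheta hp)).cexp
      simp only [Complex.cpow_natCast]
      exact ((Complex.analyticAt_sin.comp analyticAt_fst).pow 2).pow m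
  refine (AnalyticAt.fun_comp (f := fun p : ℂ × ℂ => (p.1, nome p.2 ^ 2)) h1
    (analyticAt_nome_sq (x, τ))).congr ?_
  have hev : ∀ᶠ p in 𝓝 (x, τ), 0 < p.2.im :=
    (isOpen_lt (g := fun p : ℂ × ℂ => p.2.im) continuous_const (by fun_prop)).mem_nhds hτ
  filter_upwards [hev] with p hp
  exact (theta1SqPow_eq hp).symm

lemma cosSeries_C_mul (c : ℂ) (p : ℕ → Polynomial ℂ) (x : ℂ × ℂ) :
    cosSeries (fun ℓ => Polynomial.C c * p ℓ) x = c * cosSeries p x := by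
  simp only [cosSeries, Polynomial.eval_mul, Polynomial.eval_C, mul_assoc, tsum_mul_left]

lemma CosSeriesBound.C_mul {m : ℕ} {p : ℕ → Polynomial ℂ} (h : CosSeriesBound m p) (c : ℂ) :
    CosSeriesBound m fun ℓ => Polynomial.C c * p ℓ := by
  intro σ h0 h1
  obtain ⟨M, hM⟩ := h σ h0 h1
  refine ⟨‖c‖ * M, fun ℓ y => ?_⟩
  rw [Polynomial.eval_mul, Polynomial.eval_C, norm_mul]
  have := mul_le_mul_of_nonneg_left (hM ℓ y) (norm_nonneg c)
  calc _ = ‖c‖ * (‖(p ℓ).eval (Complex.cos y)‖ * σ ^ ℓ) := by ring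
    _ ≤ _ := this
    _ = _ := by ring

section

variable {g : ℝ} {κ : ℤ} {n m : ℕ} {p p' : ℕ → Polynomial ℂ}

/-- The leading polynomial of the transform is the Gegenbauer polynomial. -/
theorem normConst_mul_transform_zero (hg : 0 ≤ g) (hm : (m : ℤ) = n - κ)
    (hN : poch (2 * g + κ) m ≠ 0) (hp : CosSeriesBound n p) (hp0 : p 0 = gegenbauer g n)
    (hp' : CosSeriesBound m p') (hdeg : (p' 0).natDegree ≤ m)
    (htr : ∀ ε : ℝ, ∀ x ∈ contourBase ε,
      reducedTransform g κ (cosSeries p) ε x = cosSeries p' x)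
    (hE : ∀ τ : UpperHalfPlane, ∃ E : ℂ, ∀ x : ℝ, Real.sin x ≠ 0 →
      reducedOp κ g (cosSeries p) (x, nome τ ^ 2) = E * cosSeries p (x, nome τ ^ 2)) :
    Polynomial.C (normConst g κ n / (2 * Real.pi)) * p' 0 = gegenbauer (g + κ) m := by
  set c := normConst g κ n / (2 * (Real.pi : ℂ)) with hc
  have hpi : (Real.pi : ℂ) ≠ 0 := by exact_mod_cast Real.pi_ne_zero
  have hf := hp.analyticOnNhd_cosSeries
  have hdegn : (p 0).natDegree ≤ n := hp0 ▸ natDegree_gegenbauer_le g n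
  have hdegc : (Polynomial.C c * p' 0).natDegree ≤ m := (Polynomial.natDegree_C_mul_le _ _).trans hdeg
  have hmC : (m : ℂ) = n - κ := by exact_mod_cast hm
  -- The limit is taken along real Q in (0, 1), all of which occur as q². For each such Q the
  -- equation of the transform comes from the kernel identity.
  have hode : gegOp (g + κ) m (Polynomial.C c * p' 0) = 0 := by
    refine gegOp_eq_zero_of_reducedOp (κ := κ) (n := n) (P := p 0) (f := cosSeries p)
      (h := fun x => c * cosSeries p' x) hmC hf
      (fun x hx => analyticAt_const.mul (hp'.analyticOnNhd_cosSeries x hx))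
      (fun x => cosSeries_zero p x) (fun x => ?_) ?_ ?_ ?_
    · rw [cosSeries_zero, Polynomial.eval_mul, Polynomial.eval_C]
    · intro h0
      have h1 := coeff_gegenbauer g n
      rw [← hp0, h0, Polynomial.coeff_zero] at h1
      have h2 : (gegenbauerTop g n : ℂ) ≠ 0 := by exact_mod_cast gegenbauerTop_ne_zero hg n
      exact mul_ne_zero h2 (pow_ne_zero n two_ne_zero) h1.symm
    · rw [hp0]
      exact gegOp_gegenbauer g n
    · intro r h0 h1
      obtain ⟨τ, hτ⟩ := exists_nome_sq_eq h0 h1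
      obtain ⟨E, hEx⟩ := hE τ
      rw [hτ] at hEx
      refine ⟨E, fun x hx => ⟨hEx x hx, ?_⟩⟩
      obtain ⟨ε, hε0, hε⟩ := exists_between (mul_pos Real.pi_pos τ.im_pos)
      have hmem : ((x : ℂ), (r : ℂ)) ∈ contourBase ε := by
        rw [← hτ]
        exact mem_contourBase_nome.mpr ⟨by simpa using hε0, hε⟩
      have hev : (fun x => c * cosSeries p' x) =ᶠ[𝓝 ((x : ℂ), (r : ℂ))]
          fun x => c * reducedTransform g κ (cosSeries p) ε x := by
        filter_upwards [(isOpen_contourBase ε).mem_nhds hmem] with z hz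
        rw [htr ε z hz]
      have hrC : (r : ℂ) ≠ 0 := by exact_mod_cast h0.ne'
      rw [reducedOp_congr hev, reducedOp_const_mul, reducedOp_reducedTransform hf
        (cosSeries_add_two_pi p) hmem hrC (by exact_mod_cast hx) (E := E), htr ε _ hmem]
      · ring
      · intro y hy hyQ
        rw [← hτ] at hyQ ⊢
        rw [← hτ] at hEx
        exact reducedOp_eq_of_real hf hEx hy hyQ
  have htop := coeff_transform_zero hm hdegn hdeg htr
  -- Both polynomials satisfy the same nonresonant equation; the normalization constant makes their
  -- top coefficients equal.
  refine eq_of_gegOp_eq_zero (g := ((g + κ : ℝ) : ℂ)) hdegc (natDegree_gegenbauer_le _ _)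
    (by push_cast; exact hode) (gegOp_gegenbauer _ _) (fun k hk => ?_) ?_
  · have := add_ne_zero_of_poch_ne_zero hg hm hN hk
    exact_mod_cast this
  · rw [coeff_gegenbauer, Polynomial.coeff_C_mul, ← normConst_mul g hg κ n m hm hN]
    have h2 : (p' 0).coeff m = (p' 0).coeff m / 2 ^ m * 2 ^ m := by field_simp
    have h3 : (p 0).coeff n / 2 ^ n = gegenbauerTop g n := by
      rw [hp0, coeff_gegenbauer]; field_simp
    rw [h2, htop, h3, hc]
    field_simp

end

end NSLame

end

/-! ### The main theorem -/

open NSLame Filter Topology MeasureTheory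

theorem theorem1 (κ : ℤ) (n : ℕ) (hn : κ ≤ (n : ℤ)) (g : ℝ) (hg : 0 ≤ g)
    (hN : NSLame.poch (2 * g + κ) ((n : ℤ) - κ).toNat ≠ 0)
    (P : ℂ → ℂ → ℂ) (hP : NSLame.HasGegenbauerForm g n P)
    (E : UpperHalfPlane → ℂ)
    (hE : ∀ (τ : UpperHalfPlane) (x : ℝ), Real.sin x ≠ 0 →
      NSLame.LameEqAt κ g (NSLame.lameFn g P) (E τ) (x : ℂ) τ) :
    -- the integral is well defined
    (∀ (τ : UpperHalfPlane) (x : ℂ) (ε : ℝ), |x.im| < ε → ε < Real.pi * τ.im →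
      IntervalIntegrable
        (NSLame.integrand g κ ε (NSLame.lameFnUpper g P) x (τ : ℂ))
        MeasureTheory.volume (-Real.pi) Real.pi) ∧
    -- it solves the equation with parameters (κ, g + κ)
    (∀ (τ : UpperHalfPlane) (x : ℂ) (ε : ℝ), |x.im| < ε → ε < Real.pi * τ.im →
      Real.sin x.re ≠ 0 →
      NSLame.LameEqAt κ (g + κ)
        (NSLame.transform g κ n ε (NSLame.lameFnUpper g P))
        (E τ + NSLame.energyShift g κ (τ : ℂ)) x τ) ∧
    -- it is an analytic function of (x, τ); the points of πℤ are excluded unless g + κ is an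
    -- even natural number, since the prefactor is not analytic there
    (∀ (τ : UpperHalfPlane) (x : ℂ) (ε : ℝ), |x.im| < ε → ε < Real.pi * τ.im →
      (Real.sin x.re ≠ 0 ∨ ∃ m : ℕ, g + κ = 2 * m) →
      AnalyticAt ℂ
        (fun p : ℂ × ℂ => NSLame.transform g κ n ε (NSLame.lameFnUpper g P) p.1 p.2)
        (x, (τ : ℂ))) ∧
    -- it is independent of ε
    (∀ (τ : UpperHalfPlane) (x : ℂ) (ε ε' : ℝ), |x.im| < ε → ε < Real.pi * τ.im →
      |x.im| < ε' → ε' < Real.pi * τ.im →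
      NSLame.transform g κ n ε (NSLame.lameFnUpper g P) x (τ : ℂ) =
        NSLame.transform g κ n ε' (NSLame.lameFnUpper g P) x (τ : ℂ)) ∧
    -- it is of the same form, with coupling g + κ and degree n - κ
    (∃ P' : ℂ → ℂ → ℂ, NSLame.HasGegenbauerForm (g + κ) ((n : ℤ) - κ).toNat P' ∧
      ∀ (τ : UpperHalfPlane) (x : ℂ) (ε : ℝ), |x.im| < ε → ε < Real.pi * τ.im →
        NSLame.transform g κ n ε (NSLame.lameFnUpper g P) x (τ : ℂ) =
          NSLame.lameFn (g + κ) P' x (τ : ℂ)) := by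

  obtain ⟨hA, p, hp0, hdeg, hs⟩ := hP
  have hB : CosSeriesBound n p := HasGegenbauerForm.cosSeriesBound hA hdeg hs
  have hf := hB.analyticOnNhd_cosSeries
  have hper := cosSeries_add_two_pi p
  -- Only even powers of q occur, so 𝒫(cos y, q) is a function of y and Q = q².
  have hPf : ∀ y τ : ℂ, |y.im| < Real.pi * τ.im →
      P (Complex.cos y) (nome τ) = cosSeries p (y, nome τ ^ 2) := fun y τ h => by
    rw [← (hs _ _ (mem_domain_nome h)).tsum_eq, cosSeries]
    simp only [pow_mul]
  obtain ⟨m, hm⟩ : ∃ m : ℕ, (m : ℤ) = n - κ := ⟨((n : ℤ) - κ).toNat, by omega⟩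
  have hmN : ((n : ℤ) - κ).toNat = m := by omega
  rw [hmN] at hN ⊢
  have hEr : ∀ (τ : UpperHalfPlane) (x : ℝ), Real.sin x ≠ 0 →
      reducedOp κ g (cosSeries p) (x, nome τ ^ 2) = E τ * cosSeries p (x, nome τ ^ 2) := by
    intro τ x hx
    have hτ : 0 < Real.pi * (τ : ℂ).im := mul_pos Real.pi_pos τ.im_pos
    have h := (lameEqAt_iff (κ := κ) (g := g) (ψ := lameFn g P) (E := E τ) (x := (x : ℂ)) (τ := τ)
      (f := cosSeries p) (by simpa using hτ) (by simpa using hx)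
      (hf _ (mem_stripQ_nome.mpr (by simpa using hτ))) ?_).mp (hE τ x hx)
    · simpa using h
    · have ho : IsOpen {q : ℂ × ℂ | |q.1.im| < Real.pi * q.2.im} :=
        isOpen_lt (by fun_prop) (by fun_prop)
      filter_upwards [ho.mem_nhds (x := ((x : ℂ), (τ : ℂ))) (by simpa using hτ)] with q hq
      rw [lameFn, hPf _ _ hq]
  obtain ⟨p', hdeg', hB', htr⟩ := exists_cosSeries_reducedTransform (g := (g : ℂ)) (κ := κ) hB hm
  set c := normConst g κ n / (2 * (Real.pi : ℂ)) with hc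
  have hp'0 := normConst_mul_transform_zero hg hm hN hB hp0 hB' (by simpa using hdeg' 0) htr
    fun τ => ⟨E τ, hEr τ⟩
  have hpos : ∀ (τ : UpperHalfPlane) (x : ℂ) (ε : ℝ), |x.im| < ε → 0 < ε := fun τ x ε h =>
    (abs_nonneg _).trans_lt h
  -- All the conclusions on the transform are read from this factorization into the power of θ₁(x)²
  -- and a function analytic in (x, Q).
  have hT : ∀ (τ x : ℂ) (ε : ℝ), |x.im| < ε → ε < Real.pi * τ.im →
      transform g κ n ε (lameFnUpper g P) x τ = theta1SqPow (((g + κ) / 2 : ℝ) : ℂ) x τ *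
        (c * reducedTransform g κ (cosSeries p) ε (x, nome τ ^ 2)) := fun τ x ε h1 h2 => by
    have h0 : 0 < ε := (abs_nonneg _).trans_lt h1
    exact transform_eq hPf (pos_of_mul_pos_right (h0.trans h2) Real.pi_pos.le) h0 h2
  refine ⟨?_, ?_, ?_, ?_, ?_⟩
  · intro τ x ε h1 h2
    have h0 : 0 < ε := (abs_nonneg _).trans_lt h1
    rw [show integrand g κ ε (lameFnUpper g P) x (τ : ℂ) = _ from
      funext fun t => integrand_eq hPf τ.im_pos h0 h2 t]
    refine (Continuous.intervalIntegrable ?_ _ _).const_mul _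
    exact continuous_line (p := (x, nome τ ^ 2)) fun t => analyticAt_kernelFn hf
      (mem_contourDomain (mem_contourBase_nome.mpr ⟨h1, h2⟩) t)
  · intro τ x ε h1 h2 hx
    have hmem : (x, nome τ ^ 2) ∈ contourBase ε := mem_contourBase_nome.mpr ⟨h1, h2⟩
    have h := (lameEqAt_iff (κ := κ) (g := g + κ)
      (ψ := transform g κ n ε (lameFnUpper g P)) (E := E τ + energyShift g κ τ) (x := x) (τ := τ)
      (f := fun q => c * reducedTransform g κ (cosSeries p) ε q) (h1.trans h2) hx
      (analyticAt_const.mul (analyticOnNhd_reducedTransform hf ε _ hmem)) ?_).mpr ?_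
    · exact h
    · filter_upwards [(isOpen_strip ε).mem_nhds (x := (x, (τ : ℂ))) ⟨h1, h2⟩] with q hq
      exact hT q.2 q.1 ε hq.1 hq.2
    · have h3 := reducedOp_reducedTransform (g := (g : ℂ)) hf hper hmem
        (pow_ne_zero 2 (nome_ne_zero _)) (sin_ne_zero_of_re hx)
        (fun y hy hyQ => reducedOp_eq_of_real hf (hEr τ) hy hyQ)
      rw [reducedOp_const_mul, energyShift_eq]
      push_cast
      rw [h3]
      ring
  · intro τ x ε h1 h2 h3
    have hmem : (x, nome τ ^ 2) ∈ contourBase ε := mem_contourBase_nome.mpr ⟨h1, h2⟩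
    have a1 : AnalyticAt ℂ (fun q : ℂ × ℂ => theta1SqPow (((g + κ) / 2 : ℝ) : ℂ) q.1 q.2)
        (x, (τ : ℂ)) := by
      refine analyticAt_theta1SqPow τ.im_pos (h1.trans h2) (h3.imp_right ?_)
      rintro ⟨k, hk⟩
      exact ⟨k, by rw [hk]; push_cast; ring⟩
    have a2 : AnalyticAt ℂ (fun q : ℂ × ℂ =>
        c * reducedTransform g κ (cosSeries p) ε (q.1, nome q.2 ^ 2)) (x, (τ : ℂ)) :=
      analyticAt_const.mul (AnalyticAt.fun_comp (f := fun q : ℂ × ℂ => (q.1, nome q.2 ^ 2))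
        (analyticOnNhd_reducedTransform hf ε _ hmem) (analyticAt_nome_sq _))
    refine (a1.mul a2).congr ?_
    filter_upwards [(isOpen_strip ε).mem_nhds (x := (x, (τ : ℂ))) ⟨h1, h2⟩] with q hq
    exact (hT q.2 q.1 ε hq.1 hq.2).symm
  · intro τ x ε ε' h1 h2 h3 h4
    rw [hT _ _ _ h1 h2, hT _ _ _ h3 h4, reducedTransform_congr hf hper
      (mem_contourBase_nome.mpr ⟨h1, h2⟩) (mem_contourBase_nome.mpr ⟨h3, h4⟩)]
  · refine ⟨_, hasGegenbauerForm_of_cosSeriesBound (p := fun ℓ => Polynomial.C c * p' ℓ) hp'0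
      (fun ℓ => (Polynomial.natDegree_C_mul_le _ _).trans (hdeg' ℓ)) (hB'.C_mul c), ?_⟩
    intro τ x ε h1 h2
    rw [hT _ _ _ h1 h2, htr ε _ (mem_contourBase_nome.mpr ⟨h1, h2⟩), ← cosSeries_C_mul, lameFn]
    simp only [cosSeries, pow_mul]
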